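/- Let $X$ be a complex manifold of dimension $n$ and $D\subset X$ a reduced divisor with normal crossings: around every point there are holomorphic coordinates $z_1,\dots,z_n$ and a set $I$ of indices with $D=\{\prod_{i\in I}z_i=0\}$ (log coordinates). Let $T_X(-\log D)$ be the bundle with local frame $\varepsilon_i=z_i\,\partial/\partial z_i$ $(i\in I)$, $\varepsilon_i=\partial/\partial z_i$ $(i\notin I)$, let $P=P(T_X(-\log D))$ be the bundle of lines in it, and let $L$ be the tautological bundle on $P$, i.e. the dual of the tautological line subbundle $L^{-1}$ of the pullback of $T_X(-\log D)$. Let $\|\ \|_{\log}$ be a $C^\infty$ Hermitian metric on $T_X|_{X\setminus D}=T_X(-\log D)|_{X\setminus D}$, complete or not. It induces a metric on $L$ off the preimage of $D$, with Chern form $c_1(\overline L)=\frac{i}{2\pi}\partial\bar\partial\log\|\xi\|_{\log}^2$, where $(z,[\xi])$ are the coordinates of $P$ over log coordinates $z$ and $\|\xi\|_{\log}$ is the norm of $\sum_i\xi_i\varepsilon_i(z)$. Suppose that it is mildly singular along $D$: around every point of $D$ there are log coordinates, a neighbourhood $V$ and constants $C>0$, $N\in\mathbb N$ such that over $V\setminus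 D$, with $\rho=1+\sum_{i\in I}|\log|z_i||$, $$C^{-1}\rho^{-N}|\xi|^2\le\|\xi\|_{\log}^2\le C\rho^{N}|\xi|^2,\qquad c_1(\overline L)\ \ge\ -C\,\Big(\sum_{i\in I}\frac{|dz_i|^2}{|z_i|^2(1+|\log|z_i||)^2}+\sum_{i\notin I}|dz_i|^2\Big)$$ (in the second inequality a real $(1,1)$-form $\eta$ is identified with the quadratic form $v\mapsto\eta(v,iv)$). For example, $\|\ \|_{\log}$ may be the restriction of a smooth Hermitian metric on $T_X(-\log D)$, or locally the metric $\sum_{i\in I}\frac{|dz_i|^2}{|z_i|^2(\log|z_i|^2)^2}+\sum_{i\notin I}|dz_i|^2$. Let $\mathbb D=\{|z|<1\}$, let $f:\mathbb D\to X$ be holomorphic with $f(0)\notin D$ and $f_*(\partial/\partial z)(0)\ne0$, let $f':\mathbb D\to P$ be the holomorphic map whose value at a general point $z$ is the line spanned by $f_*(\partial/\partial z)$, and let $0<r<1$. Write $\mathbb D(t)=\{|z|<t\}$, let $\int_{\partial\mathbb D(r)}$ denote the mean over the circle $|z|=r$, let $\mathrm{ord}_z(f^*D)$ be the order of vanishing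 at $z$ of the pullback by $f$ of a local equation of $D$, and $\mathrm{ord}_z(R_f)$ the order of vanishing at $z$ of the derivative of $f$ in local coordinates of $X$. Then $f'^*c_1(\overline L)$ (a form defined off $f^{-1}(D)$) is integrable on $\mathbb D(r)$, $t\mapsto\frac1t\int_{\mathbb D(t)}f'^*c_1(\overline L)$ is integrable on $(0,r)$, $\log\|f_*(\partial/\partial z)\|_{\log}$ is integrable on $\partial\mathbb D(r)$, the orders $\mathrm{ord}_z(f^*D)$ and $\mathrm{ord}_z(R_f)$ are finite at every point of $\mathbb D(r)$ and non-zero at only finitely many, and $$\begin{aligned}\int_0^r\frac{dt}{t}\int_{\mathbb D(t)}f'^*c_1(\overline L)\;=\;&-\log\Big\|f_*\Big(\frac{\partial}{\partial z}\Big)\Big\|_{\log}(0)+\int_{\partial\mathbb D(r)}\log\Big\|f_*\Big(\frac{\partial}{\partial z}\Big)\Big\|_{\log}\\&+\sum_{0<|z|<r}\min\{1,\mathrm{ord}_z(f^*D)\}\log\frac r{|z|}-\sum_{\substack{0<|z|<r\\ f(z)\notin D}}\mathrm{ord}_z(R_f)\log\frac r{|z|}.\end{aligned}$$ -/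

import Mathlib

open scoped Manifold ContDiff Topology

noncomputable section

namespace LogDisc

/-- Coordinates on an `n`-dimensional complex manifold. -/
abbrev Coord (n : ℕ) : Type := Fin n → ℂ

section LogGeometry

variable {n : ℕ} {X : Type*} [TopologicalSpace X] [ChartedSpace (Coord n) X]

/-- `(e, I)` is a logarithmic chart of `(X, D)`: `e` is a holomorphic chart of `X` in which `D` is
the union of the coordinate hyperplanes `z i = 0`, `i ∈ I`. -/
def IsLogChart (D : Set X) (e : OpenPartialHomeomorph X (Coord n)) (I : Finset (Fin n)) : Prop :=
  e ∈ IsManifold.maximalAtlas 𝓘(ℂ, Coord n) ω X ∧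
    ∀ x ∈ e.source, (x ∈ D ↔ ∃ i ∈ I, e x i = 0)

/-- `(X, D)` is log-smooth: `D` is (the support of) a reduced divisor with normal crossings. -/
def IsLogSmooth (n : ℕ) {X : Type*} [TopologicalSpace X] [ChartedSpace (Coord n) X]
    (D : Set X) : Prop :=
  ∀ x : X, ∃ (e : OpenPartialHomeomorph X (Coord n)) (I : Finset (Fin n)),
    IsLogChart D e I ∧ x ∈ e.source

/-- In the coordinates `z` of a log chart, the vector `∑ i, ξ i • ε i`, where `ε i = z i ∂/∂z i` for
`i ∈ I` and `ε i = ∂/∂z i` for `i ∉ I` is the standard frame of the bundle `T_X(-log D)`. -/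
def logFrame (I : Finset (Fin n)) (z ξ : Coord n) : Coord n :=
  fun i => if i ∈ I then z i * ξ i else ξ i

/-- The tangent vector to `X` at `e⁻¹ z` given by the element of `T_X(-log D)` whose components in
the frame `ε` are `ξ`. Off `D` this is an isomorphism of `T_X(-log D)` with `T_X`. -/
def logVector (e : OpenPartialHomeomorph X (Coord n)) (I : Finset (Fin n)) (z ξ : Coord n) :
    TangentSpace 𝓘(ℂ, Coord n) (e.symm z) :=
  mfderiv 𝓘(ℂ, Coord n) 𝓘(ℂ, Coord n) e.symm z (logFrame I z ξ)

/-- A smooth Hermitian metric on the holomorphic tangent bundle of `X \ D`; equivalently, on the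
restriction of `T_X(-log D)` to `X \ D`. The values of `form` over `D` are irrelevant.
Smoothness is expressed in the log frames. -/
structure OpenMetric (n : ℕ) {X : Type*} [TopologicalSpace X] [ChartedSpace (Coord n) X]
    (D : Set X) where
  form : ∀ x : X, TangentSpace 𝓘(ℂ, Coord n) x →ₗ⋆[ℂ] TangentSpace 𝓘(ℂ, Coord n) x →ₗ[ℂ] ℂ
  conj_symm : ∀ x, x ∉ D → ∀ v w, (starRingEnd ℂ) (form x v w) = form x w v
  pos : ∀ x, x ∉ D → ∀ v, v ≠ 0 → 0 < (form x v v).re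
  smooth : ∀ (e : OpenPartialHomeomorph X (Coord n)) (I : Finset (Fin n)), IsLogChart D e I →
    ContDiffOn ℝ ∞
      (fun p : Coord n × Coord n =>
        (form (e.symm p.1) (logVector e I p.1 p.2) (logVector e I p.1 p.2)).re)
      {p | p.1 ∈ e.target ∧ ∀ i ∈ I, p.1 i ≠ 0}

/-- `‖v‖²`. -/
def OpenMetric.normSq {D : Set X} (h : OpenMetric n D) (x : X)
    (v : TangentSpace 𝓘(ℂ, Coord n) x) : ℝ :=
  (h.form x v v).re

/-- `‖v‖`. -/
def OpenMetric.norm {D : Set X} (h : OpenMetric n D) (x : X)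
    (v : TangentSpace 𝓘(ℂ, Coord n) x) : ℝ :=
  Real.sqrt (h.normSq x v)

/-- The Levi form `∑ ∂²Φ/∂ζ_j∂ζ̄_k (p) v_j v̄_k` of a function `Φ` on `ℂⁿ × ℂⁿ`. -/
def leviForm (Φ : Coord n × Coord n → ℝ) (p v : Coord n × Coord n) : ℝ :=
  (iteratedFDeriv ℝ 2 Φ p ![v, v]
    + iteratedFDeriv ℝ 2 Φ p ![Complex.I • v, Complex.I • v]) / 4

/-- Over a log chart, `P(T_X(-log D))` has coordinates `(z, [ξ])`, and `(z, ξ)` with `ξ ≠ 0` are the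
coordinates on the complement of the zero section of `L⁻¹`, the tautological line subbundle of the
pullback of `T_X(-log D)`. This is `log ‖ξ‖²` for the metric on `L⁻¹` induced by `h`. -/
def tautPotential {D : Set X} (h : OpenMetric n D) (e : OpenPartialHomeomorph X (Coord n))
    (I : Finset (Fin n)) (p : Coord n × Coord n) : ℝ :=
  Real.log (h.normSq (e.symm p.1) (logVector e I p.1 p.2))

/-- The Chern form `c₁(L̄) = (i/2π) ∂∂̄ log ‖ξ‖²` of the tautological bundle `L` on
`P(T_X(-log D))`, in the homogeneous coordinates `p = (z, ξ)`, evaluated on the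
pair `(v, i v)`. (It does not change if `ξ` is multiplied by a nowhere zero holomorphic function,
so it is a form in `(z, [ξ])`.) -/
def tautChernForm {D : Set X} (h : OpenMetric n D) (e : OpenPartialHomeomorph X (Coord n))
    (I : Finset (Fin n)) (p v : Coord n × Coord n) : ℝ :=
  (1 / Real.pi) * leviForm (tautPotential h e I) p v

/-- The model form of Poincaré growth
`∑_{i ∈ I} |dz i|² / (|z i|² (1 + |log |z i||)²) + ∑_{i ∉ I} |dz i|²`, at `z`, on `a`. -/
def poincareForm (I : Finset (Fin n)) (z a : Coord n) : ℝ :=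
  ∑ i, if i ∈ I then ‖a i‖ ^ 2 / (‖z i‖ ^ 2 * (1 + |Real.log ‖z i‖|) ^ 2) else ‖a i‖ ^ 2

/-- `1 + ∑_{i ∈ I} |log |z i||`. -/
def logWeight (I : Finset (Fin n)) (z : Coord n) : ℝ :=
  1 + ∑ i ∈ I, |Real.log ‖z i‖|

/-- `h` is a log metric on `(X, D)`: as a metric on `T_X(-log D)` it is at most mildly singular along
`D`. Around every point of `D`, in some log chart: the metric is bounded above and below in the log
frame up to powers of `log |z i|`, and the Chern form of the induced metric on the tautological
bundle is bounded below by a negative multiple of the form of Poincaré growth. -/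
def IsLogMetric {D : Set X} (h : OpenMetric n D) : Prop :=
  ∀ x ∈ D, ∃ (e : OpenPartialHomeomorph X (Coord n)) (I : Finset (Fin n)),
    IsLogChart D e I ∧ x ∈ e.source ∧
    ∃ (C : ℝ) (N : ℕ), 0 < C ∧ ∀ᶠ z in 𝓝 (e x), (∀ i ∈ I, z i ≠ 0) →
      (∀ ξ : Coord n,
        ‖ξ‖ ^ 2 ≤ C * logWeight I z ^ N * h.normSq (e.symm z) (logVector e I z ξ) ∧
        h.normSq (e.symm z) (logVector e I z ξ) ≤ C * logWeight I z ^ N * ‖ξ‖ ^ 2) ∧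
      (∀ ξ : Coord n, ξ ≠ 0 → ∀ a b : Coord n,
        -(C * poincareForm I z a) ≤ tautChernForm h e I (z, ξ) (a, b))

/-! ### Discs -/

/-- `f_*(∂/∂z)` at `z`. -/
def pushDz (n : ℕ) {X : Type*} [TopologicalSpace X] [ChartedSpace (Coord n) X] (f : ℂ → X)
    (z : ℂ) : TangentSpace 𝓘(ℂ, Coord n) (f z) :=
  mfderiv 𝓘(ℂ, ℂ) 𝓘(ℂ, Coord n) f z (1 : ℂ)

/-- `ξ` describes, near `z₀` and in homogeneous coordinates over the log chart `(e, I)`, the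
derivative `f'` of `f` as a map to `P(T_X(-log D))`: it is holomorphic, does not vanish at `z₀`, and
`f_*(∂/∂z)` is a multiple of the log vector with components `ξ`, off `f⁻¹(D)`. In other words `ξ`
generates the line bundle `f'^* L⁻¹` near `z₀`. -/
def IsDerivativeLift (D : Set X) (f : ℂ → X) (z₀ : ℂ) (e : OpenPartialHomeomorph X (Coord n))
    (I : Finset (Fin n)) (ξ : ℂ → Coord n) : Prop :=
  IsLogChart D e I ∧ f z₀ ∈ e.source ∧ AnalyticAt ℂ ξ z₀ ∧ ξ z₀ ≠ 0 ∧
    ∀ᶠ z in 𝓝 z₀, f z ∉ D →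
      ∃ c : ℂ, deriv (fun t => e (f t)) z = c • logFrame I (e (f z)) (ξ z)

open Classical in
/-- The density of `f'^* c₁(L̄)` with respect to `dx ∧ dy`, at points off `f⁻¹(D)`: the pullback of
the Chern form of `L̄` by `f'`. It does not depend on the log chart or on `ξ`. -/
def pullbackChern {D : Set X} (h : OpenMetric n D) (f : ℂ → X) (z : ℂ) : ℝ :=
  if H : ∃ c : (OpenPartialHomeomorph X (Coord n) × Finset (Fin n)) × (ℂ → Coord n),
      IsDerivativeLift D f z c.1.1 c.1.2 c.2 then
    tautChernForm h H.choose.1.1 H.choose.1.2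
      (H.choose.1.1 (f z), H.choose.2 z)
      (deriv (fun t => H.choose.1.1 (f t)) z, deriv H.choose.2 z)
  else 0

/-- `ord_z (f^* D)`: the order of vanishing at `z` of the equation `∏_{i ∈ I} z i` of `D` in any log
chart at `f z`, composed with `f`. -/
def boundaryOrder (n : ℕ) {X : Type*} [TopologicalSpace X] [ChartedSpace (Coord n) X]
    (D : Set X) (f : ℂ → X) (z : ℂ) : ℕ∞ :=
  ⨅ (e : OpenPartialHomeomorph X (Coord n)) (I : Finset (Fin n)) (_ : IsLogChart D e I)
    (_ : f z ∈ e.source), analyticOrderAt (fun t => ∏ i ∈ I, e (f t) i) z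

/-- `ord_z (R_f)`: the order of vanishing at `z` of the derivative of `f`. -/
def ramificationOrder (n : ℕ) {X : Type*} [TopologicalSpace X] [ChartedSpace (Coord n) X]
    (f : ℂ → X) (z : ℂ) : ℕ∞ :=
  analyticOrderAt (deriv (fun t => chartAt (Coord n) (f z) (f t))) z

end LogGeometry

/-- `∫_0^r (dt/t) ∫_{𝔻(t)} u dx ∧ dy`. -/
def doubleIntegral (u : ℂ → ℝ) (r : ℝ) : ℝ :=
  ∫ t in (0 : ℝ)..r, (1 / t) * ∫ z in Metric.ball (0 : ℂ) t, u z

end LogDisc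

end

/-!
The formula is a Jensen formula for the function `U = log ‖f_*(∂/∂z)‖²` on the disc.

Where `f` avoids `D` and `f_*(∂/∂z)` does not vanish, `U` is of class `C²` and
`f'^* c₁(L̄) = (1/4π) ΔU`: a lift `ξ` of `f'` satisfies `f_*(∂/∂z) = c ξ` with `c` holomorphic and
non-vanishing, so that `U` is `log ‖ξ‖²` up to the harmonic function `2 log |c|`, and the Laplacian
of a function composed with a holomorphic curve is its Levi form on the velocity of the curve
(`laplacian_comp_analyticAt`, `IsDerivativeLift.laplacian_logNormSqPushDz`). The exceptional points
are isolated, as `f 0 ∉ D` and `f_*(∂/∂z)` does not vanish at `0`. Near each such point `a`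
one has `U = φ + m log |z - a|`, where

* if `f a ∉ D`, then `m` is twice the order of vanishing of `f_*(∂/∂z)` and `φ` is of class `C²`
  (`exists_isMildAt_of_notMem`);
* if `f a ∈ D`, then `m = -2`, whatever the order of contact, because the components
  `g_i' / g_i` of `f_*(∂/∂z)` in the logarithmic frame have simple poles (`exists_lift_of_zero`).
  The function `φ` is now the logarithm of the squared norm of a non-vanishing section of the
  pullback of `T_X(-log D)`, and the hypothesis on the metric gives `φ = O(log |log |z - a||)`
  and `Δφ ≥ -ψ` with `ψ` integrable, by comparison with the Poincaré metric of the punctured disc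
  (`exists_isMildAt_of_mem`).

It remains to see that such a `φ` behaves in Jensen's formula like a smooth function, that is, `Δφ`
is integrable and is the Laplacian of `φ` in the sense of distributions, with no mass at `a`.
Green's identity is applied to `φ` times cutoff functions of the form `κ(-log |z - a| / N)`. The terms with
derivatives of the cutoff functions are dominated, uniformly in `N`, by the integrable weight
`|z - a|⁻² (1 + |log |z - a||)^{-3/2}` (`exists_bound_mul_laplacian_logCutoff`), so they disappear
in the limit. Fatou's lemma and the lower bound for `Δφ` give the integrability of `Δφ`
(`integrableOn_laplacian_of_le`), and dominated convergence gives Green's identity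
(`HasMildSingularities.integral_laplacian_mul`). Consequently `U`, with its logarithmic poles
subtracted and cut off outside the disc, is the logarithmic potential of its Laplacian
(`HasMildSingularities.integral_laplacian_mul_log`). Averaging over the circle produces Green's
function of the disc (`HasMildSingularities.circleAverage_sub_eq`), and Fubini's theorem turns the
integral against Green's function into the iterated integral (`doubleIntegral_eq`).
-/

open MeasureTheory Filter Topology InnerProductSpace Metric Set

namespace LogDisc

/-! ### The Laplacian on the complex plane -/

/-- The second derivative of `F` at `z` in the direction `v`. -/
noncomputable def dirDeriv₂ (v : ℂ) (F : ℂ → ℝ) (z : ℂ) : ℝ :=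
  fderiv ℝ (fun y => fderiv ℝ F y v) z v

lemma differentiableAt_fderiv_apply {F : ℂ → ℝ} {z : ℂ} (hF : ContDiffAt ℝ 2 F z) (v : ℂ) :
    DifferentiableAt ℝ (fun y => fderiv ℝ F y v) z :=
  ((hF.fderiv_right (m := 1) (by norm_num)).differentiableAt (by norm_num)).clm_apply
    (differentiableAt_const v)

lemma iteratedFDeriv_two_diag {F : ℂ → ℝ} {z : ℂ} (hF : ContDiffAt ℝ 2 F z) (v : ℂ) :
    iteratedFDeriv ℝ 2 F z ![v, v] = dirDeriv₂ v F z := by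
  have h := (hF.fderiv_right (m := 1) (by norm_num)).differentiableAt (by norm_num)
  rw [iteratedFDeriv_two_apply, dirDeriv₂,
    fderiv_clm_apply h (differentiableAt_const v)]
  simp

lemma laplacian_eq_dirDeriv₂ {F : ℂ → ℝ} {z : ℂ} (hF : ContDiffAt ℝ 2 F z) :
    Laplacian.laplacian F z = dirDeriv₂ 1 F z + dirDeriv₂ Complex.I F z := by
  rw [laplacian_eq_iteratedFDeriv_complexPlane]
  simp only [iteratedFDeriv_two_diag hF]

lemma laplacian_congr_at {F G : ℂ → ℝ} {z : ℂ} (h : F =ᶠ[𝓝 z] G) :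
    Laplacian.laplacian F z = Laplacian.laplacian G z :=
  (laplacian_congr_nhds h).self_of_nhds

lemma continuousOn_fderiv_apply {F : ℂ → ℝ} {O : Set ℂ} (hO : IsOpen O)
    (hF : ContDiffOn ℝ 2 F O) (v : ℂ) : ContinuousOn (fun y => fderiv ℝ F y v) O := fun _ hz =>
  (differentiableAt_fderiv_apply (hF.contDiffAt (hO.mem_nhds hz)) v).continuousAt.continuousWithinAt

lemma continuousOn_dirDeriv₂ {F : ℂ → ℝ} {O : Set ℂ} (hO : IsOpen O)
    (hF : ContDiffOn ℝ 2 F O) (v : ℂ) : ContinuousOn (dirDeriv₂ v F) O := by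
  have h1 : ContDiffOn ℝ 1 (fun y => fderiv ℝ F y v) O :=
    (hF.fderiv_of_isOpen hO (m := 1) (by norm_num)).clm_apply contDiffOn_const
  exact (h1.continuousOn_fderiv_of_isOpen hO (by norm_num)).clm_apply continuousOn_const

lemma continuousOn_laplacian {F : ℂ → ℝ} {O : Set ℂ} (hO : IsOpen O)
    (hF : ContDiffOn ℝ 2 F O) : ContinuousOn (Laplacian.laplacian F) O :=
  ((continuousOn_dirDeriv₂ hO hF 1).add (continuousOn_dirDeriv₂ hO hF Complex.I)).congr
    fun _ hz => laplacian_eq_dirDeriv₂ (hF.contDiffAt (hO.mem_nhds hz))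

lemma laplacian_mul {F G : ℂ → ℝ} {z : ℂ} (hF : ContDiffAt ℝ 2 F z) (hG : ContDiffAt ℝ 2 G z) :
    Laplacian.laplacian (fun y => F y * G y) z
      = Laplacian.laplacian F z * G z
        + 2 * (fderiv ℝ F z 1 * fderiv ℝ G z 1
            + fderiv ℝ F z Complex.I * fderiv ℝ G z Complex.I)
        + F z * Laplacian.laplacian G z := by
  have key : ∀ v, dirDeriv₂ v (fun y => F y * G y) z = dirDeriv₂ v F z * G z
      + 2 * (fderiv ℝ F z v * fderiv ℝ G z v) + F z * dirDeriv₂ v G z := by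
    intro v
    have hev : (fun y => fderiv ℝ (fun y => F y * G y) y v) =ᶠ[𝓝 z]
        fun y => F y * fderiv ℝ G y v + G y * fderiv ℝ F y v := by
      filter_upwards [hF.eventually (by simp), hG.eventually (by simp)] with y h1 h2
      rw [fderiv_fun_mul (h1.differentiableAt (by norm_num)) (h2.differentiableAt (by norm_num))]
      simp
    have hF' := hF.differentiableAt (n := 2) (by norm_num)
    have hG' := hG.differentiableAt (n := 2) (by norm_num)
    have hF2 := differentiableAt_fderiv_apply hF v
    have hG2 := differentiableAt_fderiv_apply hG v
    rw [dirDeriv₂, hev.fderiv_eq, fderiv_fun_add (hF'.fun_mul hG2) (hG'.fun_mul hF2),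
      fderiv_fun_mul hF' hG2, fderiv_fun_mul hG' hF2]
    simp [dirDeriv₂]
    ring
  rw [laplacian_eq_dirDeriv₂ hF, laplacian_eq_dirDeriv₂ hG, laplacian_eq_dirDeriv₂ (hF.mul hG),
    key, key]
  ring

lemma laplacian_comp {κ : ℝ → ℝ} {u : ℂ → ℝ} {z : ℂ} (hκ : ContDiffAt ℝ 2 κ (u z))
    (hu : ContDiffAt ℝ 2 u z) :
    Laplacian.laplacian (fun y => κ (u y)) z
      = deriv (deriv κ) (u z) * ((fderiv ℝ u z 1) ^ 2 + (fderiv ℝ u z Complex.I) ^ 2)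
        + deriv κ (u z) * Laplacian.laplacian u z := by
  have hd : DifferentiableAt ℝ (deriv κ) (u z) := by
    have := (hκ.fderiv_right (m := 1) (by norm_num)).differentiableAt (by norm_num)
    exact this.clm_apply (differentiableAt_const 1)
  have hud := hu.differentiableAt (n := 2) (by norm_num)
  have chain : ∀ (g : ℝ → ℝ) (y : ℂ), DifferentiableAt ℝ g (u y) → DifferentiableAt ℝ u y →
      ∀ v, fderiv ℝ (fun y => g (u y)) y v = deriv g (u y) * fderiv ℝ u y v := by
    intro g y hg hy v
    have := (hg.hasDerivAt.comp_hasFDerivAt y hy.hasFDerivAt).fderiv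
    rw [show (fun y => g (u y)) = g ∘ u from rfl, this]
    simp
  have key : ∀ v, dirDeriv₂ v (fun y => κ (u y)) z
      = deriv (deriv κ) (u z) * (fderiv ℝ u z v) ^ 2 + deriv κ (u z) * dirDeriv₂ v u z := by
    intro v
    have hev : (fun y => fderiv ℝ (fun y => κ (u y)) y v) =ᶠ[𝓝 z]
        fun y => deriv κ (u y) * fderiv ℝ u y v := by
      filter_upwards [hu.eventually (by simp),
        hud.continuousAt.eventually (hκ.eventually (by simp))]
        with y h1 h2
      exact chain κ y (h2.differentiableAt (by norm_num)) (h1.differentiableAt (by norm_num)) v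
    have h1 : DifferentiableAt ℝ (fun y => deriv κ (u y)) z := hd.comp z hud
    rw [dirDeriv₂, hev.fderiv_eq, fderiv_fun_mul h1 (differentiableAt_fderiv_apply hu v)]
    simp [chain _ z hd hud, dirDeriv₂]
    ring
  rw [laplacian_eq_dirDeriv₂ hu, laplacian_eq_dirDeriv₂ (F := fun y => κ (u y)) (hκ.comp z hu), key,
    key]
  ring

/-! ### Green's identity for functions of class `C²` -/

lemma integrable_of_continuousOn_of_support_subset {G : ℂ → ℝ} {O K : Set ℂ}
    (hG : ContinuousOn G O) (hK : IsCompact K) (hKO : K ⊆ O) (hs : Function.support G ⊆ K) :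
    Integrable G :=
  (integrableOn_iff_integrable_of_support_subset hs).1 ((hG.mono hKO).integrableOn_compact hK)

lemma contDiffAt_of_notMem_tsupport {F : ℂ → ℝ} {z : ℂ} (h : z ∉ tsupport F) :
    ContDiffAt ℝ 2 F z :=
  contDiffAt_const.congr_of_eventuallyEq (notMem_tsupport_iff_eventuallyEq.1 h)

lemma contDiffAt_of_inter_tsupport_subset {F w : ℂ → ℝ} {O : Set ℂ} (hO : IsOpen O)
    (hF : ContDiffOn ℝ 2 F O) (hs : tsupport F ∩ tsupport w ⊆ O) {z : ℂ} (hz : z ∈ tsupport w) :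
    ContDiffAt ℝ 2 F z := by
  by_cases h : z ∈ tsupport F
  · exact hF.contDiffAt (hO.mem_nhds (hs ⟨h, hz⟩))
  · exact contDiffAt_of_notMem_tsupport h

lemma integral_mul_dirDeriv₂ {F w : ℂ → ℝ} {O : Set ℂ} (hO : IsOpen O)
    (hF : ContDiffOn ℝ 2 F O) (hw : ContDiffOn ℝ 2 w O)
    (hs : tsupport F ∩ tsupport w ⊆ O) (hc : IsCompact (tsupport F ∩ tsupport w)) (v : ℂ) :
    ∫ z, F z * dirDeriv₂ v w z = - ∫ z, fderiv ℝ F z v * fderiv ℝ w z v := by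
  have hFv := tsupport_fderiv_apply_subset (f := F) ℝ v
  have hwv := tsupport_fderiv_apply_subset (f := w) ℝ v
  have hwvv := (tsupport_fderiv_apply_subset (f := fun y => fderiv ℝ w y v) ℝ v).trans hwv
  have hs' : tsupport w ∩ tsupport F ⊆ O := by rwa [inter_comm]
  apply integral_mul_fderiv_eq_neg_fderiv_mul_of_integrable
  · refine integrable_of_continuousOn_of_support_subset
      ((continuousOn_fderiv_apply hO hF v).mul (continuousOn_fderiv_apply hO hw v)) hc hs ?_
    intro z hz
    exact ⟨hFv (subset_tsupport _ (left_ne_zero_of_mul hz)),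
      hwv (subset_tsupport _ (right_ne_zero_of_mul hz))⟩
  · refine integrable_of_continuousOn_of_support_subset
      (hF.continuousOn.mul (continuousOn_dirDeriv₂ hO hw v)) hc hs ?_
    intro z hz
    exact ⟨subset_tsupport _ (left_ne_zero_of_mul hz),
      hwvv (subset_tsupport _ (right_ne_zero_of_mul hz))⟩
  · refine integrable_of_continuousOn_of_support_subset
      (hF.continuousOn.mul (continuousOn_fderiv_apply hO hw v)) hc hs ?_
    intro z hz
    exact ⟨subset_tsupport _ (left_ne_zero_of_mul hz),
      hwv (subset_tsupport _ (right_ne_zero_of_mul hz))⟩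
  · intro z hz
    exact (contDiffAt_of_inter_tsupport_subset hO hF hs (hwv hz)).differentiableAt (by norm_num)
  · intro z hz
    exact differentiableAt_fderiv_apply (contDiffAt_of_inter_tsupport_subset hO hw hs' hz) v

lemma support_laplacian_mul_subset (F w : ℂ → ℝ) :
    (Function.support fun z => F z * Laplacian.laplacian w z) ⊆ tsupport F ∩ tsupport w := by
  intro z hz
  refine ⟨subset_tsupport _ (left_ne_zero_of_mul hz), ?_⟩
  by_contra h
  apply right_ne_zero_of_mul hz
  rw [laplacian_congr_at (notMem_tsupport_iff_eventuallyEq.1 h)]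
  simp [Pi.zero_def]

lemma integrable_mul_laplacian {F w : ℂ → ℝ} {O : Set ℂ} (hO : IsOpen O)
    (hF : ContinuousOn F O) (hw : ContDiffOn ℝ 2 w O)
    (hs : tsupport F ∩ tsupport w ⊆ O) (hc : IsCompact (tsupport F ∩ tsupport w)) :
    Integrable fun z => F z * Laplacian.laplacian w z :=
  integrable_of_continuousOn_of_support_subset (hF.mul (continuousOn_laplacian hO hw)) hc hs
    (support_laplacian_mul_subset F w)

lemma integral_mul_laplacian {F w : ℂ → ℝ} {O : Set ℂ} (hO : IsOpen O)
    (hF : ContDiffOn ℝ 2 F O) (hw : ContDiffOn ℝ 2 w O)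
    (hs : tsupport F ∩ tsupport w ⊆ O) (hc : IsCompact (tsupport F ∩ tsupport w)) :
    ∫ z, F z * Laplacian.laplacian w z
      = - ((∫ z, fderiv ℝ F z 1 * fderiv ℝ w z 1)
        + ∫ z, fderiv ℝ F z Complex.I * fderiv ℝ w z Complex.I) := by
  have hs' : tsupport w ∩ tsupport F ⊆ O := by rwa [inter_comm]
  have hint : ∀ v, Integrable fun z => F z * dirDeriv₂ v w z := by
    intro v
    refine integrable_of_continuousOn_of_support_subset
      (hF.continuousOn.mul (continuousOn_dirDeriv₂ hO hw v)) hc hs ?_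
    intro z hz
    exact ⟨subset_tsupport _ (left_ne_zero_of_mul hz),
      (tsupport_fderiv_apply_subset (f := fun y => fderiv ℝ w y v) ℝ v).trans
        (tsupport_fderiv_apply_subset (f := w) ℝ v) (subset_tsupport _ (right_ne_zero_of_mul hz))⟩
  have : ∀ z, F z * Laplacian.laplacian w z
      = F z * dirDeriv₂ 1 w z + F z * dirDeriv₂ Complex.I w z := by
    intro z
    by_cases hz : z ∈ tsupport F
    · rw [laplacian_eq_dirDeriv₂ (contDiffAt_of_inter_tsupport_subset hO hw hs' hz)]
      ring
    · simp [image_eq_zero_of_notMem_tsupport hz]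
  simp_rw [this]
  rw [integral_add (hint _) (hint _), integral_mul_dirDeriv₂ hO hF hw hs hc,
    integral_mul_dirDeriv₂ hO hF hw hs hc]
  ring

/-- **Green's identity** without boundary terms. -/
theorem integral_laplacian_mul_eq {F w : ℂ → ℝ} {O : Set ℂ} (hO : IsOpen O)
    (hF : ContDiffOn ℝ 2 F O) (hw : ContDiffOn ℝ 2 w O)
    (hs : tsupport F ∩ tsupport w ⊆ O) (hc : IsCompact (tsupport F ∩ tsupport w)) :
    ∫ z, Laplacian.laplacian F z * w z = ∫ z, F z * Laplacian.laplacian w z := by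
  rw [integral_mul_laplacian hO hF hw hs hc]
  simp_rw [mul_comm (Laplacian.laplacian F _)]
  rw [integral_mul_laplacian hO hw hF (by rwa [inter_comm]) (by rwa [inter_comm])]
  simp_rw [mul_comm (fderiv ℝ w _ _)]

/-! ### Logarithmic growth near a point -/

/-- `√(1 + |log |z - a||)`, the largest growth allowed at an isolated singularity `a`. -/
noncomputable def logGrowth (a z : ℂ) : ℝ := √(1 + |Real.log ‖z - a‖|)

/-- `1 / (|z - a|² (1 + |log |z - a||)^{3/2})`, a function that is integrable near `a` and dominates
all the terms in the estimates near an isolated singularity. -/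
noncomputable def singularWeight (a z : ℂ) : ℝ := 1 / (‖z - a‖ ^ 2 * logGrowth a z ^ 3)

lemma one_le_logGrowth (a z : ℂ) : 1 ≤ logGrowth a z := by
  rw [logGrowth, Real.one_le_sqrt]
  linarith [abs_nonneg (Real.log ‖z - a‖)]

lemma logGrowth_sq (a z : ℂ) : logGrowth a z ^ 2 = 1 + |Real.log ‖z - a‖| :=
  Real.sq_sqrt (by positivity)

lemma norm_mul_logGrowth_sq_le {a z : ℂ} (h1 : ‖z - a‖ ≤ 1) :
    ‖z - a‖ * logGrowth a z ^ 2 ≤ 1 := by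
  rw [logGrowth_sq]
  rcases (norm_nonneg (z - a)).eq_or_lt with h0 | h0
  · simp [← h0]
  rw [abs_of_nonpos (Real.log_nonpos h0.le h1)]
  have := Real.log_le_sub_one_of_pos (inv_pos.2 h0)
  rw [Real.log_inv] at this
  calc ‖z - a‖ * (1 + -Real.log ‖z - a‖) ≤ ‖z - a‖ * ‖z - a‖⁻¹ := by gcongr; linarith
    _ = 1 := mul_inv_cancel₀ h0.ne'

lemma logGrowth_le_singularWeight {a z : ℂ} (h0 : z ≠ a) (h1 : ‖z - a‖ ≤ 1) :
    logGrowth a z ≤ singularWeight a z := by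
  have hs := one_le_logGrowth a z
  have hr : 0 < ‖z - a‖ := norm_pos_iff.2 (sub_ne_zero.2 h0)
  have h := norm_mul_logGrowth_sq_le h1
  rw [singularWeight, le_div_iff₀ (by positivity)]
  calc logGrowth a z * (‖z - a‖ ^ 2 * logGrowth a z ^ 3) = (‖z - a‖ * logGrowth a z ^ 2) ^ 2 := by
        ring
    _ ≤ 1 := pow_le_one₀ (by positivity) h

lemma inv_mul_logGrowth_le_singularWeight {a z : ℂ} (h0 : z ≠ a) (h1 : ‖z - a‖ ≤ 1) :
    1 / (‖z - a‖ * logGrowth a z) ≤ singularWeight a z := by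
  have hs := one_le_logGrowth a z
  have hr : 0 < ‖z - a‖ := norm_pos_iff.2 (sub_ne_zero.2 h0)
  have h := norm_mul_logGrowth_sq_le h1
  rw [singularWeight]
  gcongr 1 / ?_
  calc ‖z - a‖ ^ 2 * logGrowth a z ^ 3
      = (‖z - a‖ * logGrowth a z) * (‖z - a‖ * logGrowth a z ^ 2) := by ring
    _ ≤ ‖z - a‖ * logGrowth a z := mul_le_of_le_one_right (by positivity) h

lemma integrableOn_singularWeight (a : ℂ) : IntegrableOn (singularWeight a) (ball a 1) := by
  -- in polar coordinates the integrand is the derivative of `2 (1 - log y)^{-1/2}`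
  have h1 : IntegrableOn (fun y : ℝ => 1 / (y * √(1 - Real.log y) ^ 3)) (Ioc 0 1) := by
    apply intervalIntegral.integrableOn_deriv_of_nonneg
      (g := fun y => if y ≤ 0 then 0 else 2 / √(1 - Real.log y))
    · intro y hy
      rcases hy.1.eq_or_lt with rfl | hy0
      · have : Tendsto (fun y => 2 / √(1 - Real.log y)) (𝓝[>] 0) (𝓝 0) := by
          apply Tendsto.const_div_atTop
          apply Real.tendsto_sqrt_atTop.comp
          exact tendsto_atTop_add_const_left _ _ (tendsto_neg_atBot_atTop.comp
            Real.tendsto_log_nhdsGT_zero)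
        rw [ContinuousWithinAt, if_pos le_rfl]
        have h2 : Tendsto (fun y => if y ≤ 0 then 0 else 2 / √(1 - Real.log y)) (𝓝[≥] 0) (𝓝 0) := by
          rw [← Ioi_insert, nhdsWithin_insert]
          refine Tendsto.sup ?_ (this.congr' ?_)
          · rw [tendsto_pure_left]
            intro s hs
            simpa using mem_of_mem_nhds hs
          · filter_upwards [self_mem_nhdsWithin] with y hy
            rw [if_neg (not_le.2 hy)]
        exact h2.mono_left (nhdsWithin_mono _ Icc_subset_Ici_self)
      · have hl : Real.log y ≤ 0 := Real.log_nonpos hy0.le hy.2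
        have hs : √(1 - Real.log y) ≠ 0 := (Real.sqrt_pos.2 (by linarith)).ne'
        have : ContinuousAt (fun y => 2 / √(1 - Real.log y)) y := by
          have := Real.continuousAt_log hy0.ne'
          fun_prop (disch := assumption)
        refine (this.congr ?_).continuousWithinAt
        filter_upwards [lt_mem_nhds hy0] with x hx
        rw [if_neg (not_le.2 hx)]
    · intro y hy
      have hl : Real.log y ≤ 0 := Real.log_nonpos hy.1.le hy.2.le
      have hs : 0 < √(1 - Real.log y) := Real.sqrt_pos.2 (by linarith)
      have hd := (((Real.hasDerivAt_log hy.1.ne').const_sub 1).sqrt (by linarith)).fun_inv hs.ne'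
      have hev : (fun y => if y ≤ 0 then 0 else 2 / √(1 - Real.log y))
          =ᶠ[𝓝 y] fun y => 2 * (√(1 - Real.log y))⁻¹ := by
        filter_upwards [lt_mem_nhds hy.1] with x hx
        rw [if_neg (not_le.2 hx), div_eq_mul_inv]
      have := hy.1.ne'
      exact ((hd.const_mul 2).congr_of_eventuallyEq hev).congr_deriv (by field_simp)
    · intro y hy
      have := hy.1
      positivity
  have h2 : IntegrableOn (fun z : ℂ => 1 / (‖z‖ ^ 2 * √(1 + |Real.log ‖z‖|) ^ 3)) (ball 0 1) := by
    refine (integrableOn_fun_norm_addHaar volume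
      (f := fun y => 1 / (y ^ 2 * √(1 + |Real.log y|) ^ 3))).2 ?_
    refine (h1.mono_set Ioo_subset_Ioc_self).congr_fun (fun y hy => ?_) measurableSet_Ioo
    simp only [Complex.finrank_real_complex, smul_eq_mul]
    rw [abs_of_nonpos (Real.log_nonpos hy.1.le hy.2.le), ← sub_eq_add_neg]
    have := hy.1.ne'
    field_simp
    norm_num
  rw [← integrable_indicator_iff measurableSet_ball] at h2 ⊢
  refine (h2.comp_sub_right a).congr (Eventually.of_forall fun z => ?_)
  simp [indicator, singularWeight, logGrowth, dist_eq_norm]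

/-! ### The logarithm of the distance to a point -/

lemma harmonicAt_log_norm_sub {a z : ℂ} (h : z ≠ a) :
    HarmonicAt (fun y => Real.log ‖y - a‖) z :=
  AnalyticAt.harmonicAt_log_norm (f := fun y => y - a) (by fun_prop) (sub_ne_zero.2 h)

lemma contDiffAt_log_norm_sub {a z : ℂ} (h : z ≠ a) :
    ContDiffAt ℝ 2 (fun y => Real.log ‖y - a‖) z :=
  (harmonicAt_log_norm_sub h).1

lemma laplacian_log_norm_sub {a z : ℂ} (h : z ≠ a) :
    Laplacian.laplacian (fun y => Real.log ‖y - a‖) z = 0 :=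
  (harmonicAt_log_norm_sub h).2.self_of_nhds

lemma abs_fderiv_log_norm_sub_le {a z : ℂ} (h : z ≠ a) {v : ℂ} (hv : ‖v‖ = 1) :
    |fderiv ℝ (fun y => Real.log ‖y - a‖) z v| ≤ 1 / ‖z - a‖ := by
  have hne : z - a ≠ 0 := sub_ne_zero.2 h
  have hd : DifferentiableAt ℝ (fun y : ℂ => ‖y - a‖) z :=
    (differentiableAt_id.sub_const a).norm ℂ hne
  have hlip : LipschitzWith 1 (fun y : ℂ => ‖y - a‖) := by
    refine LipschitzWith.of_dist_le_mul fun x y => ?_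
    simpa [dist_eq_norm] using abs_norm_sub_norm_le (x - a) (y - a)
  have hle := norm_fderiv_le_of_lipschitz ℝ hlip (x₀ := z)
  have h1 := (Real.hasDerivAt_log (norm_ne_zero_iff.2 hne)).comp_hasFDerivAt z hd.hasFDerivAt
  rw [show (fun y : ℂ => Real.log ‖y - a‖) = Real.log ∘ (fun y => ‖y - a‖) from rfl, h1.fderiv,
    smul_apply, smul_eq_mul, abs_mul, abs_of_nonneg (by positivity), one_div]
  refine mul_le_of_le_one_right (by positivity) ?_
  calc _ ≤ ‖fderiv ℝ (fun y : ℂ => ‖y - a‖) z‖ * ‖v‖ := ContinuousLinearMap.le_opNorm _ _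
    _ ≤ 1 := by simpa [hv] using hle

/-! ### Logarithmic cutoff functions -/

/-- A smooth function on the line, equal to `1` on `(-∞, 1]` and to `0` on `[2, ∞)`. -/
noncomputable def cutoffProfile (x : ℝ) : ℝ := Real.smoothTransition (2 - x)

lemma contDiff_cutoffProfile {n : ℕ∞} : ContDiff ℝ n cutoffProfile :=
  Real.smoothTransition.contDiff.comp (contDiff_const.sub contDiff_id)

lemma cutoffProfile_of_le {x : ℝ} (h : x ≤ 1) : cutoffProfile x = 1 :=
  Real.smoothTransition.one_of_one_le (by linarith)

lemma cutoffProfile_of_ge {x : ℝ} (h : 2 ≤ x) : cutoffProfile x = 0 :=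
  Real.smoothTransition.zero_of_nonpos (by linarith)

lemma deriv_cutoffProfile_of_notMem {x : ℝ} (h : x ∉ Icc (1 : ℝ) 2) :
    deriv cutoffProfile x = 0 := by
  rw [mem_Icc, not_and_or, not_le, not_le] at h
  rcases h with h | h
  · rw [EventuallyEq.deriv_eq (f := fun _ => (1 : ℝ))]
    · simp
    · filter_upwards [gt_mem_nhds h] with y hy using cutoffProfile_of_le hy.le
  · rw [EventuallyEq.deriv_eq (f := fun _ => (0 : ℝ))]
    · simp
    · filter_upwards [lt_mem_nhds h] with y hy using cutoffProfile_of_ge hy.le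

lemma deriv_deriv_cutoffProfile_of_notMem {x : ℝ} (h : x ∉ Icc (1 : ℝ) 2) :
    deriv (deriv cutoffProfile) x = 0 := by
  rw [EventuallyEq.deriv_eq (f := fun _ => (0 : ℝ))]
  · simp
  · filter_upwards [isClosed_Icc.isOpen_compl.mem_nhds h] with y hy
    exact deriv_cutoffProfile_of_notMem hy

lemma exists_bound_cutoffProfile :
    ∃ C, 0 ≤ C ∧ ∀ x, |deriv cutoffProfile x| ≤ C ∧ |deriv (deriv cutoffProfile) x| ≤ C := by
  have h2 : ContDiff ℝ 1 (deriv cutoffProfile) :=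
    (contDiff_succ_iff_deriv.1 (show ContDiff ℝ (1 + 1) cutoffProfile from
      contDiff_cutoffProfile (n := 2))).2.2
  obtain ⟨C₁, h₁⟩ := (HasCompactSupport.intro isCompact_Icc
    (fun _ hx => deriv_cutoffProfile_of_notMem hx)).exists_bound_of_continuous h2.continuous
  obtain ⟨C₂, h₂⟩ := (HasCompactSupport.intro isCompact_Icc
    (fun _ hx => deriv_deriv_cutoffProfile_of_notMem hx)).exists_bound_of_continuous
      (h2.continuous_deriv (by norm_num))
  exact ⟨max C₁ C₂, ((norm_nonneg _).trans (h₁ 0)).trans (le_max_left _ _),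
    fun x => ⟨(h₁ x).trans (le_max_left _ _), (h₂ x).trans (le_max_right _ _)⟩⟩

open Classical in
/-- A smooth function of the plane that vanishes for `|z - a| ≤ e^{-2(N+1)}` and is `1` for
`|z - a| ≥ e^{-(N+1)}`. In terms of `log |z - a|` it varies slowly, so that its derivatives
are small compared with those of cutoff functions of scaling type. -/
noncomputable def logCutoff (a : ℂ) (N : ℕ) (z : ℂ) : ℝ :=
  if z = a then 0 else cutoffProfile (-Real.log ‖z - a‖ / (N + 1))

lemma logCutoff_of_ne {a z : ℂ} (h : z ≠ a) (N : ℕ) :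
    logCutoff a N z = cutoffProfile (-Real.log ‖z - a‖ / (N + 1)) := if_neg h

lemma logCutoff_eq_zero {a z : ℂ} {N : ℕ} (h : ‖z - a‖ ≤ Real.exp (-(2 * (N + 1)))) :
    logCutoff a N z = 0 := by
  by_cases hz : z = a
  · simp [logCutoff, hz]
  rw [logCutoff_of_ne hz]
  apply cutoffProfile_of_ge
  have := (Real.log_le_iff_le_exp (norm_pos_iff.2 (sub_ne_zero.2 hz))).2 h
  rw [le_div_iff₀ (by positivity)]
  linarith

lemma logCutoff_eq_one {a z : ℂ} {N : ℕ} (h : Real.exp (-(N + 1)) ≤ ‖z - a‖) :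
    logCutoff a N z = 1 := by
  have hpos : 0 < ‖z - a‖ := (Real.exp_pos _).trans_le h
  rw [logCutoff_of_ne (sub_ne_zero.1 (norm_pos_iff.1 hpos))]
  apply cutoffProfile_of_le
  have := (Real.le_log_iff_exp_le hpos).2 h
  rw [div_le_iff₀ (by positivity)]
  linarith

lemma logCutoff_nonneg (a : ℂ) (N : ℕ) (z : ℂ) : 0 ≤ logCutoff a N z := by
  unfold logCutoff
  split_ifs
  exacts [le_rfl, Real.smoothTransition.nonneg _]

lemma logCutoff_le_one (a : ℂ) (N : ℕ) (z : ℂ) : logCutoff a N z ≤ 1 := by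
  unfold logCutoff
  split_ifs
  exacts [zero_le_one, Real.smoothTransition.le_one _]

lemma notMem_tsupport_logCutoff (a : ℂ) (N : ℕ) : a ∉ tsupport (logCutoff a N) := by
  rw [notMem_tsupport_iff_eventuallyEq]
  filter_upwards [closedBall_mem_nhds a (Real.exp_pos (-(2 * ((N : ℝ) + 1))))] with z hz
  exact logCutoff_eq_zero (by simpa [dist_eq_norm] using hz)

lemma logCutoff_eventuallyEq {a z : ℂ} (h : z ≠ a) (N : ℕ) :
    logCutoff a N =ᶠ[𝓝 z] fun y => cutoffProfile (-Real.log ‖y - a‖ / (N + 1)) := by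
  filter_upwards [isOpen_ne.mem_nhds h] with y hy using logCutoff_of_ne hy N

lemma contDiff_logCutoff (a : ℂ) (N : ℕ) : ContDiff ℝ 2 (logCutoff a N) := by
  rw [contDiff_iff_contDiffAt]
  intro z
  by_cases h : z = a
  · exact contDiffAt_of_notMem_tsupport (h ▸ notMem_tsupport_logCutoff a N)
  · exact ((contDiff_cutoffProfile (n := 2)).contDiffAt.comp z
      ((contDiffAt_log_norm_sub h).neg.div_const _)).congr_of_eventuallyEq
      (logCutoff_eventuallyEq h N)

lemma eventually_logCutoff_eq_one {a z : ℂ} (h : z ≠ a) :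
    ∀ᶠ N : ℕ in atTop, logCutoff a N =ᶠ[𝓝 z] 1 := by
  have hpos : 0 < ‖z - a‖ := norm_pos_iff.2 (sub_ne_zero.2 h)
  have ht : Tendsto (fun N : ℕ => Real.exp (-((N : ℝ) + 1))) atTop (𝓝 0) :=
    Real.tendsto_exp_neg_atTop_nhds_zero.comp
      (tendsto_atTop_add_const_right _ _ tendsto_natCast_atTop_atTop)
  filter_upwards [ht.eventually (gt_mem_nhds hpos)] with N hN
  have hc : ContinuousAt (fun y => ‖y - a‖) z := by fun_prop
  filter_upwards [hc.eventually (lt_mem_nhds hN)] with y hy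
  exact logCutoff_eq_one hy.le

/-- The derivatives of the logarithmic cutoff functions, uniformly in `N`. -/
lemma exists_bound_logCutoff (a : ℂ) : ∃ C, 0 ≤ C ∧ ∀ (N : ℕ) (z : ℂ), z ≠ a →
    (∀ v : ℂ, ‖v‖ = 1 → |fderiv ℝ (logCutoff a N) z v| ≤ C / (‖z - a‖ * logGrowth a z ^ 2)) ∧
    |Laplacian.laplacian (logCutoff a N) z| ≤ C / (‖z - a‖ ^ 2 * logGrowth a z ^ 4) := by
  obtain ⟨C, hC0, hC⟩ := exists_bound_cutoffProfile
  refine ⟨18 * C, by positivity, fun N z hz => ?_⟩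
  have hpos : 0 < ‖z - a‖ := norm_pos_iff.2 (sub_ne_zero.2 hz)
  have hs := one_le_logGrowth a z
  set L : ℝ := N + 1 with hL
  have hL1 : 1 ≤ L := by simp [hL]
  set u : ℂ → ℝ := fun y => -Real.log ‖y - a‖ / L with hu
  have hu' : u = (-1 / L) • (fun y : ℂ => Real.log ‖y - a‖) := by
    ext y; simp [hu]; ring
  have hlog := contDiffAt_log_norm_sub hz
  have huc : ContDiffAt ℝ 2 u z := hu' ▸ contDiffAt_const.smul hlog
  have hud : DifferentiableAt ℝ u z := huc.differentiableAt (by norm_num)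
  have hfu : ∀ v : ℂ, ‖v‖ = 1 → |fderiv ℝ u z v| ≤ 1 / L * (1 / ‖z - a‖) := by
    intro v hv
    rw [hu', fderiv_const_smul (hlog.differentiableAt (by norm_num)),
      smul_apply, smul_eq_mul, abs_mul]
    gcongr
    · rw [abs_div, abs_neg, abs_one, abs_of_pos (by positivity)]
    · exact abs_fderiv_log_norm_sub_le hz hv
  have hlap : Laplacian.laplacian u z = 0 := by
    rw [hu', laplacian_smul _ hlog, laplacian_log_norm_sub hz, smul_zero]
  -- on the region where the cutoff is not locally constant, `log |z - a|` is comparable to `L`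
  have hreg : u z ∈ Icc (1 : ℝ) 2 → 1 / L ≤ 3 / logGrowth a z ^ 2 := by
    rintro ⟨h1, h2⟩
    simp only [hu] at h1 h2
    rw [le_div_iff₀ (by positivity)] at h1
    rw [div_le_iff₀ (by positivity)] at h2
    rw [logGrowth_sq, abs_of_nonpos (by linarith), div_le_div_iff₀ (by positivity) (by linarith)]
    linarith
  have hfu' : u z ∈ Icc (1 : ℝ) 2 → ∀ v : ℂ, ‖v‖ = 1 →
      |fderiv ℝ u z v| ≤ 3 / (‖z - a‖ * logGrowth a z ^ 2) := by
    intro h v hv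
    refine (hfu v hv).trans ?_
    calc 1 / L * (1 / ‖z - a‖) ≤ 3 / logGrowth a z ^ 2 * (1 / ‖z - a‖) :=
          mul_le_mul_of_nonneg_right (hreg h) (by positivity)
      _ = _ := by field_simp
  have hev := logCutoff_eventuallyEq hz N
  constructor
  · intro v hv
    have hcomp := (((contDiff_cutoffProfile (n := 2)).differentiable (by norm_num)
      (u z)).hasDerivAt.comp_hasFDerivAt z hud.hasFDerivAt).fderiv
    rw [hev.fderiv_eq]
    change |fderiv ℝ (cutoffProfile ∘ u) z v| ≤ _
    rw [hcomp, smul_apply, smul_eq_mul, abs_mul]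
    by_cases h : u z ∈ Icc (1 : ℝ) 2
    · calc _ ≤ C * (3 / (‖z - a‖ * logGrowth a z ^ 2)) := by
            gcongr
            exacts [(hC _).1, hfu' h v hv]
        _ = 3 * C / (‖z - a‖ * logGrowth a z ^ 2) := by ring
        _ ≤ _ := by gcongr; norm_num
    · rw [deriv_cutoffProfile_of_notMem h, abs_zero, zero_mul]
      positivity
  · rw [laplacian_congr_at hev]
    change |Laplacian.laplacian (fun y => cutoffProfile (u y)) z| ≤ _
    rw [laplacian_comp (contDiff_cutoffProfile (n := 2)).contDiffAt huc, hlap, mul_zero, add_zero,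
      abs_mul]
    by_cases h : u z ∈ Icc (1 : ℝ) 2
    · have h1 := sq_le_sq' (neg_le_of_abs_le (hfu' h 1 (by simp)))
        (le_of_abs_le (hfu' h 1 (by simp)))
      have h2 := sq_le_sq' (neg_le_of_abs_le (hfu' h Complex.I (by simp)))
        (le_of_abs_le (hfu' h Complex.I (by simp)))
      rw [abs_of_nonneg (a := (fderiv ℝ u z 1) ^ 2 + _) (by positivity)]
      calc _ ≤ C * ((3 / (‖z - a‖ * logGrowth a z ^ 2)) ^ 2
              + (3 / (‖z - a‖ * logGrowth a z ^ 2)) ^ 2) := by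
            gcongr
            exact (hC _).2
        _ = 18 * C / (‖z - a‖ ^ 2 * logGrowth a z ^ 4) := by
            field_simp
            ring
    · rw [deriv_deriv_cutoffProfile_of_notMem h, abs_zero, zero_mul]
      positivity

/-! ### Green's identity across a mild isolated singularity -/

section Local

variable {a : ℂ} {ε : ℝ} {F w : ℂ → ℝ} {C : ℝ}

lemma isOpen_ball_diff_singleton (a : ℂ) (ε : ℝ) : IsOpen (ball a ε \ {a}) :=
  isOpen_ball.sdiff isClosed_singleton

lemma exists_bound_of_tsupport_subset_ball (hw : ContDiff ℝ 2 w) (hs : tsupport w ⊆ ball a ε) :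
    ∃ M, 0 ≤ M ∧ ∀ z, |w z| ≤ M ∧ |fderiv ℝ w z 1| ≤ M ∧ |fderiv ℝ w z Complex.I| ≤ M ∧
      |Laplacian.laplacian w z| ≤ M := by
  have hc : HasCompactSupport w :=
    (isCompact_closedBall a ε).of_isClosed_subset (isClosed_tsupport w)
      (hs.trans ball_subset_closedBall)
  have hd : ∀ v : ℂ, ∃ M, ∀ z, ‖fderiv ℝ w z v‖ ≤ M := fun v =>
    HasCompactSupport.exists_bound_of_continuous
      (hc.isCompact.of_isClosed_subset isClosed_closure (tsupport_fderiv_apply_subset ℝ v))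
      (continuousOn_univ.1 (continuousOn_fderiv_apply isOpen_univ hw.contDiffOn v))
  obtain ⟨M₀, h₀⟩ := hc.exists_bound_of_continuous hw.continuous
  obtain ⟨M₁, h₁⟩ := hd 1
  obtain ⟨M₂, h₂⟩ := hd Complex.I
  have hcl : HasCompactSupport (Laplacian.laplacian w) := HasCompactSupport.intro hc fun z hz => by
    rw [laplacian_congr_at (notMem_tsupport_iff_eventuallyEq.1 hz)]
    simp [Pi.zero_def]
  obtain ⟨M₃, h₃⟩ := hcl.exists_bound_of_continuous
    (continuousOn_univ.1 (continuousOn_laplacian isOpen_univ hw.contDiffOn))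
  refine ⟨max (max M₀ M₁) (max M₂ M₃), ?_, fun z => ⟨?_, ?_, ?_, ?_⟩⟩
  · exact ((norm_nonneg _).trans (h₀ 0)).trans (by simp)
  · exact (h₀ z).trans (by simp)
  · exact (h₁ z).trans (by simp)
  · exact (h₂ z).trans (by simp)
  · exact (h₃ z).trans (by simp)

lemma tsupport_logCutoff_mul_subset (hs : tsupport w ⊆ ball a ε) (N : ℕ) :
    tsupport (fun z => logCutoff a N z * w z) ⊆ ball a ε \ {a} := by
  intro z hz
  refine ⟨hs (tsupport_mul_subset_right hz), ?_⟩
  rintro rfl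
  exact notMem_tsupport_logCutoff z N (tsupport_mul_subset_left hz)

lemma isCompact_tsupport_logCutoff_mul (hs : tsupport w ⊆ ball a ε) (N : ℕ) :
    IsCompact (tsupport (fun z => logCutoff a N z * w z)) :=
  (isCompact_closedBall a ε).of_isClosed_subset (isClosed_tsupport _)
    ((tsupport_logCutoff_mul_subset hs N).trans (sdiff_subset.trans ball_subset_closedBall))

/-- The uniform bound that makes dominated convergence applicable. -/
lemma exists_bound_mul_laplacian_logCutoff (hε1 : ε ≤ 1)
    (hC : ∀ z ∈ ball a ε \ {a}, |F z| ≤ C * logGrowth a z)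
    (hw : ContDiff ℝ 2 w) (hs : tsupport w ⊆ ball a ε) :
    ∃ B, ∀ (N : ℕ) (z : ℂ), z ≠ a →
      |F z * Laplacian.laplacian (fun y => logCutoff a N y * w y) z|
        ≤ (ball a ε).indicator (fun z => B * singularWeight a z) z := by
  obtain ⟨M, hM0, hM⟩ := exists_bound_of_tsupport_subset_ball hw hs
  obtain ⟨K, hK0, hK⟩ := exists_bound_logCutoff a
  refine ⟨C * (M + 4 * K * M + K * M), fun N z hza => ?_⟩
  by_cases hz : z ∈ ball a ε
  · have hr1 : ‖z - a‖ ≤ 1 := by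
      rw [← dist_eq_norm]
      exact (mem_ball.1 hz).le.trans hε1
    have hpos : 0 < ‖z - a‖ := norm_pos_iff.2 (sub_ne_zero.2 hza)
    have hg := one_le_logGrowth a z
    have hF := hC z ⟨hz, hza⟩
    have hC0 : 0 ≤ C := by
      by_contra h
      have := (abs_nonneg _).trans hF
      nlinarith
    obtain ⟨hK1, hK2⟩ := hK N z hza
    obtain ⟨hM1, hM2, hM3, hM4⟩ := hM z
    have hc := logCutoff_le_one a N z
    have hc0 := logCutoff_nonneg a N z
    rw [indicator_of_mem hz, laplacian_mul (contDiff_logCutoff a N).contDiffAt hw.contDiffAt,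
      abs_mul]
    have hsum : |Laplacian.laplacian (logCutoff a N) z * w z
        + 2 * (fderiv ℝ (logCutoff a N) z 1 * fderiv ℝ w z 1
          + fderiv ℝ (logCutoff a N) z Complex.I * fderiv ℝ w z Complex.I)
        + logCutoff a N z * Laplacian.laplacian w z|
        ≤ K / (‖z - a‖ ^ 2 * logGrowth a z ^ 4) * M
          + 2 * (K / (‖z - a‖ * logGrowth a z ^ 2) * M + K / (‖z - a‖ * logGrowth a z ^ 2) * M)
          + 1 * M := by
      refine (abs_add_le _ _).trans (add_le_add ((abs_add_le _ _).trans (add_le_add ?_ ?_)) ?_)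
      · rw [abs_mul]; gcongr
      · rw [abs_mul, abs_two]
        gcongr
        refine (abs_add_le _ _).trans (add_le_add ?_ ?_)
        · rw [abs_mul]; gcongr; exact hK1 1 (by simp)
        · rw [abs_mul]; gcongr; exact hK1 _ (by simp)
      · rw [abs_mul, abs_of_nonneg hc0]; gcongr
    have e1 := logGrowth_le_singularWeight hza hr1
    have e2 := inv_mul_logGrowth_le_singularWeight hza hr1
    calc _ ≤ (C * logGrowth a z) * (K / (‖z - a‖ ^ 2 * logGrowth a z ^ 4) * M
          + 2 * (K / (‖z - a‖ * logGrowth a z ^ 2) * M + K / (‖z - a‖ * logGrowth a z ^ 2) * M)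
          + 1 * M) := by gcongr
      _ = C * (M * logGrowth a z + 4 * K * M * (1 / (‖z - a‖ * logGrowth a z))
          + K * M * singularWeight a z) := by
        rw [singularWeight]
        field_simp
        ring
      _ ≤ C * (M * singularWeight a z + 4 * K * M * singularWeight a z
          + K * M * singularWeight a z) := by gcongr
      _ = _ := by ring
  · rw [indicator_of_notMem hz, laplacian_congr_at (G := 0)]
    · simp [Pi.zero_def]
    · exact notMem_tsupport_iff_eventuallyEq.1 fun h =>
        hz (tsupport_logCutoff_mul_subset hs N h).1

lemma ae_ne (a : ℂ) : ∀ᵐ z : ℂ, z ≠ a := by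
  simp [ae_iff]

lemma integrable_mul_laplacian_logCutoff (hF : ContDiffOn ℝ 2 F (ball a ε \ {a}))
    (hw : ContDiff ℝ 2 w) (hs : tsupport w ⊆ ball a ε) (N : ℕ) :
    Integrable fun z => F z * Laplacian.laplacian (fun y => logCutoff a N y * w y) z :=
  integrable_mul_laplacian (isOpen_ball_diff_singleton a ε) hF.continuousOn
    ((contDiff_logCutoff a N).mul hw).contDiffOn
    (inter_subset_right.trans (tsupport_logCutoff_mul_subset hs N))
    ((isCompact_tsupport_logCutoff_mul hs N).inter_left (isClosed_tsupport F))

lemma tendsto_integral_mul_laplacian_logCutoff (hε1 : ε ≤ 1)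
    (hF : ContDiffOn ℝ 2 F (ball a ε \ {a}))
    (hC : ∀ z ∈ ball a ε \ {a}, |F z| ≤ C * logGrowth a z)
    (hw : ContDiff ℝ 2 w) (hs : tsupport w ⊆ ball a ε) :
    Integrable (fun z => F z * Laplacian.laplacian w z) ∧
    Tendsto (fun N : ℕ => ∫ z, F z * Laplacian.laplacian (fun y => logCutoff a N y * w y) z) atTop
      (𝓝 (∫ z, F z * Laplacian.laplacian w z)) := by
  obtain ⟨B, hB⟩ := exists_bound_mul_laplacian_logCutoff hε1 hC hw hs
  have hmeas := fun N => (integrable_mul_laplacian_logCutoff hF hw hs N).aestronglyMeasurable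
  have hlim : ∀ᵐ z : ℂ, Tendsto
      (fun N : ℕ => F z * Laplacian.laplacian (fun y => logCutoff a N y * w y) z) atTop
      (𝓝 (F z * Laplacian.laplacian w z)) := by
    filter_upwards [ae_ne a] with z hz
    refine tendsto_const_nhds.congr' ?_
    filter_upwards [eventually_logCutoff_eq_one hz] with N hN
    rw [laplacian_congr_at (F := fun y => logCutoff a N y * w y) (G := w)]
    filter_upwards [hN] with y hy
    simp [hy]
  have hbd : Integrable ((ball a ε).indicator fun z => B * singularWeight a z) :=
    IntegrableOn.integrable_indicator
      (((integrableOn_singularWeight a).mono_set (ball_subset_ball hε1)).const_mul B)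
      measurableSet_ball
  have hdom : ∀ N : ℕ, ∀ᵐ z : ℂ,
      ‖F z * Laplacian.laplacian (fun y => logCutoff a N y * w y) z‖
        ≤ (ball a ε).indicator (fun z => B * singularWeight a z) z := fun N => by
    filter_upwards [ae_ne a] with z hz using hB N z hz
  refine ⟨hbd.mono' (aestronglyMeasurable_of_tendsto_ae atTop hmeas hlim) ?_,
    tendsto_integral_of_dominated_convergence _ hmeas hbd hdom hlim⟩
  filter_upwards [hlim, ae_all_iff.2 hdom] with z h1 h2
  exact le_of_tendsto h1.norm (Eventually.of_forall h2)

lemma integral_laplacian_mul_logCutoff (hF : ContDiffOn ℝ 2 F (ball a ε \ {a}))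
    (hw : ContDiff ℝ 2 w) (hs : tsupport w ⊆ ball a ε) (N : ℕ) :
    ∫ z, Laplacian.laplacian F z * (logCutoff a N z * w z)
      = ∫ z, F z * Laplacian.laplacian (fun y => logCutoff a N y * w y) z :=
  integral_laplacian_mul_eq (isOpen_ball_diff_singleton a ε) hF
    ((contDiff_logCutoff a N).mul hw).contDiffOn
    (inter_subset_right.trans (tsupport_logCutoff_mul_subset hs N))
    ((isCompact_tsupport_logCutoff_mul hs N).inter_left (isClosed_tsupport F))

lemma integrable_laplacian_mul_logCutoff (hF : ContDiffOn ℝ 2 F (ball a ε \ {a}))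
    (hw : ContDiff ℝ 2 w) (hs : tsupport w ⊆ ball a ε) (N : ℕ) :
    Integrable fun z => Laplacian.laplacian F z * (logCutoff a N z * w z) := by
  refine integrable_of_continuousOn_of_support_subset
    ((continuousOn_laplacian (isOpen_ball_diff_singleton a ε) hF).mul
      ((contDiff_logCutoff a N).mul hw).continuous.continuousOn)
    (isCompact_tsupport_logCutoff_mul hs N) (tsupport_logCutoff_mul_subset hs N) ?_
  exact fun z hz => subset_tsupport _ (right_ne_zero_of_mul hz)

lemma tendsto_logCutoff_mul {z : ℂ} (hz : z ≠ a) (G w : ℂ → ℝ) :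
    Tendsto (fun N : ℕ => G z * (logCutoff a N z * w z)) atTop (𝓝 (G z * w z)) := by
  refine tendsto_const_nhds.congr' ?_
  filter_upwards [eventually_logCutoff_eq_one hz] with N hN
  simp [hN.self_of_nhds]

/-- A lower bound for the Laplacian suffices for its integrability: its integrals against the
logarithmic cutoff functions converge, by Green's identity, and Fatou's lemma applies. -/
lemma integrableOn_laplacian_of_le (hε0 : 0 < ε) (hε1 : ε ≤ 1)
    (hF : ContDiffOn ℝ 2 F (ball a ε \ {a}))
    (hC : ∀ z ∈ ball a ε \ {a}, |F z| ≤ C * logGrowth a z)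
    {ψ : ℂ → ℝ} (hψ : IntegrableOn ψ (ball a ε))
    (hle : ∀ z ∈ ball a ε \ {a}, -ψ z ≤ Laplacian.laplacian F z) :
    IntegrableOn (Laplacian.laplacian F) (ball a (ε / 2)) := by
  let χ : ContDiffBump a := ⟨ε / 2, 3 * ε / 4, by positivity, by linarith⟩
  have hχ : ContDiff ℝ 2 χ := χ.contDiff
  have hs : tsupport χ ⊆ ball a ε := by
    rw [χ.tsupport_eq]
    exact closedBall_subset_ball (by change 3 * ε / 4 < ε; linarith)
  set ψ₁ := (ball a ε).indicator ψ with hψ₁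
  have hψi : Integrable ψ₁ := hψ.integrable_indicator measurableSet_ball
  have hle₁ : ∀ z, z ∈ ball a ε → z ≠ a → 0 ≤ Laplacian.laplacian F z + ψ₁ z := fun z hz hza => by
    rw [hψ₁, indicator_of_mem hz]
    linarith [hle z ⟨hz, hza⟩]
  have hψm : ∀ N, Integrable fun z => ψ₁ z * (logCutoff a N z * χ z) := fun N => by
    refine hψi.mul_bdd (c := 1)
      ((contDiff_logCutoff a N).mul hχ).continuous.aestronglyMeasurable ?_
    refine Eventually.of_forall fun z => ?_
    rw [Real.norm_of_nonneg (mul_nonneg (logCutoff_nonneg _ _ _) χ.nonneg)]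
    exact mul_le_one₀ (logCutoff_le_one _ _ _) χ.nonneg χ.le_one
  obtain ⟨-, hT⟩ := tendsto_integral_mul_laplacian_logCutoff hε1 hF hC hχ hs
  obtain ⟨B, hB⟩ := hT.bddAbove_range
  set G : ℕ → ℂ → ℝ := fun N z => (Laplacian.laplacian F z + ψ₁ z) * (logCutoff a N z * χ z)
    with hG
  have hGi : ∀ N, Integrable (G N) := fun N => by
    simp only [hG, add_mul]
    exact (integrable_laplacian_mul_logCutoff hF hχ hs N).add (hψm N)
  have hG0 : ∀ N, 0 ≤ᵐ[volume] G N := fun N => by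
    filter_upwards [ae_ne a] with z hz
    by_cases hzb : z ∈ ball a ε
    · exact mul_nonneg (hle₁ z hzb hz) (mul_nonneg (logCutoff_nonneg _ _ _) χ.nonneg)
    · have : χ z = 0 := image_eq_zero_of_notMem_tsupport fun h => hzb (hs h)
      simp [hG, this]
  have hGle : ∀ N, ∫ z, G N z ≤ B + ∫ z, |ψ₁ z| := fun N => by
    simp only [hG, add_mul]
    rw [integral_add (integrable_laplacian_mul_logCutoff hF hχ hs N) (hψm N),
      integral_laplacian_mul_logCutoff hF hχ hs N]
    refine add_le_add (hB (mem_range_self N)) (integral_mono (hψm N) hψi.abs fun z => ?_)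
    have h0 := mul_nonneg (logCutoff_nonneg a N z) (χ.nonneg (x := z))
    have h1 := mul_le_one₀ (logCutoff_le_one a N z) χ.nonneg (χ.le_one (x := z))
    calc _ ≤ |ψ₁ z * (logCutoff a N z * χ z)| := le_abs_self _
      _ = |ψ₁ z| * (logCutoff a N z * χ z) := by rw [abs_mul, abs_of_nonneg h0]
      _ ≤ |ψ₁ z| := mul_le_of_le_one_right (abs_nonneg _) h1
  have hlim : ∀ᵐ z : ℂ, Tendsto (fun N => G N z) atTop
      (𝓝 ((Laplacian.laplacian F z + ψ₁ z) * χ z)) := by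
    filter_upwards [ae_ne a] with z hz
    exact tendsto_logCutoff_mul hz (fun z => Laplacian.laplacian F z + ψ₁ z) χ
  have hint : Integrable fun z => (Laplacian.laplacian F z + ψ₁ z) * χ z := by
    refine ⟨aestronglyMeasurable_of_tendsto_ae atTop (fun N => (hGi N).aestronglyMeasurable) hlim,
      ?_⟩
    refine ((lintegral_congr_ae (hlim.mono fun z hz => hz.enorm.liminf_eq.symm)).trans_le
      (lintegral_liminf_le' fun N => (hGi N).aestronglyMeasurable.enorm)).trans_lt ?_
    refine (liminf_le_of_le (a := ENNReal.ofReal (B + ∫ z, |ψ₁ z|)) (by isBoundedDefault)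
      fun b hb => ?_).trans_lt ENNReal.ofReal_lt_top
    obtain ⟨N, hN⟩ := hb.exists
    refine hN.trans ?_
    rw [← ofReal_integral_norm_eq_lintegral_enorm (hGi N)]
    refine ENNReal.ofReal_le_ofReal ((integral_congr_ae ?_).trans_le (hGle N))
    filter_upwards [hG0 N] with z hz using Real.norm_of_nonneg hz
  have hon : IntegrableOn (fun z => Laplacian.laplacian F z + ψ₁ z) (ball a (ε / 2)) := by
    refine hint.integrableOn.congr_fun (fun z hz => ?_) measurableSet_ball
    change _ * χ z = _
    rw [χ.one_of_mem_closedBall (ball_subset_closedBall hz), mul_one]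
  exact (hon.sub hψi.integrableOn).congr_fun (fun z _ => by simp) measurableSet_ball

/-- **Green's identity** for a function with a mild isolated singularity: since the function is
`o(log |z - a|)`, the singularity does not contribute. -/
lemma integral_laplacian_mul_eq_of_le (hε0 : 0 < ε) (hε1 : ε ≤ 1)
    (hF : ContDiffOn ℝ 2 F (ball a ε \ {a}))
    (hC : ∀ z ∈ ball a ε \ {a}, |F z| ≤ C * logGrowth a z)
    {ψ : ℂ → ℝ} (hψ : IntegrableOn ψ (ball a ε))
    (hle : ∀ z ∈ ball a ε \ {a}, -ψ z ≤ Laplacian.laplacian F z)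
    (hw : ContDiff ℝ 2 w) (hs : tsupport w ⊆ ball a (ε / 2)) :
    Integrable (fun z => Laplacian.laplacian F z * w z) ∧
    Integrable (fun z => F z * Laplacian.laplacian w z) ∧
    ∫ z, Laplacian.laplacian F z * w z = ∫ z, F z * Laplacian.laplacian w z := by
  have hs' : tsupport w ⊆ ball a ε := hs.trans (ball_subset_ball (by linarith))
  have hon := integrableOn_laplacian_of_le hε0 hε1 hF hC hψ hle
  obtain ⟨hi, hT⟩ := tendsto_integral_mul_laplacian_logCutoff hε1 hF hC hw hs'
  obtain ⟨M, -, hM⟩ := exists_bound_of_tsupport_subset_ball hw hs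
  have hint : Integrable (fun z => Laplacian.laplacian F z * w z) := by
    refine (integrableOn_iff_integrable_of_support_subset (s := ball a (ε / 2)) ?_).1
      (hon.mul_bdd (c := M) hw.continuous.aestronglyMeasurable
        (Eventually.of_forall fun z => (hM z).1))
    exact fun z hz => hs (subset_tsupport _ (right_ne_zero_of_mul hz))
  refine ⟨hint, hi, ?_⟩
  simp_rw [← integral_laplacian_mul_logCutoff hF hw hs'] at hT
  refine tendsto_nhds_unique ?_ hT
  refine tendsto_integral_of_dominated_convergence _
    (fun N => (integrable_laplacian_mul_logCutoff hF hw hs' N).aestronglyMeasurable) hint.norm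
    (fun N => Eventually.of_forall fun z => ?_) ?_
  · rw [mul_left_comm, norm_mul]
    refine mul_le_of_le_one_left (norm_nonneg _) ?_
    rw [Real.norm_of_nonneg (logCutoff_nonneg _ _ _)]
    exact logCutoff_le_one _ _ _
  · filter_upwards [ae_ne a] with z hz
    exact tendsto_logCutoff_mul hz _ _

end Local

/-! ### Functions with finitely many mild singularities -/

/-- `φ` has a mild singularity at `a`: it grows at most like the square root of `log |z - a|`, and
its Laplacian is bounded below by a function that is integrable near `a`. Growth slower than
that of `log |z - a|` excludes a logarithmic pole, hence a mass of `Δφ` at `a`; the square root is a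
convenient choice. -/
def IsMildAt (φ : ℂ → ℝ) (a : ℂ) : Prop :=
  (∃ C, ∀ᶠ z in 𝓝[≠] a, |φ z| ≤ C * logGrowth a z) ∧
    ∃ ψ : ℂ → ℝ, IntegrableAtFilter ψ (𝓝 a) ∧ ∀ᶠ z in 𝓝[≠] a, -ψ z ≤ Laplacian.laplacian φ z

/-- `F` has compact support and is of class `C²` off the finite set `A`, at the points of which it
has mild singularities. -/
structure HasMildSingularities (A : Finset ℂ) (F : ℂ → ℝ) : Prop where
  contDiffOn : ContDiffOn ℝ 2 F (A : Set ℂ)ᶜ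
  hasCompactSupport : HasCompactSupport F
  isMildAt : ∀ a ∈ A, IsMildAt F a

lemma laplacian_finset_sum {ι : Type*} (s : Finset ι) (G : ι → ℂ → ℝ) {z : ℂ}
    (hG : ∀ i ∈ s, ContDiffAt ℝ 2 (G i) z) :
    Laplacian.laplacian (fun y => ∑ i ∈ s, G i y) z = ∑ i ∈ s, Laplacian.laplacian (G i) z := by
  classical
  induction s using Finset.induction_on with
  | empty => simp
  | insert i s his ih =>
    simp only [Finset.sum_insert his]
    rw [← ih fun j hj => hG j (Finset.mem_insert_of_mem hj)]
    exact ContDiffAt.laplacian_add (hG i (Finset.mem_insert_self i s))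
      (ContDiffAt.sum fun j hj => hG j (Finset.mem_insert_of_mem hj))

lemma isOpen_compl_coe_finset (A : Finset ℂ) : IsOpen (A : Set ℂ)ᶜ :=
  A.finite_toSet.isClosed.isOpen_compl

namespace HasMildSingularities

variable {A : Finset ℂ} {F : ℂ → ℝ}

lemma exists_radius (hF : HasMildSingularities A F) {a : ℂ} (ha : a ∈ A) :
    ∃ (ε C : ℝ) (ψ : ℂ → ℝ), 0 < ε ∧ ε ≤ 1 ∧ ball a ε \ {a} ⊆ (A : Set ℂ)ᶜ ∧
      (∀ z ∈ ball a ε \ {a}, |F z| ≤ C * logGrowth a z) ∧ IntegrableOn ψ (ball a ε) ∧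
      ∀ z ∈ ball a ε \ {a}, -ψ z ≤ Laplacian.laplacian F z := by
  obtain ⟨⟨C, hC⟩, ψ, ⟨s, hs, hψ⟩, hle⟩ := hF.isMildAt a ha
  have hA : ∀ᶠ z in 𝓝[≠] a, z ∈ (A : Set ℂ)ᶜ := by
    have : (↑(A.erase a) : Set ℂ)ᶜ ∈ 𝓝 a :=
      (isOpen_compl_coe_finset _).mem_nhds (by simp)
    filter_upwards [nhdsWithin_le_nhds this, self_mem_nhdsWithin] with z h1 h2 h3
    exact h1 (Finset.mem_coe.2 (Finset.mem_erase.2 ⟨h2, h3⟩))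
  have hs' : ∀ᶠ z in 𝓝[≠] a, z ∈ s := nhdsWithin_le_nhds hs
  have hall := hC.and (hle.and hA)
  rw [eventually_nhdsWithin_iff] at hall
  obtain ⟨ε, hε, hb⟩ := eventually_nhds_iff_ball.1 (hall.and hs)
  refine ⟨min ε 1, C, ψ, by positivity, min_le_right _ _, ?_, ?_, ?_, ?_⟩
  · exact fun z hz => ((hb z (ball_subset_ball (min_le_left _ _) hz.1)).1 hz.2).2.2
  · exact fun z hz => ((hb z (ball_subset_ball (min_le_left _ _) hz.1)).1 hz.2).1
  · exact hψ.mono_set fun z hz => (hb z (ball_subset_ball (min_le_left _ _) hz)).2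
  · exact fun z hz => ((hb z (ball_subset_ball (min_le_left _ _) hz.1)).1 hz.2).2.1

/-- **Green's identity** for a function with mild singularities: its Laplacian off the singular set
is integrable and is its Laplacian in the sense of distributions. -/
theorem integral_laplacian_mul (hF : HasMildSingularities A F) {w : ℂ → ℝ} (hw : ContDiff ℝ 2 w) :
    Integrable (fun z => Laplacian.laplacian F z * w z) ∧
    Integrable (fun z => F z * Laplacian.laplacian w z) ∧
    ∫ z, Laplacian.laplacian F z * w z = ∫ z, F z * Laplacian.laplacian w z := by
  classical
  have hrad : ∀ a : A, _ := fun a => hF.exists_radius a.2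
  choose ε C ψ hε0 hε1 hA hC hψ hle using hrad
  let χ : ∀ a : A, ContDiffBump (a : ℂ) := fun a =>
    ⟨ε a / 4, ε a / 3, by linarith [hε0 a], by linarith [hε0 a]⟩
  have hχ : ∀ a, ContDiff ℝ 2 (χ a) := fun a => (χ a).contDiff
  have hχs : ∀ a, tsupport (χ a) ⊆ ball (a : ℂ) (ε a / 2) := fun a => by
    rw [(χ a).tsupport_eq]
    exact closedBall_subset_ball (by change ε a / 3 < ε a / 2; linarith [hε0 a])
  -- the part of `w` near the singularity `a`
  have hloc : ∀ a : A, _ := fun a =>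
    integral_laplacian_mul_eq_of_le (w := fun z => χ a z * w z) (hε0 a) (hε1 a)
      (hF.contDiffOn.mono (hA a)) (hC a) (hψ a) (hle a) ((hχ a).mul hw)
      (tsupport_mul_subset_left.trans (hχs a))
  -- the part of `w` away from the singularities
  set w₀ : ℂ → ℝ := fun z => (1 - ∑ a, χ a z) * w z with hw₀
  have hw₀c : ContDiff ℝ 2 w₀ :=
    (contDiff_const.sub (ContDiff.sum fun a _ => hχ a)).mul hw
  have hs₀ : tsupport F ∩ tsupport w₀ ⊆ (A : Set ℂ)ᶜ := by
    rintro z ⟨-, hz⟩ hzA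
    lift z to A using hzA
    refine (notMem_tsupport_iff_eventuallyEq.2 ?_) hz
    have hoff : ∀ᶠ y in 𝓝 (z : ℂ), ∀ b : A, b ≠ z → χ b y = 0 := by
      rw [eventually_all]
      intro b
      by_cases hb : b = z
      · simp [hb]
      have : (z : ℂ) ∉ tsupport (χ b) := fun h =>
        hA b ⟨ball_subset_ball (by linarith [hε0 b]) (hχs b h), fun h' => hb (Subtype.ext h'.symm)⟩
          z.2
      filter_upwards [notMem_tsupport_iff_eventuallyEq.1 this] with y hy _ using hy
    filter_upwards [hoff, (χ z).eventuallyEq_one] with y h1 h2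
    simp only [hw₀, Pi.zero_apply, mul_eq_zero]
    left
    rw [Finset.sum_eq_single z (fun b _ hb => h1 b hb) (by simp), h2]
    simp
  have hc₀ : IsCompact (tsupport F ∩ tsupport w₀) :=
    hF.hasCompactSupport.isCompact.inter_right (isClosed_tsupport _)
  have hO := isOpen_compl_coe_finset A
  have h₀ := integral_laplacian_mul_eq hO hF.contDiffOn hw₀c.contDiffOn hs₀ hc₀
  have h₀i := integrable_mul_laplacian hO hF.contDiffOn.continuousOn hw₀c.contDiffOn hs₀ hc₀
  have h₀i' : Integrable fun z => Laplacian.laplacian F z * w₀ z := by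
    simp_rw [mul_comm (Laplacian.laplacian F _)]
    exact integrable_mul_laplacian hO hw₀c.continuous.continuousOn hF.contDiffOn
      (by rwa [inter_comm]) (by rwa [inter_comm])
  have hsplit : ∀ z, w z = w₀ z + ∑ a, χ a z * w z := fun z => by
    simp only [hw₀, ← Finset.sum_mul]
    ring
  have e1 : (fun z => Laplacian.laplacian F z * w z) = fun z => Laplacian.laplacian F z * w₀ z
      + ∑ a, Laplacian.laplacian F z * (χ a z * w z) := by
    ext z
    rw [← Finset.mul_sum, ← mul_add, ← hsplit]
  have e2 : (fun z => F z * Laplacian.laplacian w z) = fun z => F z * Laplacian.laplacian w₀ z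
      + ∑ a, F z * Laplacian.laplacian (fun y => χ a y * w y) z := by
    ext z
    have hm : ∀ a ∈ Finset.univ, ContDiffAt ℝ 2 (fun y => χ a y * w y) z := fun a _ =>
      ((hχ a).mul hw).contDiffAt
    rw [← Finset.mul_sum, ← mul_add, ← laplacian_finset_sum _ _ hm]
    congr 1
    rw [laplacian_congr_at (Eventually.of_forall hsplit)]
    exact ContDiffAt.laplacian_add hw₀c.contDiffAt (ContDiffAt.sum hm)
  have i1 := integrable_finsetSum Finset.univ fun a _ => (hloc a).1
  have i2 := integrable_finsetSum Finset.univ fun a _ => (hloc a).2.1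
  refine ⟨e1 ▸ h₀i'.add i1, e2 ▸ h₀i.add i2, ?_⟩
  rw [e1, e2, integral_add h₀i' i1, integral_add h₀i i2,
    integral_finsetSum _ fun a _ => (hloc a).1, integral_finsetSum _ fun a _ => (hloc a).2.1, h₀]
  congr 1
  exact Finset.sum_congr rfl fun a _ => (hloc a).2.2

lemma integrable_laplacian (hF : HasMildSingularities A F) :
    Integrable (Laplacian.laplacian F) := by
  simpa using (hF.integral_laplacian_mul (w := fun _ => 1) contDiff_const).1

lemma laplacian_eq_zero {z : ℂ} (hz : z ∉ tsupport F) : Laplacian.laplacian F z = 0 := by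
  rw [laplacian_congr_at (notMem_tsupport_iff_eventuallyEq.1 hz)]
  simp [Pi.zero_def]

lemma integrable (hF : HasMildSingularities A F) : Integrable F := by
  have hm : AEStronglyMeasurable F volume := by
    have hA : (A : Set ℂ)ᶜ =ᵐ[volume] univ := by
      rw [← compl_empty]
      exact (ae_eq_empty.2 (A.finite_toSet.measure_zero _)).compl
    rw [← Measure.restrict_univ (μ := volume), ← Measure.restrict_congr_set hA]
    exact hF.contDiffOn.continuousOn.aestronglyMeasurable
      (isOpen_compl_coe_finset A).measurableSet
  have hl : LocallyIntegrable F := by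
    intro x
    by_cases hx : x ∈ A
    · obtain ⟨ε, C, ψ, hε0, hε1, -, hC, -⟩ := hF.exists_radius hx
      refine ⟨ball x ε, ball_mem_nhds x hε0, ?_⟩
      refine Integrable.mono' (((integrableOn_singularWeight x).mono_set
        (ball_subset_ball hε1)).const_mul |C|) hm.restrict ?_
      filter_upwards [ae_restrict_mem measurableSet_ball, ae_restrict_of_ae (ae_ne x)] with z h1 h2
      refine (hC z ⟨h1, h2⟩).trans ?_
      have h3 : ‖z - x‖ ≤ 1 := by
        rw [← dist_eq_norm]
        exact (mem_ball.1 h1).le.trans hε1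
      have := one_le_logGrowth x z
      calc C * logGrowth x z ≤ |C| * logGrowth x z := by gcongr; exact le_abs_self C
        _ ≤ _ := by gcongr; exact logGrowth_le_singularWeight h2 h3
    · have hO := isOpen_compl_coe_finset A
      rw [← hO.nhdsWithin_eq hx]
      exact hF.contDiffOn.continuousOn.integrableAt_nhdsWithin hO.measurableSet hx
  exact (integrableOn_iff_integrable_of_support_subset (subset_tsupport F)).1
    (hl.integrableOn_isCompact hF.hasCompactSupport)

end HasMildSingularities

/-! ### The logarithmic potential -/

lemma hasFDerivAt_norm_sq_sub (b z : ℂ) :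
    HasFDerivAt (fun y : ℂ => ‖y - b‖ ^ 2) (2 • (innerSL ℝ) (z - b)) z := by
  simpa using ((hasFDerivAt_id z).sub_const b).norm_sq

lemma contDiff_norm_sq_sub (b : ℂ) : ContDiff ℝ 2 (fun y : ℂ => ‖y - b‖ ^ 2) :=
  (contDiff_id.sub contDiff_const).norm_sq ℝ

lemma laplacian_norm_sq_sub (b z : ℂ) :
    Laplacian.laplacian (fun y : ℂ => ‖y - b‖ ^ 2) z = 4 := by
  have key : ∀ v : ℂ, dirDeriv₂ v (fun y : ℂ => ‖y - b‖ ^ 2) z = 2 * ‖v‖ ^ 2 := by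
    intro v
    have h : (fun y => fderiv ℝ (fun y : ℂ => ‖y - b‖ ^ 2) y v)
        = fun y => 2 * (v.re * (y.re - b.re) + v.im * (y.im - b.im)) := by
      ext y
      rw [(hasFDerivAt_norm_sq_sub b y).fderiv]
      simp [Complex.inner]
      ring
    have h2 : HasFDerivAt (fun y : ℂ => 2 * (v.re * (y.re - b.re) + v.im * (y.im - b.im)))
        ((2 : ℝ) • (v.re • Complex.reCLM + v.im • Complex.imCLM)) z :=
      (((Complex.reCLM.hasFDerivAt.sub_const b.re).const_mul v.re).add
        ((Complex.imCLM.hasFDerivAt.sub_const b.im).const_mul v.im)).const_mul 2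
    rw [dirDeriv₂, h, h2.fderiv]
    simp [Complex.sq_norm, Complex.normSq_apply]
    ring
  rw [laplacian_eq_dirDeriv₂ (contDiff_norm_sq_sub b).contDiffAt, key, key]
  simp
  norm_num

/-- `½ log (|z - b|² + δ)`, a smooth approximation of `log |z - b|`. -/
noncomputable def regLog (b : ℂ) (δ : ℝ) (z : ℂ) : ℝ := 1 / 2 * Real.log (‖z - b‖ ^ 2 + δ)

lemma contDiff_regLog (b : ℂ) {δ : ℝ} (hδ : 0 < δ) : ContDiff ℝ 2 (regLog b δ) :=
  contDiff_const.mul (((contDiff_norm_sq_sub b).add contDiff_const).log fun _ => by positivity)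

lemma laplacian_regLog (b z : ℂ) {δ : ℝ} (hδ : 0 < δ) :
    Laplacian.laplacian (regLog b δ) z = 2 * δ / (‖z - b‖ ^ 2 + δ) ^ 2 := by
  set u : ℂ → ℝ := fun y => ‖y - b‖ ^ 2 with hu
  have hd : ∀ t : ℝ, 0 < t + δ →
      HasDerivAt (fun t => 1 / 2 * Real.log (t + δ)) (1 / 2 * (t + δ)⁻¹) t := fun t ht => by
    have := (((hasDerivAt_id t).add_const δ).log ht.ne').const_mul (1 / 2)
    simpa using this
  have hu0 : 0 ≤ u z := by positivity
  have hpos : 0 < u z + δ := by positivity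
  have hd1 : deriv (fun t => 1 / 2 * Real.log (t + δ)) =ᶠ[𝓝 (u z)] fun t => 1 / 2 * (t + δ)⁻¹ := by
    have : ∀ᶠ t in 𝓝 (u z), 0 < t + δ :=
      (continuous_id.add continuous_const).continuousAt.eventually (lt_mem_nhds hpos)
    filter_upwards [this] with t ht using (hd t ht).deriv
  have hd2 : deriv (deriv (fun t => 1 / 2 * Real.log (t + δ))) (u z)
      = -(1 / 2) / (u z + δ) ^ 2 := by
    rw [hd1.deriv_eq]
    have := (((hasDerivAt_id (u z)).add_const δ).fun_inv hpos.ne').const_mul (1 / 2)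
    simp only [id] at this
    rw [this.deriv]
    ring
  have hκ : ContDiffAt ℝ 2 (fun t => 1 / 2 * Real.log (t + δ)) (u z) :=
    contDiffAt_const.mul ((contDiffAt_id.add contDiffAt_const).log hpos.ne')
  have hgrad : (fderiv ℝ u z 1) ^ 2 + (fderiv ℝ u z Complex.I) ^ 2 = 4 * u z := by
    rw [hu, (hasFDerivAt_norm_sq_sub b z).fderiv]
    simp [Complex.inner, Complex.sq_norm, Complex.normSq_apply]
    ring
  change Laplacian.laplacian (fun y => (fun t => 1 / 2 * Real.log (t + δ)) (u y)) z = _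
  rw [laplacian_comp hκ (contDiff_norm_sq_sub b).contDiffAt, hd2, hd1.self_of_nhds, hgrad,
    laplacian_norm_sq_sub]
  change _ = 2 * δ / (u z + δ) ^ 2
  field_simp
  ring

lemma integral_inv_one_add_norm_sq_sq :
    ∫ z : ℂ, 1 / Real.pi * (1 / (1 + ‖z‖ ^ 2) ^ 2) = 1 := by
  have hder : ∀ y ∈ Ici (0 : ℝ), HasDerivAt (fun y : ℝ => -(1 / 2) * (1 + y ^ 2)⁻¹)
      (y * (1 / (1 + y ^ 2) ^ 2)) y := fun y _ => by
    have hp : 1 + y ^ 2 ≠ 0 := by positivity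
    have := (((hasDerivAt_pow 2 y).const_add 1).fun_inv hp).const_mul (-(1 / 2))
    refine this.congr_deriv ?_
    field_simp
    ring
  have hlim : Tendsto (fun y : ℝ => -(1 / 2) * (1 + y ^ 2)⁻¹) atTop (𝓝 0) := by
    have : Tendsto (fun y : ℝ => 1 + y ^ 2) atTop atTop :=
      tendsto_atTop_add_const_left _ _ (tendsto_pow_atTop (by norm_num))
    simpa only [mul_zero, Pi.inv_apply] using this.inv_tendsto_atTop.const_mul (-(1 / 2))
  have hint := integral_Ioi_of_hasDerivAt_of_nonneg' (a := (0 : ℝ)) hder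
    (fun y hy => by have := mem_Ioi.1 hy; positivity) hlim
  rw [integral_const_mul, integral_fun_norm_addHaar volume (fun y => 1 / (1 + y ^ 2) ^ 2)]
  simp only [Complex.finrank_real_complex, smul_eq_mul, nsmul_eq_mul, Nat.add_one_sub_one, pow_one]
  rw [hint, Measure.real, Complex.volume_ball]
  simp
  field_simp

lemma tendsto_norm_sq_mul_inv_one_add_norm_sq_sq :
    Tendsto (fun z : ℂ => ‖z‖ ^ Module.finrank ℝ ℂ * (1 / Real.pi * (1 / (1 + ‖z‖ ^ 2) ^ 2)))
      (Bornology.cobounded ℂ) (𝓝 0) := by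
  have h1 : Tendsto (fun z : ℂ => 1 / Real.pi * (1 + ‖z‖ ^ 2)⁻¹) (Bornology.cobounded ℂ) (𝓝 0) := by
    have : Tendsto (fun z : ℂ => 1 + ‖z‖ ^ 2) (Bornology.cobounded ℂ) atTop :=
      tendsto_atTop_add_const_left _ _
        ((tendsto_pow_atTop (by norm_num)).comp tendsto_norm_cobounded_atTop)
    simpa using this.inv_tendsto_atTop.const_mul (1 / Real.pi)
  refine squeeze_zero (fun z => by positivity) (fun z => ?_) h1
  rw [Complex.finrank_real_complex]
  have hp := Real.pi_pos
  have : ‖z‖ ^ 2 / (1 + ‖z‖ ^ 2) ≤ 1 := by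
    rw [div_le_one (by positivity)]
    linarith
  calc _ = 1 / Real.pi * (1 + ‖z‖ ^ 2)⁻¹ * (‖z‖ ^ 2 / (1 + ‖z‖ ^ 2)) := by
        field_simp
    _ ≤ _ := mul_le_of_le_one_right (by positivity) this

lemma abs_regLog_le {b z : ℂ} (hz : z ≠ b) {δ : ℝ} (h0 : 0 < δ) (h1 : δ ≤ 1) :
    |regLog b δ z| ≤ |Real.log ‖z - b‖| + |regLog b 1 z| := by
  have hr : 0 < ‖z - b‖ := norm_pos_iff.2 (sub_ne_zero.2 hz)
  have e1 : Real.log ‖z - b‖ ≤ regLog b δ z := by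
    rw [regLog]
    have : Real.log (‖z - b‖ ^ 2) ≤ Real.log (‖z - b‖ ^ 2 + δ) :=
      Real.log_le_log (by positivity) (by linarith)
    rw [Real.log_pow] at this
    push_cast at this
    linarith
  have e2 : regLog b δ z ≤ regLog b 1 z := by
    unfold regLog
    gcongr
  refine (abs_le_max_abs_abs e1 e2).trans (max_le ?_ ?_)
  · linarith [abs_nonneg (regLog b 1 z)]
  · linarith [abs_nonneg (Real.log ‖z - b‖)]

lemma integrableOn_log_norm_sub (b : ℂ) (δ : ℝ) :
    IntegrableOn (fun z : ℂ => Real.log ‖z - b‖) (ball b δ) := by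
  have h2 : IntegrableOn (fun z : ℂ => Real.log ‖z‖) (ball 0 δ) := by
    refine (integrableOn_fun_norm_addHaar volume (f := Real.log)).2 ?_
    have : IntegrableOn (fun y : ℝ => y * Real.log y) (Icc 0 δ) :=
      Real.continuous_mul_log.continuousOn.integrableOn_compact isCompact_Icc
    refine (this.mono_set Ioo_subset_Icc_self).congr_fun (fun y _ => ?_) measurableSet_Ioo
    simp
  rw [← integrable_indicator_iff measurableSet_ball] at h2 ⊢
  refine (h2.comp_sub_right b).congr (Eventually.of_forall fun z => ?_)
  simp [indicator, dist_eq_norm]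

namespace HasMildSingularities

variable {A : Finset ℂ} {F : ℂ → ℝ}

lemma contDiffAt (hF : HasMildSingularities A F) {z : ℂ} (hz : z ∉ A) : ContDiffAt ℝ 2 F z :=
  hF.contDiffOn.contDiffAt ((isOpen_compl_coe_finset A).mem_nhds hz)

lemma integrable_laplacian_mul_log (hF : HasMildSingularities A F) {b : ℂ} (hb : b ∉ A) :
    Integrable fun z => Laplacian.laplacian F z * Real.log ‖z - b‖ := by
  have hi := hF.integrable_laplacian
  have hcont : ContinuousAt (Laplacian.laplacian F) b :=
    (continuousOn_laplacian (isOpen_compl_coe_finset A) hF.contDiffOn).continuousAt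
      ((isOpen_compl_coe_finset A).mem_nhds hb)
  obtain ⟨δ, hδ, hbd⟩ := eventually_nhds_iff_ball.1
    (hcont.norm.eventually (gt_mem_nhds (lt_add_one ‖Laplacian.laplacian F b‖)))
  have hmlog : AEStronglyMeasurable (fun z : ℂ => Real.log ‖z - b‖) volume :=
    (Real.measurable_log.comp (measurable_id.sub_const b).norm).aestronglyMeasurable
  have h1 : IntegrableOn (fun z => Laplacian.laplacian F z * Real.log ‖z - b‖) (ball b δ) := by
    refine (integrableOn_log_norm_sub b δ).bdd_mul (c := ‖Laplacian.laplacian F b‖ + 1)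
      hi.aestronglyMeasurable.restrict ?_
    filter_upwards [ae_restrict_mem measurableSet_ball] with z hz using (hbd z hz).le
  obtain ⟨R, hR⟩ := hF.hasCompactSupport.isCompact.isBounded.subset_closedBall b
  have h2 : IntegrableOn (fun z => Laplacian.laplacian F z * Real.log ‖z - b‖) (ball b δ)ᶜ := by
    refine Integrable.mono' (hi.norm.const_mul (max |Real.log δ| |Real.log R|)).integrableOn
      (hi.aestronglyMeasurable.mul hmlog).restrict ?_
    filter_upwards [ae_restrict_mem measurableSet_ball.compl] with z hz
    by_cases hzs : z ∈ tsupport F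
    · have hz1 : δ ≤ ‖z - b‖ := by simpa [dist_eq_norm] using hz
      have hz2 : ‖z - b‖ ≤ R := by simpa [dist_eq_norm] using hR hzs
      rw [norm_mul, mul_comm]
      gcongr
      exact abs_le_max_abs_abs (Real.log_le_log hδ hz1) (Real.log_le_log (hδ.trans_le hz1) hz2)
    · simp [laplacian_eq_zero hzs]
  simpa using h1.union h2

/-- A function with mild singularities is the logarithmic potential of its Laplacian. -/
theorem integral_laplacian_mul_log (hF : HasMildSingularities A F) {b : ℂ} (hb : b ∉ A) :
    ∫ z, Laplacian.laplacian F z * Real.log ‖z - b‖ = 2 * Real.pi * F b := by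
  -- the Laplacian of `½ log (|z - b|² + c⁻²)` is an approximate identity as `c → ∞`
  have hpeak := (tendsto_integral_comp_smul_smul_of_integrable' (μ := volume) (x₀ := b)
    (φ := fun z : ℂ => 1 / Real.pi * (1 / (1 + ‖z‖ ^ 2) ^ 2)) (fun z => by positivity)
    integral_inv_one_add_norm_sq_sq tendsto_norm_sq_mul_inv_one_add_norm_sq_sq hF.integrable
    (hF.contDiffAt hb).continuousAt).const_mul (2 * Real.pi)
  have hi1 := hF.integrable_laplacian_mul_log hb
  have hi2 := (hF.integral_laplacian_mul (contDiff_regLog b one_pos)).1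
  have hδlim : Tendsto (fun c : ℝ => (c ^ 2)⁻¹) atTop (𝓝 0) :=
    (tendsto_pow_atTop (by norm_num)).inv_tendsto_atTop
  have hleft : Tendsto (fun c : ℝ => ∫ z, Laplacian.laplacian F z * regLog b (c ^ 2)⁻¹ z) atTop
      (𝓝 (∫ z, Laplacian.laplacian F z * Real.log ‖z - b‖)) := by
    refine tendsto_integral_filter_of_dominated_convergence
      (fun z => |Laplacian.laplacian F z * Real.log ‖z - b‖|
        + |Laplacian.laplacian F z * regLog b 1 z|) ?_ ?_ (hi1.abs.add hi2.abs) ?_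
    · filter_upwards [eventually_ge_atTop 1] with c hc
      exact (hF.integral_laplacian_mul
        (contDiff_regLog b (by positivity))).1.aestronglyMeasurable
    · filter_upwards [eventually_ge_atTop 1] with c hc
      filter_upwards [ae_ne b] with z hz
      rw [norm_mul, abs_mul, abs_mul, ← mul_add]
      exact mul_le_mul_of_nonneg_left
        (abs_regLog_le hz (by positivity) (inv_le_one_of_one_le₀ (one_le_pow₀ hc)))
        (norm_nonneg _)
    · filter_upwards [ae_ne b] with z hz
      have hr : ‖z - b‖ ^ 2 + 0 ≠ 0 := by simpa [sub_eq_zero] using hz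
      have := (((hδlim.const_add (‖z - b‖ ^ 2)).log hr).const_mul (1 / 2)).const_mul
        (Laplacian.laplacian F z)
      have e : 1 / 2 * Real.log (‖z - b‖ ^ 2 + 0) = Real.log ‖z - b‖ := by
        rw [add_zero, Real.log_pow]
        push_cast
        ring
      rwa [e] at this
  refine tendsto_nhds_unique hleft (hpeak.congr' ?_)
  filter_upwards [eventually_ge_atTop 1] with c hc
  rw [(hF.integral_laplacian_mul (contDiff_regLog b (δ := (c ^ 2)⁻¹) (by positivity))).2.2,
    ← integral_const_mul]
  congr 1
  ext z
  rw [laplacian_regLog b z (by positivity), Complex.finrank_real_complex, norm_smul, norm_sub_rev,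
    mul_pow, Real.norm_eq_abs, sq_abs, smul_eq_mul]
  have hp := Real.pi_pos
  field_simp
  ring

end HasMildSingularities

/-! ### Mean values over circles -/

lemma abs_log_eq (x : ℝ) : |Real.log x| = 2 * Real.posLog x - Real.log x := by
  rw [← Real.half_mul_log_add_log_abs]
  ring

lemma integral_abs_log_norm_circleMap_sub_le {r : ℝ} (hr : 0 < r) (w : ℂ) :
    ∫ θ in (0 : ℝ)..2 * Real.pi, |Real.log ‖circleMap 0 r θ - w‖|
      ≤ 2 * Real.pi * (2 * Real.posLog (r + ‖w‖) - Real.log r) := by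
  have hp := Real.pi_pos
  have hi : IntervalIntegrable (fun θ => Real.log ‖circleMap 0 r θ - w‖) volume 0 (2 * Real.pi) :=
    circleIntegrable_log_norm_sub_const (c := 0) (a := w) r
  have hc := circleAverage_log_norm_sub_const_eq_log_radius_add_posLog (c := 0) (a := w) hr.ne'
  rw [Real.circleAverage_def, smul_eq_mul, inv_mul_eq_iff_eq_mul₀ (by positivity)] at hc
  have hc' : 2 * Real.pi * Real.log r ≤ ∫ θ in (0 : ℝ)..2 * Real.pi,
      Real.log ‖circleMap 0 r θ - w‖ := by
    rw [hc]
    gcongr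
    linarith [Real.posLog_nonneg (x := r⁻¹ * ‖0 - w‖)]
  calc _ ≤ ∫ θ in (0 : ℝ)..2 * Real.pi,
        (2 * Real.posLog (r + ‖w‖) - Real.log ‖circleMap 0 r θ - w‖) := by
        refine intervalIntegral.integral_mono_on (by positivity) hi.abs
          (intervalIntegrable_const.sub hi) fun θ _ => ?_
        rw [abs_log_eq]
        have : ‖circleMap 0 r θ - w‖ ≤ r + ‖w‖ := by
          refine (norm_sub_le _ _).trans ?_
          simp [abs_of_pos hr]
        linarith [Real.posLog_le_posLog (norm_nonneg _) this]
    _ = 2 * Real.pi * (2 * Real.posLog (r + ‖w‖)) - ∫ θ in (0 : ℝ)..2 * Real.pi,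
        Real.log ‖circleMap 0 r θ - w‖ := by
        rw [intervalIntegral.integral_sub intervalIntegrable_const hi]
        simp
        ring
    _ ≤ _ := by linarith

lemma ae_circleMap_notMem {r : ℝ} (hr : 0 < r) (A : Finset ℂ) :
    ∀ᵐ θ : ℝ, circleMap 0 r θ ∉ A := by
  have := (A.countable_toSet.preimage_circleMap 0 hr.ne').measure_zero volume
  exact measure_eq_zero_iff_ae_notMem.1 this

namespace HasMildSingularities

variable {A : Finset ℂ} {F : ℂ → ℝ}

lemma integrable_prod_laplacian_mul_log (hF : HasMildSingularities A F) {r : ℝ} (hr : 0 < r) :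
    Integrable (fun p : ℝ × ℂ => Laplacian.laplacian F p.2 * Real.log ‖circleMap 0 r p.1 - p.2‖)
      ((volume.restrict (Ioc 0 (2 * Real.pi))).prod volume) := by
  have hp := Real.pi_pos
  have hi := hF.integrable_laplacian
  have hmeas : AEStronglyMeasurable
      (fun p : ℝ × ℂ => Laplacian.laplacian F p.2 * Real.log ‖circleMap 0 r p.1 - p.2‖)
      ((volume.restrict (Ioc 0 (2 * Real.pi))).prod volume) := by
    refine hi.aestronglyMeasurable.comp_snd.mul ?_
    have : Measurable fun p : ℝ × ℂ => ‖circleMap 0 r p.1 - p.2‖ :=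
      Continuous.measurable (by fun_prop)
    exact (Real.measurable_log.comp this).aestronglyMeasurable
  obtain ⟨R, hR⟩ := hF.hasCompactSupport.isCompact.isBounded.subset_closedBall 0
  have hint : ∀ w : ℂ, ∫ θ in Ioc 0 (2 * Real.pi), ‖Laplacian.laplacian F w
      * Real.log ‖circleMap 0 r θ - w‖‖
      ≤ ‖Laplacian.laplacian F w‖ * (2 * Real.pi * (2 * Real.posLog (r + R) - Real.log r)) := by
    intro w
    simp_rw [norm_mul, integral_const_mul, Real.norm_eq_abs]
    by_cases hw : w ∈ tsupport F
    · gcongr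
      rw [← intervalIntegral.integral_of_le (by positivity)]
      refine (integral_abs_log_norm_circleMap_sub_le hr w).trans ?_
      have : ‖w‖ ≤ R := by simpa using hR hw
      gcongr
    · simp [laplacian_eq_zero hw]
  refine (integrable_prod_iff' hmeas).2 ⟨Eventually.of_forall fun w => ?_, ?_⟩
  · have : IntervalIntegrable (fun θ => Real.log ‖circleMap 0 r θ - w‖) volume 0 (2 * Real.pi) :=
      circleIntegrable_log_norm_sub_const (c := 0) (a := w) r
    exact ((intervalIntegrable_iff_integrableOn_Ioc_of_le (by positivity)).1 this).const_mul
      (Laplacian.laplacian F w)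
  · refine Integrable.mono' (hi.norm.mul_const
      (2 * Real.pi * (2 * Real.posLog (r + R) - Real.log r)))
      hmeas.norm.prod_swap.integral_prod_right'
      (Eventually.of_forall fun w => ?_)
    rw [Real.norm_of_nonneg (integral_nonneg fun _ => norm_nonneg _)]
    exact hint w

lemma eq_integral_on_circle (hF : HasMildSingularities A F) {r : ℝ} (hr : 0 < r) :
    (fun θ => F (circleMap 0 r θ)) =ᵐ[volume] fun θ => (2 * Real.pi)⁻¹ *
      ∫ w, Laplacian.laplacian F w * Real.log ‖circleMap 0 r θ - w‖ := by
  have hp := Real.pi_pos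
  filter_upwards [ae_circleMap_notMem hr A] with θ hθ
  simp_rw [norm_sub_rev (circleMap 0 r θ)]
  rw [hF.integral_laplacian_mul_log hθ]
  field_simp

lemma circleIntegrable (hF : HasMildSingularities A F) {r : ℝ} (hr : 0 < r) :
    CircleIntegrable F 0 r := by
  have hp := Real.pi_pos
  rw [circleIntegrable_def, intervalIntegrable_iff_integrableOn_Ioc_of_le (by positivity)]
  have hae : (fun θ => F (circleMap 0 r θ)) =ᵐ[volume.restrict (Ioc 0 (2 * Real.pi))] _ :=
    ae_restrict_of_ae (hF.eq_integral_on_circle hr)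
  exact ((hF.integrable_prod_laplacian_mul_log hr).integral_prod_left.const_mul
    (2 * Real.pi)⁻¹).congr hae.symm

lemma circleAverage_eq (hF : HasMildSingularities A F) {r : ℝ} (hr : 0 < r) :
    Real.circleAverage F 0 r = (2 * Real.pi)⁻¹ *
      ∫ w, Laplacian.laplacian F w * (Real.log r + Real.posLog (r⁻¹ * ‖w‖)) := by
  have hp := Real.pi_pos
  rw [Real.circleAverage_def, smul_eq_mul, intervalIntegral.integral_of_le (by positivity),
    integral_congr_ae (ae_restrict_of_ae (hF.eq_integral_on_circle hr)), integral_const_mul,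
    integral_integral_swap (hF.integrable_prod_laplacian_mul_log hr), ← integral_const_mul]
  congr 2
  ext w
  have hc := circleAverage_log_norm_sub_const_eq_log_radius_add_posLog (c := 0) (a := w) hr.ne'
  rw [Real.circleAverage_def, smul_eq_mul, inv_mul_eq_iff_eq_mul₀ (by positivity),
    intervalIntegral.integral_of_le (by positivity), zero_sub, norm_neg] at hc
  rw [integral_const_mul, hc]
  field_simp

/-- The difference between the mean over a circle and the value at the centre is the integral of
the Laplacian against Green's function of the disc. -/
lemma circleAverage_sub_eq (hF : HasMildSingularities A F) (h0 : (0 : ℂ) ∉ A) {r : ℝ}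
    (hr : 0 < r) :
    IntegrableOn (fun w => Laplacian.laplacian F w * Real.log (r / ‖w‖)) (ball 0 r) ∧
    Real.circleAverage F 0 r - F 0 = (2 * Real.pi)⁻¹ *
      ∫ w in ball 0 r, Laplacian.laplacian F w * Real.log (r / ‖w‖) := by
  have hp := Real.pi_pos
  have hlog := hF.integrable_laplacian_mul_log h0
  have hlog' := hF.integral_laplacian_mul_log h0
  simp only [sub_zero] at hlog hlog'
  have hi := hF.integrable_laplacian
  have key : ∀ w : ℂ, w ≠ 0 → (ball (0 : ℂ) r).indicator
      (fun w => Laplacian.laplacian F w * Real.log (r / ‖w‖)) w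
      = Laplacian.laplacian F w * (Real.log r + Real.posLog (r⁻¹ * ‖w‖))
        - Laplacian.laplacian F w * Real.log ‖w‖ := by
    intro w hw
    have hw' : 0 < ‖w‖ := norm_pos_iff.2 hw
    by_cases hwr : ‖w‖ < r
    · have : Real.posLog (r⁻¹ * ‖w‖) = 0 := by
        rw [Real.posLog_eq_zero_iff, abs_of_pos (by positivity), inv_mul_le_iff₀ hr, mul_one]
        exact hwr.le
      rw [indicator_of_mem (by simpa using hwr), this, Real.log_div hr.ne' hw'.ne']
      ring
    · have : Real.posLog (r⁻¹ * ‖w‖) = Real.log ‖w‖ - Real.log r := by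
        rw [Real.posLog_eq_log, Real.log_mul (by positivity) hw'.ne', Real.log_inv]
        · ring
        · rw [abs_of_pos (by positivity), le_inv_mul_iff₀ hr, mul_one]
          exact not_lt.1 hwr
      rw [indicator_of_notMem (by simpa using hwr), this]
      ring
  have hae : (ball (0 : ℂ) r).indicator
      (fun w => Laplacian.laplacian F w * Real.log (r / ‖w‖)) =ᵐ[volume] fun w =>
      Laplacian.laplacian F w * (Real.log r + Real.posLog (r⁻¹ * ‖w‖))
        - Laplacian.laplacian F w * Real.log ‖w‖ := by
    filter_upwards [ae_ne 0] with w hw using key w hw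
  have hpos : Integrable fun w => Laplacian.laplacian F w
      * (Real.log r + Real.posLog (r⁻¹ * ‖w‖)) := by
    obtain ⟨R, hR⟩ := hF.hasCompactSupport.isCompact.isBounded.subset_closedBall 0
    refine Integrable.mono' (hi.norm.mul_const (|Real.log r| + Real.posLog (r⁻¹ * R)))
      (hi.aestronglyMeasurable.mul (Continuous.aestronglyMeasurable (by fun_prop)))
      (Eventually.of_forall fun w => ?_)
    by_cases hw : w ∈ tsupport F
    · have : ‖w‖ ≤ R := by simpa using hR hw
      rw [norm_mul]
      gcongr
      refine (norm_add_le _ _).trans ?_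
      rw [Real.norm_of_nonneg Real.posLog_nonneg, Real.norm_eq_abs]
      gcongr
    · simp [laplacian_eq_zero hw]
  constructor
  · exact (integrable_indicator_iff measurableSet_ball).1 ((hpos.sub hlog).congr hae.symm)
  · rw [← integral_indicator measurableSet_ball, integral_congr_ae hae, integral_sub hpos hlog,
      hlog', hF.circleAverage_eq hr]
    field_simp

end HasMildSingularities

/-! ### The characteristic as an integral against Green's function -/

lemma integral_Ioc_indicator_inv {r : ℝ} {w : ℂ} (hw : w ≠ 0) (hwr : ‖w‖ < r) (c : ℝ) :
    IntegrableOn (fun t : ℝ => (ball (0 : ℂ) t).indicator (fun _ => 1 / t * c) w) (Ioc 0 r) ∧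
    ∫ t in Ioc 0 r, (ball (0 : ℂ) t).indicator (fun _ => 1 / t * c) w
      = c * Real.log (r / ‖w‖) := by
  have hw' : 0 < ‖w‖ := norm_pos_iff.2 hw
  have e : (fun t : ℝ => (ball (0 : ℂ) t).indicator (fun _ => 1 / t * c) w)
      = (Ioi ‖w‖).indicator fun t => 1 / t * c := by
    ext t
    simp [indicator]
  have e2 : Ioi ‖w‖ ∩ Ioc 0 r = Ioc ‖w‖ r := by
    ext t
    simp only [mem_inter_iff, mem_Ioi, mem_Ioc]
    exact ⟨fun h => ⟨h.1, h.2.2⟩, fun h => ⟨h.1, hw'.trans h.1, h.2⟩⟩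
  have hi : IntervalIntegrable (fun t : ℝ => 1 / t) volume ‖w‖ r := by
    apply intervalIntegral.intervalIntegrable_one_div (fun t ht => ?_) continuousOn_id
    rw [uIcc_of_le hwr.le] at ht
    exact (hw'.trans_le ht.1).ne'
  rw [e]
  constructor
  · rw [IntegrableOn, integrable_indicator_iff measurableSet_Ioi, IntegrableOn,
      Measure.restrict_restrict measurableSet_Ioi, e2]
    exact ((intervalIntegrable_iff_integrableOn_Ioc_of_le hwr.le).1 hi).mul_const c
  · rw [integral_indicator measurableSet_Ioi, Measure.restrict_restrict measurableSet_Ioi, e2,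
      ← intervalIntegral.integral_of_le hwr.le, intervalIntegral.integral_mul_const,
      integral_one_div_of_pos hw' (hw'.trans hwr), mul_comm]

/-- Integration by parts in the radius. -/
lemma doubleIntegral_eq {u : ℂ → ℝ} {r : ℝ} (hr : 0 < r) (hu : IntegrableOn u (ball 0 r))
    (hul : IntegrableOn (fun w => u w * Real.log (r / ‖w‖)) (ball 0 r)) :
    IntervalIntegrable (fun t : ℝ => (1 / t) * ∫ z in ball (0 : ℂ) t, u z) volume 0 r ∧
    doubleIntegral u r = ∫ w in ball 0 r, u w * Real.log (r / ‖w‖) := by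
  set G : ℝ × ℂ → ℝ := fun p => (ball (0 : ℂ) p.1).indicator (fun _ => 1 / p.1 * u p.2) p.2 with hG
  have hset : MeasurableSet {p : ℝ × ℂ | ‖p.2‖ < p.1} :=
    measurableSet_lt measurable_snd.norm measurable_fst
  have hGe : G = {p : ℝ × ℂ | ‖p.2‖ < p.1}.indicator fun p => 1 / p.1 * u p.2 := by
    ext p
    simp [hG, indicator]
  have hmeas : AEStronglyMeasurable G
      ((volume.restrict (Ioc 0 r)).prod (volume.restrict (ball 0 r))) := by
    rw [hGe]
    refine AEStronglyMeasurable.indicator ?_ hset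
    exact (measurable_const.div measurable_fst).aestronglyMeasurable.mul
      hu.aestronglyMeasurable.comp_snd
  have hae : ∀ᵐ w ∂(volume.restrict (ball (0 : ℂ) r)), w ≠ 0 ∧ ‖w‖ < r := by
    filter_upwards [ae_restrict_mem measurableSet_ball, ae_restrict_of_ae (ae_ne 0)] with w h1 h2
    exact ⟨h2, by simpa using h1⟩
  have hint : Integrable G ((volume.restrict (Ioc 0 r)).prod (volume.restrict (ball 0 r))) := by
    refine (integrable_prod_iff' hmeas).2 ⟨?_, ?_⟩
    · filter_upwards [hae] with w hw
      exact (integral_Ioc_indicator_inv hw.1 hw.2 (u w)).1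
    · refine hul.norm.congr ?_
      filter_upwards [hae] with w hw
      have hlog : 0 ≤ Real.log (r / ‖w‖) :=
        Real.log_nonneg ((one_le_div (norm_pos_iff.2 hw.1)).2 hw.2.le)
      rw [norm_mul, Real.norm_of_nonneg hlog, ← (integral_Ioc_indicator_inv hw.1 hw.2 ‖u w‖).2]
      refine setIntegral_congr_fun measurableSet_Ioc fun t ht => ?_
      simp only [hG, indicator]
      split_ifs
      · rw [norm_mul, Real.norm_of_nonneg (one_div_nonneg.2 ht.1.le)]
      · simp
  have hin : ∀ t ∈ Ioc 0 r, ∫ w in ball (0 : ℂ) r, G (t, w)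
      = (1 / t) * ∫ z in ball (0 : ℂ) t, u z := by
    intro t ht
    have : (fun w => G (t, w)) = (ball (0 : ℂ) t).indicator fun w => 1 / t * u w := by
      ext w
      simp [hG, indicator]
    rw [this, integral_indicator measurableSet_ball, Measure.restrict_restrict measurableSet_ball,
      inter_eq_left.2 (ball_subset_ball ht.2), integral_const_mul]
  constructor
  · rw [intervalIntegrable_iff_integrableOn_Ioc_of_le hr.le]
    exact IntegrableOn.congr_fun hint.integral_prod_left hin measurableSet_Ioc
  · rw [doubleIntegral, intervalIntegral.integral_of_le hr.le,
      ← setIntegral_congr_fun measurableSet_Ioc hin, integral_integral_swap hint]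
    refine integral_congr_ae ?_
    filter_upwards [hae] with w hw using (integral_Ioc_indicator_inv hw.1 hw.2 (u w)).2

/-! ### Jensen's formula with mild singularities -/

lemma eventually_laplacian_eq {φ₁ φ₂ : ℂ → ℝ} {a : ℂ} (h : ∀ᶠ z in 𝓝[≠] a, φ₁ z = φ₂ z) :
    ∀ᶠ z in 𝓝[≠] a, Laplacian.laplacian φ₁ z = Laplacian.laplacian φ₂ z := by
  filter_upwards [eventually_eventually_nhdsWithin.2 h, self_mem_nhdsWithin] with z hz hza
  rw [isOpen_compl_singleton.nhdsWithin_eq hza] at hz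
  exact laplacian_congr_at hz

lemma IsMildAt.congr {φ₁ φ₂ : ℂ → ℝ} {a : ℂ} (h₁ : IsMildAt φ₁ a)
    (h : ∀ᶠ z in 𝓝[≠] a, φ₁ z = φ₂ z) : IsMildAt φ₂ a := by
  obtain ⟨⟨C, hC⟩, ψ, hψ, hle⟩ := h₁
  refine ⟨⟨C, ?_⟩, ψ, hψ, ?_⟩
  · filter_upwards [hC, h] with z h1 h2 using h2 ▸ h1
  · filter_upwards [hle, eventually_laplacian_eq h] with z h1 h2 using h2 ▸ h1

lemma IsMildAt.sub_contDiffAt {φ g : ℂ → ℝ} {a : ℂ} (hφ : IsMildAt φ a)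
    (hφc : ∀ᶠ z in 𝓝[≠] a, ContDiffAt ℝ 2 φ z) (hg : ContDiffAt ℝ 2 g a) :
    IsMildAt (fun z => φ z - g z) a := by
  obtain ⟨⟨C, hC⟩, ψ, hψ, hle⟩ := hφ
  have hgc : ∀ᶠ z in 𝓝 a, ContDiffAt ℝ 2 g z := hg.eventually (by simp)
  obtain ⟨ε, hε, hgb⟩ := eventually_nhds_iff_ball.1 hgc
  have hgo : ContDiffOn ℝ 2 g (ball a ε) := fun z hz => (hgb z hz).contDiffWithinAt
  constructor
  · have hbd : ∀ᶠ z in 𝓝 a, |g z| < |g a| + 1 :=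
      hg.continuousAt.abs.eventually (gt_mem_nhds (lt_add_one _))
    refine ⟨C + (|g a| + 1), ?_⟩
    filter_upwards [hC, nhdsWithin_le_nhds hbd] with z h1 h2
    have h3 := one_le_logGrowth a z
    have h4 : |g a| + 1 ≤ (|g a| + 1) * logGrowth a z := le_mul_of_one_le_right (by positivity) h3
    linarith [abs_sub (φ z) (g z)]
  · refine ⟨fun z => ψ z + Laplacian.laplacian g z, ?_, ?_⟩
    · refine hψ.add ?_
      have := (continuousOn_laplacian isOpen_ball hgo).integrableAt_nhdsWithin (μ := volume)
        measurableSet_ball (mem_ball_self hε)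
      rwa [isOpen_ball.nhdsWithin_eq (mem_ball_self hε)] at this
    · filter_upwards [hle, hφc, nhdsWithin_le_nhds hgc] with z h1 h2 h3
      change _ ≤ Laplacian.laplacian (φ - g) z
      rw [h2.laplacian_sub h3]
      linarith

/-- **Jensen's formula** for a function that is of class `C²` off a finite set, at the points of
which it is the sum of a multiple of `log |z - a|` and a function with a mild singularity. -/
theorem jensen_of_isMildAt {r R : ℝ} (hr : 0 < r) (hrR : r < R) {U u : ℂ → ℝ} {A : Finset ℂ}
    (m : ℂ → ℝ) (hA0 : (0 : ℂ) ∉ A) (hAr : ∀ a ∈ A, ‖a‖ ≤ r)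
    (hU : ContDiffOn ℝ 2 U (ball 0 R \ A))
    (hloc : ∀ a ∈ A, ∃ φ : ℂ → ℝ, IsMildAt φ a ∧
      ∀ᶠ z in 𝓝[≠] a, U z = φ z + m a * Real.log ‖z - a‖)
    (hu : ∀ z ∈ ball (0 : ℂ) r \ A, u z = 1 / (4 * Real.pi) * Laplacian.laplacian U z) :
    IntegrableOn u (ball 0 r) ∧
    IntervalIntegrable (fun t : ℝ => (1 / t) * ∫ z in ball (0 : ℂ) t, u z) volume 0 r ∧
    CircleIntegrable U 0 r ∧
    doubleIntegral u r
      = 1 / 2 * (Real.circleAverage U 0 r - U 0 - ∑ a ∈ A, m a * Real.log (r / ‖a‖)) := by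
  have hp := Real.pi_pos
  set P : ℂ → ℝ := fun z => ∑ a ∈ A, m a * Real.log ‖z - a‖ with hP
  let χ : ContDiffBump (0 : ℂ) := ⟨r + (R - r) / 3, r + 2 * (R - r) / 3, by linarith, by linarith⟩
  have hχin : ∀ z : ℂ, ‖z‖ ≤ r → χ =ᶠ[𝓝 z] 1 := fun z hz =>
    χ.eventuallyEq_one_of_mem_ball (mem_ball_zero_iff.2 (by
      change ‖z‖ < r + (R - r) / 3; linarith))
  have hχs : tsupport χ ⊆ ball 0 R := by
    rw [χ.tsupport_eq]
    exact closedBall_subset_ball (by change r + 2 * (R - r) / 3 < R; linarith)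
  set F : ℂ → ℝ := fun z => χ z * (U z - P z) with hFdef
  have hFin : ∀ z : ℂ, ‖z‖ ≤ r → F =ᶠ[𝓝 z] fun z => U z - P z := fun z hz => by
    filter_upwards [hχin z hz] with y hy
    simp [hFdef, hy]
  have hO : IsOpen (ball (0 : ℂ) R \ A) := isOpen_ball.sdiff A.finite_toSet.isClosed
  have hlogc : ∀ a z : ℂ, z ≠ a → ContDiffAt ℝ 2 (fun z => m a * Real.log ‖z - a‖) z :=
    fun a z hz => contDiffAt_const.mul (contDiffAt_log_norm_sub hz)
  have hPc : ∀ z, z ∉ A → ContDiffAt ℝ 2 P z := fun z hz =>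
    ContDiffAt.sum fun a ha => hlogc a z fun h => hz (h ▸ ha)
  have hPl : ∀ z, z ∉ A → Laplacian.laplacian P z = 0 := fun z hz => by
    have hne : ∀ a ∈ A, z ≠ a := fun a ha h => hz (h ▸ ha)
    rw [hP, laplacian_finset_sum _ _ fun a ha => hlogc a z (hne a ha)]
    refine Finset.sum_eq_zero fun a ha => ?_
    have := laplacian_smul (m a) (contDiffAt_log_norm_sub (hne a ha))
    rw [laplacian_log_norm_sub (hne a ha), smul_zero] at this
    exact this
  have hUc : ∀ z ∈ ball (0 : ℂ) R \ A, ContDiffAt ℝ 2 U z := fun z hz =>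
    hU.contDiffAt (hO.mem_nhds hz)
  have hmild : ∀ a ∈ A, IsMildAt F a := by
    intro a ha
    obtain ⟨φ, hφ, hφU⟩ := hloc a ha
    -- near `a` the function is `φ` up to a function of class `C²`
    have hg : ContDiffAt ℝ 2 (fun z => ∑ b ∈ A.erase a, m b * Real.log ‖z - b‖) a :=
      ContDiffAt.sum fun b hb => hlogc b a (Finset.ne_of_mem_erase hb).symm
    have hev : ∀ᶠ z in 𝓝[≠] a, z ∈ ball (0 : ℂ) R \ A := by
      have h1 : ball (0 : ℂ) R \ (A.erase a) ∈ 𝓝 a :=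
        (isOpen_ball.sdiff (A.erase a).finite_toSet.isClosed).mem_nhds
          ⟨mem_ball_zero_iff.2 ((hAr a ha).trans_lt hrR), by simp⟩
      filter_upwards [nhdsWithin_le_nhds h1, self_mem_nhdsWithin] with z h2 h3
      exact ⟨h2.1, fun h4 => h2.2 (Finset.mem_coe.2 (Finset.mem_erase.2 ⟨h3, h4⟩))⟩
    have hφc : ∀ᶠ z in 𝓝[≠] a, ContDiffAt ℝ 2 φ z := by
      filter_upwards [eventually_eventually_nhdsWithin.2 hφU, hev, self_mem_nhdsWithin]
        with z h1 h2 h3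
      rw [isOpen_compl_singleton.nhdsWithin_eq h3] at h1
      refine ((hUc z h2).sub (hlogc a z h3)).congr_of_eventuallyEq ?_
      filter_upwards [h1] with y hy
      rw [hy, add_sub_cancel_right]
    refine (hφ.sub_contDiffAt hφc hg).congr ?_
    filter_upwards [hφU, nhdsWithin_le_nhds (hFin a (hAr a ha))] with z h1 h2
    rw [h2, h1, hP]
    simp only
    rw [← Finset.add_sum_erase A _ ha]
    ring
  have hF : HasMildSingularities A F := by
    refine ⟨fun z hz => ContDiffAt.contDiffWithinAt ?_, ?_, hmild⟩
    · by_cases hzR : z ∈ ball (0 : ℂ) R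
      · exact χ.contDiff.contDiffAt.mul ((hUc z ⟨hzR, hz⟩).sub (hPc z hz))
      · refine contDiffAt_of_notMem_tsupport fun h => hzR (hχs (tsupport_mul_subset_left h))
    · exact χ.hasCompactSupport.mul_right
  have hlap : ∀ z ∈ ball (0 : ℂ) r \ A, Laplacian.laplacian F z = Laplacian.laplacian U z := by
    intro z hz
    have hzr : ‖z‖ < r := mem_ball_zero_iff.1 hz.1
    have h1 := hUc z ⟨mem_ball_zero_iff.2 (hzr.trans hrR), hz.2⟩
    rw [laplacian_congr_at (hFin z hzr.le)]
    change Laplacian.laplacian (U - P) z = _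
    rw [h1.laplacian_sub (hPc z hz.2), hPl z hz.2, sub_zero]
  have hae : u =ᵐ[volume.restrict (ball 0 r)]
      fun z => 1 / (4 * Real.pi) * Laplacian.laplacian F z := by
    have hnA : ∀ᵐ z ∂(volume : Measure ℂ), z ∉ (A : Set ℂ) :=
      measure_eq_zero_iff_ae_notMem.1 (A.finite_toSet.measure_zero _)
    filter_upwards [ae_restrict_mem measurableSet_ball, ae_restrict_of_ae hnA] with z h1 h2
    rw [hu z ⟨h1, h2⟩, hlap z ⟨h1, h2⟩]
  obtain ⟨hGi, hG⟩ := hF.circleAverage_sub_eq hA0 hr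
  have hui : IntegrableOn u (ball 0 r) :=
    (hF.integrable_laplacian.integrableOn.const_mul _).congr hae.symm
  have hael : (fun w => u w * Real.log (r / ‖w‖)) =ᵐ[volume.restrict (ball 0 r)] fun w =>
      1 / (4 * Real.pi) * (Laplacian.laplacian F w * Real.log (r / ‖w‖)) := by
    filter_upwards [hae] with w hw
    rw [hw, mul_assoc]
  have huil : IntegrableOn (fun w => u w * Real.log (r / ‖w‖)) (ball 0 r) :=
    (hGi.const_mul _).congr hael.symm
  obtain ⟨hdi, hd⟩ := doubleIntegral_eq hr hui huil
  have hlogi : ∀ a ∈ A, CircleIntegrable (fun z => m a * Real.log ‖z - a‖) 0 r := fun a _ =>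
    (circleIntegrable_log_norm_sub_const (c := 0) (a := a) r).const_fun_smul (a := m a)
  have hPi : CircleIntegrable P 0 r := CircleIntegrable.fun_sum A hlogi
  have hUeq : EqOn (fun z => F z + P z) U (sphere 0 |r|) := fun z hz => by
    have : ‖z‖ = r := by simpa [abs_of_pos hr] using hz
    simp [(hFin z this.le).self_of_nhds]
  have hFi := hF.circleIntegrable hr
  refine ⟨hui, hdi, (circleIntegrable_congr hUeq).1 (hFi.add hPi), ?_⟩
  have hPavg : Real.circleAverage P 0 r = ∑ a ∈ A, m a * Real.log r := by
    rw [hP, Real.circleAverage_fun_sum hlogi]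
    refine Finset.sum_congr rfl fun a ha => ?_
    have := circleAverage_log_norm_sub_const_of_mem_closedBall (c := 0) (R := r) (a := a)
      (by simpa [abs_of_pos hr] using hAr a ha)
    rw [← this]
    exact Real.circleAverage_fun_smul (𝕜 := ℝ) (a := m a) (f := fun z => Real.log ‖z - a‖)
  have hUavg : Real.circleAverage U 0 r = Real.circleAverage F 0 r + ∑ a ∈ A, m a * Real.log r := by
    rw [← Real.circleAverage_congr_sphere hUeq, ← hPavg]
    exact Real.circleAverage_add hFi hPi
  have hF0 : F 0 = U 0 - P 0 := (hFin 0 (by simpa using hr.le)).self_of_nhds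
  have hsum : ∑ a ∈ A, m a * Real.log (r / ‖a‖) = ∑ a ∈ A, m a * Real.log r - P 0 := by
    rw [hP, ← Finset.sum_sub_distrib]
    refine Finset.sum_congr rfl fun a ha => ?_
    have : ‖a‖ ≠ 0 := norm_ne_zero_iff.2 fun h => hA0 (h ▸ ha)
    rw [Real.log_div hr.ne' this, zero_sub, norm_neg]
    ring
  rw [hd, integral_congr_ae hael, integral_const_mul, hUavg, hsum]
  have : ∫ w in ball 0 r, Laplacian.laplacian F w * Real.log (r / ‖w‖)
      = 2 * Real.pi * (Real.circleAverage F 0 r - F 0) := by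
    rw [hG]
    field_simp
  rw [this, hF0]
  generalize ∑ a ∈ A, m a * Real.log r = S
  field_simp
  ring

/-! ### Zeros of holomorphic functions of one variable -/

lemma hasFDerivAt_of_analyticAt {E : Type*} [NormedAddCommGroup E] [NormedSpace ℂ E]
    {γ : ℂ → E} {z : ℂ} (hγ : AnalyticAt ℂ γ z) (v : ℂ) :
    DifferentiableAt ℝ γ z ∧ fderiv ℝ γ z v = v • deriv γ z := by
  have h := hγ.differentiableAt.hasFDerivAt.restrictScalars ℝ
  refine ⟨h.differentiableAt, ?_⟩
  rw [h.fderiv]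
  simp

/-- The Laplacian of the composition of a function with a holomorphic curve is the Levi form of the
function on the derivative of the curve. -/
lemma laplacian_comp_analyticAt {E : Type*} [NormedAddCommGroup E] [NormedSpace ℂ E]
    [CompleteSpace E]
    {Φ : E → ℝ} {γ : ℂ → E} {z : ℂ} (hγ : AnalyticAt ℂ γ z) (hΦ : ContDiffAt ℝ 2 Φ (γ z)) :
    ContDiffAt ℝ 2 (fun y => Φ (γ y)) z ∧ Laplacian.laplacian (fun y => Φ (γ y)) z
      = iteratedFDeriv ℝ 2 Φ (γ z) ![deriv γ z, deriv γ z]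
        + iteratedFDeriv ℝ 2 Φ (γ z) ![Complex.I • deriv γ z, Complex.I • deriv γ z] := by
  have hγc : ContDiffAt ℝ 2 γ z := hγ.contDiffAt.restrict_scalars ℝ
  have hc : ContDiffAt ℝ 2 (fun y => Φ (γ y)) z := hΦ.comp z hγc
  have hΦ2 : DifferentiableAt ℝ (fderiv ℝ Φ) (γ z) :=
    (hΦ.fderiv_right (m := 1) (by norm_num)).differentiableAt (by norm_num)
  have hd := hγ.deriv
  have key : ∀ v : ℂ, dirDeriv₂ v (fun y => Φ (γ y)) z
      = fderiv ℝ (fderiv ℝ Φ) (γ z) (v • deriv γ z) (v • deriv γ z)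
        + fderiv ℝ Φ (γ z) (v • v • deriv (deriv γ) z) := by
    intro v
    have hev : (fun y => fderiv ℝ (fun y => Φ (γ y)) y v)
        =ᶠ[𝓝 z] fun y => fderiv ℝ Φ (γ y) (v • deriv γ y) := by
      filter_upwards [hγ.eventually_analyticAt,
        hγ.continuousAt.eventually (hΦ.eventually (by simp))] with y h1 h2
      obtain ⟨h3, h4⟩ := hasFDerivAt_of_analyticAt h1 v
      rw [← h4, show (fun y => Φ (γ y)) = Φ ∘ γ from rfl,
        fderiv_comp y (h2.differentiableAt (by norm_num)) h3]
      rfl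
    obtain ⟨h5, h6⟩ := hasFDerivAt_of_analyticAt hγ v
    obtain ⟨h7, h8⟩ := hasFDerivAt_of_analyticAt hd v
    have h9 : DifferentiableAt ℝ (fun y => fderiv ℝ Φ (γ y)) z := hΦ2.comp z h5
    have h10 : fderiv ℝ (fun y => fderiv ℝ Φ (γ y)) z v
        = fderiv ℝ (fderiv ℝ Φ) (γ z) (v • deriv γ z) := by
      rw [show (fun y => fderiv ℝ Φ (γ y)) = fderiv ℝ Φ ∘ γ from rfl, fderiv_comp z hΦ2 h5, ← h6]
      rfl
    have h11 : fderiv ℝ (fun y => v • deriv γ y) z v = v • v • deriv (deriv γ) z := by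
      rw [fderiv_fun_const_smul h7, ← h8]
      rfl
    rw [dirDeriv₂, hev.fderiv_eq, fderiv_clm_apply h9 (h7.fun_const_smul v)]
    simp only [add_apply, ContinuousLinearMap.comp_apply,
      ContinuousLinearMap.flip_apply, h10, h11]
    ring
  refine ⟨hc, ?_⟩
  rw [laplacian_eq_dirDeriv₂ hc, key, key, iteratedFDeriv_two_apply, iteratedFDeriv_two_apply]
  simp only [one_smul, smul_smul, Complex.I_mul_I, neg_smul, map_neg, Matrix.cons_val_zero,
    Matrix.cons_val_one]
  ring

/-- The factorization of a holomorphic function at a zero, and its logarithmic derivative. -/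
lemma exists_logDeriv {g : ℂ → ℂ} {a : ℂ} (hg : AnalyticAt ℂ g a)
    (hne : ¬ ∀ᶠ z in 𝓝 a, g z = 0) :
    ∃ (k : ℕ) (u ℓ : ℂ → ℂ), AnalyticAt ℂ u a ∧ u a ≠ 0 ∧ AnalyticAt ℂ ℓ a ∧ ℓ a = k ∧
      (g a = 0 → k ≠ 0) ∧ (∀ᶠ z in 𝓝 a, g z = (z - a) ^ k * u z) ∧
      ∀ᶠ z in 𝓝 a, (z - a) * deriv g z = g z * ℓ z := by
  obtain ⟨k, u, hu, hu0, hgu⟩ := hg.exists_eventuallyEq_pow_smul_nonzero_iff.2 hne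
  simp only [smul_eq_mul] at hgu
  refine ⟨k, u, fun z => k + (z - a) * (deriv u z / u z), hu, hu0, ?_, by simp, ?_, hgu, ?_⟩
  · exact analyticAt_const.add ((analyticAt_id.sub analyticAt_const).mul (hu.deriv.div hu hu0))
  · rintro h rfl
    apply hu0
    rw [← h, hgu.self_of_nhds]
    simp
  · filter_upwards [hgu.eventually_nhds, hgu, hu.eventually_analyticAt,
      hu.continuousAt.eventually_ne hu0] with z h1 h2 h3 h4
    have hd : HasDerivAt (fun z => (z - a) ^ k * u z)
        (k * (z - a) ^ (k - 1) * u z + (z - a) ^ k * deriv u z) z := by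
      have := (((hasDerivAt_id z).sub_const a).fun_pow k).fun_mul h3.differentiableAt.hasDerivAt
      simpa using this
    rw [EventuallyEq.deriv_eq h1, hd.deriv, h2]
    rcases k with _ | k
    · simp
      field_simp
    · simp
      field_simp
      ring

lemma abs_log_le_of_factor {g u : ℂ → ℂ} {a : ℂ} {k : ℕ} (hu : AnalyticAt ℂ u a) (hu0 : u a ≠ 0)
    (hgu : ∀ᶠ z in 𝓝 a, g z = (z - a) ^ k * u z) :
    ∃ B, 0 ≤ B ∧ ∀ᶠ z in 𝓝[≠] a, |Real.log ‖g z‖ - k * Real.log ‖z - a‖| ≤ B := by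
  have hc : ContinuousAt (fun z => |Real.log ‖u z‖|) a :=
    (hu.continuousAt.norm.log (norm_ne_zero_iff.2 hu0)).abs
  refine ⟨|Real.log ‖u a‖| + 1, by positivity, ?_⟩
  filter_upwards [nhdsWithin_le_nhds hgu,
    nhdsWithin_le_nhds (hc.eventually (gt_mem_nhds (lt_add_one _))),
    nhdsWithin_le_nhds (hu.continuousAt.eventually_ne hu0), self_mem_nhdsWithin] with z h1 h2 h3 h4
  have h5 : ‖z - a‖ ≠ 0 := norm_ne_zero_iff.2 (sub_ne_zero.2 h4)
  rw [h1, norm_mul, norm_pow, Real.log_mul (pow_ne_zero _ h5) (norm_ne_zero_iff.2 h3),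
    Real.log_pow, add_sub_cancel_left]
  exact h2.le

lemma eventually_norm_sub_le_one (a : ℂ) : ∀ᶠ z in 𝓝[≠] a, ‖z - a‖ ≤ 1 :=
  nhdsWithin_le_nhds (by
    filter_upwards [closedBall_mem_nhds a one_pos] with z hz
    simpa [dist_eq_norm] using hz)

lemma eventually_one_le_singularWeight (a : ℂ) : ∀ᶠ z in 𝓝[≠] a, 1 ≤ singularWeight a z := by
  filter_upwards [eventually_norm_sub_le_one a, self_mem_nhdsWithin] with z h1 h2
  exact (one_le_logGrowth a z).trans (logGrowth_le_singularWeight h2 h1)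

lemma abs_log_norm_le {g : ℂ → ℂ} {a : ℂ} (hg : AnalyticAt ℂ g a)
    (hne : ¬ ∀ᶠ z in 𝓝 a, g z = 0) :
    ∃ C, ∀ᶠ z in 𝓝[≠] a, |Real.log ‖g z‖| ≤ C * logGrowth a z ^ 2 := by
  obtain ⟨k, u, ℓ, hu, hu0, -, -, -, hgu, -⟩ := exists_logDeriv hg hne
  obtain ⟨B, hB0, hB⟩ := abs_log_le_of_factor hu hu0 hgu
  refine ⟨k + B, ?_⟩
  filter_upwards [hB] with z hz
  rw [logGrowth_sq]
  have h1 := abs_sub_abs_le_abs_sub (Real.log ‖g z‖) (k * Real.log ‖z - a‖)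
  rw [abs_mul, Nat.abs_cast] at h1
  have h2 := abs_nonneg (Real.log ‖z - a‖)
  have h3 : (0 : ℝ) ≤ k := k.cast_nonneg
  nlinarith

/-- The pullback of a Poincaré form on the punctured disc by a holomorphic function is bounded by
a Poincaré form. -/
lemma poincare_term_le {g : ℂ → ℂ} {a : ℂ} (hg : AnalyticAt ℂ g a)
    (hne : ¬ ∀ᶠ z in 𝓝 a, g z = 0) :
    ∃ C, ∀ᶠ z in 𝓝[≠] a, ‖deriv g z‖ ^ 2 / (‖g z‖ ^ 2 * (1 + |Real.log ‖g z‖|) ^ 2)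
      ≤ C * singularWeight a z := by
  by_cases ha : g a = 0
  · obtain ⟨k, u, ℓ, hu, hu0, hℓ, hℓk, hk, hgu, hgℓ⟩ := exists_logDeriv hg hne
    obtain ⟨B, hB0, hB⟩ := abs_log_le_of_factor hu hu0 hgu
    have hk1 : (1 : ℝ) ≤ k := by exact_mod_cast Nat.one_le_iff_ne_zero.2 (hk ha)
    refine ⟨(‖ℓ a‖ + 1) ^ 2 * (1 + B) ^ 2, ?_⟩
    filter_upwards [hB, nhdsWithin_le_nhds hgℓ, nhdsWithin_le_nhds hgu, self_mem_nhdsWithin,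
      nhdsWithin_le_nhds (hu.continuousAt.eventually_ne hu0),
      nhdsWithin_le_nhds (hℓ.continuousAt.norm.eventually (gt_mem_nhds (lt_add_one _)))]
      with z h1 h2 h3 h4 h5 h6
    have hza : z - a ≠ 0 := sub_ne_zero.2 h4
    have hr : 0 < ‖z - a‖ := norm_pos_iff.2 hza
    have hgz : g z ≠ 0 := by rw [h3]; exact mul_ne_zero (pow_ne_zero _ hza) h5
    have hgp : 0 < ‖g z‖ := norm_pos_iff.2 hgz
    have hs := one_le_logGrowth a z
    have hd : ‖deriv g z‖ = ‖g z‖ * ‖ℓ z‖ / ‖z - a‖ := by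
      rw [eq_div_iff hr.ne', mul_comm, ← norm_mul, h2, norm_mul]
    have hlog : logGrowth a z ^ 2 ≤ (1 + B) * (1 + |Real.log ‖g z‖|) := by
      rw [logGrowth_sq]
      have e1 := abs_sub_abs_le_abs_sub (k * Real.log ‖z - a‖) (Real.log ‖g z‖)
      rw [abs_mul, Nat.abs_cast, abs_sub_comm] at e1
      have e2 := abs_nonneg (Real.log ‖z - a‖)
      have e3 := abs_nonneg (Real.log ‖g z‖)
      nlinarith
    set t := 1 + |Real.log ‖g z‖| with ht
    have ht1 : 1 ≤ t := by simp [ht]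
    rw [singularWeight, hd, mul_one_div, div_le_div_iff₀ (by positivity) (by positivity)]
    have e4 : logGrowth a z ^ 3 ≤ (1 + B) ^ 2 * t ^ 2 := by
      calc logGrowth a z ^ 3 ≤ logGrowth a z ^ 4 := pow_le_pow_right₀ hs (by norm_num)
        _ = (logGrowth a z ^ 2) ^ 2 := by ring
        _ ≤ ((1 + B) * t) ^ 2 := by gcongr
        _ = _ := by ring
    calc (‖g z‖ * ‖ℓ z‖ / ‖z - a‖) ^ 2 * (‖z - a‖ ^ 2 * logGrowth a z ^ 3)
        = ‖ℓ z‖ ^ 2 * ‖g z‖ ^ 2 * logGrowth a z ^ 3 := by field_simp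
      _ ≤ (‖ℓ a‖ + 1) ^ 2 * ‖g z‖ ^ 2 * ((1 + B) ^ 2 * t ^ 2) := by gcongr
      _ = _ := by ring
  · have hc : ContinuousAt (fun z => ‖deriv g z‖ ^ 2 / ‖g z‖ ^ 2) a :=
      (hg.deriv.continuousAt.norm.pow 2).div (hg.continuousAt.norm.pow 2)
        (pow_ne_zero _ (norm_ne_zero_iff.2 ha))
    refine ⟨‖deriv g a‖ ^ 2 / ‖g a‖ ^ 2 + 1, ?_⟩
    filter_upwards [nhdsWithin_le_nhds (hc.eventually (gt_mem_nhds (lt_add_one _))),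
      nhdsWithin_le_nhds (hg.continuousAt.eventually_ne ha),
      eventually_one_le_singularWeight a] with z h1 h2 h3
    have hgp : 0 < ‖g z‖ := norm_pos_iff.2 h2
    have ht1 : 1 ≤ (1 + |Real.log ‖g z‖|) ^ 2 := one_le_pow₀ (by simp)
    calc _ ≤ ‖deriv g z‖ ^ 2 / ‖g z‖ ^ 2 := by
          gcongr
          exact le_mul_of_one_le_right (by positivity) ht1
      _ ≤ _ := h1.le
      _ ≤ _ := le_mul_of_one_le_right (by positivity) h3

section Curves

variable {n : ℕ} {g : ℂ → Coord n} {a : ℂ}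

lemma analyticAt_coord (hg : AnalyticAt ℂ g a) (i : Fin n) : AnalyticAt ℂ (fun z => g z i) a :=
  analyticAt_pi_iff.1 hg i

lemma deriv_coord (hg : DifferentiableAt ℂ g a) (i : Fin n) :
    deriv g a i = deriv (fun z => g z i) a :=
  ((hasDerivAt_pi.1 hg.hasDerivAt i).deriv).symm

lemma logWeight_le (hg : AnalyticAt ℂ g a) {I : Finset (Fin n)}
    (hne : ∀ i ∈ I, ¬ ∀ᶠ z in 𝓝 a, g z i = 0) :
    ∃ C, ∀ᶠ z in 𝓝[≠] a, logWeight I (g z) ≤ C * logGrowth a z ^ 2 := by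
  have h : ∀ i : I, _ := fun i => abs_log_norm_le (analyticAt_coord hg i) (hne i i.2)
  choose C hC using h
  refine ⟨1 + ∑ i, C i, ?_⟩
  filter_upwards [eventually_all.2 hC] with z hz
  have hs : 1 ≤ logGrowth a z ^ 2 := one_le_pow₀ (one_le_logGrowth a z)
  rw [logWeight, add_mul, one_mul, Finset.sum_mul, ← Finset.sum_coe_sort I]
  exact add_le_add hs (Finset.sum_le_sum fun i _ => hz i)

lemma poincareForm_le (hg : AnalyticAt ℂ g a) {I : Finset (Fin n)}
    (hne : ∀ i ∈ I, ¬ ∀ᶠ z in 𝓝 a, g z i = 0) :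
    ∃ C, ∀ᶠ z in 𝓝[≠] a, poincareForm I (g z) (deriv g z) ≤ C * singularWeight a z := by
  have h : ∀ i : Fin n, ∃ C, ∀ᶠ z in 𝓝[≠] a, (if i ∈ I then ‖deriv g z i‖ ^ 2
      / (‖g z i‖ ^ 2 * (1 + |Real.log ‖g z i‖|) ^ 2) else ‖deriv g z i‖ ^ 2)
      ≤ C * singularWeight a z := by
    intro i
    by_cases hi : i ∈ I
    · obtain ⟨C, hC⟩ := poincare_term_le (analyticAt_coord hg i) (hne i hi)
      refine ⟨C, ?_⟩
      filter_upwards [hC, nhdsWithin_le_nhds hg.eventually_analyticAt] with z h1 h2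
      rwa [if_pos hi, deriv_coord h2.differentiableAt]
    · have hc : ContinuousAt (fun z => ‖deriv g z i‖ ^ 2) a :=
        ((continuous_apply i).continuousAt.comp hg.deriv.continuousAt).norm.pow 2
      refine ⟨‖deriv g a i‖ ^ 2 + 1, ?_⟩
      filter_upwards [nhdsWithin_le_nhds (hc.eventually (gt_mem_nhds (lt_add_one _))),
        eventually_one_le_singularWeight a] with z h1 h2
      rw [if_neg hi]
      exact h1.le.trans (le_mul_of_one_le_right (by positivity) h2)
  choose C hC using h
  refine ⟨∑ i, C i, ?_⟩
  filter_upwards [eventually_all.2 hC] with z hz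
  rw [poincareForm, Finset.sum_mul]
  exact Finset.sum_le_sum fun i _ => hz i

/-- At a point where the curve `g` meets the boundary, its derivative has a simple pole in the
logarithmic frame: for `i ∈ I` the component `g i' / g i` of the derivative has a pole with residue
the order of vanishing of `g i`. -/
lemma exists_lift_of_zero (hg : AnalyticAt ℂ g a) {I : Finset (Fin n)}
    (hne : ∀ i ∈ I, ¬ ∀ᶠ z in 𝓝 a, g z i = 0) (h0 : ∃ i ∈ I, g a i = 0) :
    ∃ ξ : ℂ → Coord n, AnalyticAt ℂ ξ a ∧ ξ a ≠ 0 ∧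
      ∀ᶠ z in 𝓝 a, (z - a) • deriv g z = logFrame I (g z) (ξ z) := by
  have h : ∀ i : I, _ := fun i => exists_logDeriv (analyticAt_coord hg i) (hne i i.2)
  choose k u ℓ hu hu0 hℓ hℓk hk hgu hgℓ using h
  refine ⟨fun z i => if hi : i ∈ I then ℓ ⟨i, hi⟩ z else (z - a) * deriv g z i, ?_, ?_, ?_⟩
  · rw [analyticAt_pi_iff]
    intro i
    by_cases hi : i ∈ I
    · simpa [hi] using hℓ ⟨i, hi⟩
    · simp only [hi, dite_false]
      exact (analyticAt_id.sub analyticAt_const).mul (analyticAt_coord hg.deriv i)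
  · obtain ⟨i, hi, hi0⟩ := h0
    intro hξ
    have := congrFun hξ i
    simp only [hi, dif_pos, hℓk, Pi.zero_apply, Nat.cast_eq_zero] at this
    exact hk ⟨i, hi⟩ hi0 this
  · filter_upwards [eventually_all.2 hgℓ, hg.eventually_analyticAt] with z h1 h2
    ext i
    by_cases hi : i ∈ I
    · simp only [logFrame, hi, if_true, dif_pos, Pi.smul_apply, smul_eq_mul]
      rw [← h1 ⟨i, hi⟩, deriv_coord h2.differentiableAt]
    · simp [logFrame, hi]

end Curves

/-! ### Propagation of non-degeneracy over the disc -/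

/-- If a property holds, near each point of a connected set, either identically or at no point of a
punctured neighbourhood, and if it fails at one point, then it fails on punctured neighbourhoods of
all points. -/
lemma eventually_not_of_isPreconnected {Ω : Set ℂ} (hΩ : IsPreconnected Ω) {Q : ℂ → Prop}
    (h : ∀ z ∈ Ω, (∀ᶠ y in 𝓝 z, Q y) ∨ ∀ᶠ y in 𝓝[≠] z, ¬ Q y) {b : ℂ} (hb : b ∈ Ω)
    (hQ : ¬ Q b) {z : ℂ} (hz : z ∈ Ω) : ∀ᶠ y in 𝓝[≠] z, ¬ Q y := by
  have ho₁ : IsOpen {z : ℂ | ∀ᶠ y in 𝓝 z, Q y} := isOpen_setOfPred_eventually_nhds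
  have ho₂ : IsOpen {z : ℂ | ∀ᶠ y in 𝓝[≠] z, ¬ Q y} := by
    rw [isOpen_iff_eventually]
    intro z hz
    replace hz := eventually_nhdsWithin_iff.1 hz
    filter_upwards [hz.eventually_nhds] with y hy
    by_cases hyz : y = z
    · exact hyz ▸ eventually_nhdsWithin_iff.2 hz
    · refine nhdsWithin_le_nhds ?_
      filter_upwards [hy, isOpen_ne.mem_nhds hyz] with x h1 h2 using h1 h2
  have hdisj : Disjoint {z : ℂ | ∀ᶠ y in 𝓝 z, Q y} {z : ℂ | ∀ᶠ y in 𝓝[≠] z, ¬ Q y} := by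
    rw [Set.disjoint_left]
    intro z h1 h2
    obtain ⟨y, h3, h4⟩ := (Eventually.and (nhdsWithin_le_nhds (s := {z}ᶜ) h1) h2).exists
    exact h4 h3
  refine hΩ.subset_right_of_subset_union ho₁ ho₂ hdisj (fun z hz => h z hz) ⟨b, hb, ?_⟩ hz
  exact (h b hb).resolve_left fun h' => hQ h'.self_of_nhds

/-- A set with no accumulation points in a compact set has finitely many points there. -/
lemma finite_inter_of_eventually_not {K : Set ℂ} (hK : IsCompact K) {Q : ℂ → Prop}
    (h : ∀ z ∈ K, ∀ᶠ y in 𝓝[≠] z, ¬ Q y) : {z | z ∈ K ∧ Q z}.Finite := by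
  by_contra hinf
  obtain ⟨z, hz, hacc⟩ := Set.Infinite.exists_accPt_of_subset_isCompact hinf hK fun z hz => hz.1
  rw [accPt_iff_frequently_nhdsNE] at hacc
  exact hacc ((h z hz).mono fun y hy hy' => hy hy'.2)

/-! ### Logarithmic charts -/

section Geometry

variable {n : ℕ} {X : Type*} [TopologicalSpace X] [ChartedSpace (Coord n) X] {D : Set X}

lemma isOpen_compl_of_isLogSmooth (hD : IsLogSmooth n D) : IsOpen Dᶜ := by
  rw [isOpen_iff_eventually]
  intro x hx
  obtain ⟨e, I, ⟨-, he⟩, hxe⟩ := hD x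
  have h1 : ∀ i ∈ I, ∀ᶠ y in 𝓝 x, e y i ≠ 0 := fun i hi => by
    have hc : ContinuousAt (fun y => e y i) x :=
      (continuous_apply i).continuousAt.comp (e.continuousAt hxe)
    exact hc.eventually_ne fun h => hx ((he x hxe).2 ⟨i, hi, h⟩)
  have h2 : ∀ᶠ y in 𝓝 x, ∀ i : I, e y i ≠ 0 := eventually_all.2 fun i => h1 i i.2
  filter_upwards [h2, e.open_source.mem_nhds hxe] with y hy hys hyD
  obtain ⟨i, hi, h0⟩ := (he y hys).1 hyD
  exact hy ⟨i, hi⟩ h0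

/-- Off `D`, any chart is a log chart, with an empty set of boundary coordinates. -/
lemma isLogChart_restr_compl [IsManifold 𝓘(ℂ, Coord n) ω X] (hD : IsOpen Dᶜ) (x : X) :
    IsLogChart D ((chartAt (Coord n) x).restr Dᶜ) ∅ := by
  refine ⟨restr_mem_maximalAtlas _ (IsManifold.chart_mem_maximalAtlas x) hD, fun y hy => ?_⟩
  rw [OpenPartialHomeomorph.restr_source, hD.interior_eq] at hy
  simpa using hy.2

namespace IsLogChart

variable {e : OpenPartialHomeomorph X (Coord n)} {I : Finset (Fin n)}

lemma mdifferentiable (he : IsLogChart D e I) :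
    e.MDifferentiable 𝓘(ℂ, Coord n) 𝓘(ℂ, Coord n) :=
  ⟨(contMDiffOn_of_mem_maximalAtlas he.1).mdifferentiableOn (by simp),
    (contMDiffOn_symm_of_mem_maximalAtlas he.1).mdifferentiableOn (by simp)⟩

lemma notMem_iff (he : IsLogChart D e I) {x : X} (hx : x ∈ e.source) :
    x ∉ D ↔ ∀ i ∈ I, e x i ≠ 0 := by
  rw [he.2 x hx]
  push Not
  rfl

lemma symm_notMem (he : IsLogChart D e I) {z : Coord n} (hz : z ∈ e.target)
    (hI : ∀ i ∈ I, z i ≠ 0) : e.symm z ∉ D := by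
  rw [he.notMem_iff (e.map_target hz), e.right_inv hz]
  exact hI

lemma mfderiv_symm_ne_zero (he : IsLogChart D e I) {z : Coord n} (hz : z ∈ e.target)
    {v : Coord n} (hv : v ≠ 0) :
    (mfderiv 𝓘(ℂ, Coord n) 𝓘(ℂ, Coord n) e.symm z v : Coord n) ≠ 0 := by
  intro h
  apply hv
  apply he.mdifferentiable.symm.mfderiv_injective hz
  exact h.trans (map_zero (mfderiv 𝓘(ℂ, Coord n) 𝓘(ℂ, Coord n) e.symm z)).symm

end IsLogChart

lemma logFrame_ne_zero {I : Finset (Fin n)} {z ξ : Coord n} (hI : ∀ i ∈ I, z i ≠ 0)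
    (hξ : ξ ≠ 0) : logFrame I z ξ ≠ 0 := by
  intro h
  apply hξ
  ext i
  have := congrFun h i
  by_cases hi : i ∈ I
  · simpa [logFrame, hi, hI i hi] using this
  · simpa [logFrame, hi] using this

/-! ### Hermitian metrics -/

namespace OpenMetric

variable (h : OpenMetric n D)

lemma normSq_congr {x y : X} (hxy : x = y) {v w : Coord n} (hvw : v = w) :
    h.normSq x v = h.normSq y w := by
  subst hxy hvw
  rfl

lemma normSq_smul (x : X) (c : ℂ) (v : TangentSpace 𝓘(ℂ, Coord n) x) :
    h.normSq x (c • v) = ‖c‖ ^ 2 * h.normSq x v := by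
  have : h.form x (c • v) (c • v) = ((‖c‖ ^ 2 : ℝ) : ℂ) * h.form x v v := by
    rw [LinearMap.map_smul, LinearMap.map_smulₛₗ, LinearMap.smul_apply, smul_eq_mul, smul_eq_mul,
      ← mul_assoc, mul_comm c, ← Complex.normSq_eq_conj_mul_self, Complex.normSq_eq_norm_sq]
  unfold OpenMetric.normSq
  rw [this, Complex.re_ofReal_mul]

lemma normSq_pos {x : X} (hx : x ∉ D) {v : Coord n} (hv : v ≠ 0) : 0 < h.normSq x v :=
  h.pos x hx v hv

end OpenMetric

variable {e : OpenPartialHomeomorph X (Coord n)} {I : Finset (Fin n)}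

lemma normSq_logVector_pos (h : OpenMetric n D) (he : IsLogChart D e I) {z ξ : Coord n}
    (hz : z ∈ e.target) (hI : ∀ i ∈ I, z i ≠ 0) (hξ : ξ ≠ 0) :
    0 < h.normSq (e.symm z) (logVector e I z ξ) :=
  h.normSq_pos (he.symm_notMem hz hI) (he.mfderiv_symm_ne_zero hz (logFrame_ne_zero hI hξ))

lemma contDiffAt_tautPotential (h : OpenMetric n D) (he : IsLogChart D e I) {z ξ : Coord n}
    (hz : z ∈ e.target) (hI : ∀ i ∈ I, z i ≠ 0) (hξ : ξ ≠ 0) :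
    ContDiffAt ℝ 2 (tautPotential h e I) (z, ξ) := by
  have ho : IsOpen {p : Coord n × Coord n | p.1 ∈ e.target ∧ ∀ i ∈ I, p.1 i ≠ 0} := by
    have h1 : IsOpen {p : Coord n × Coord n | p.1 ∈ e.target} :=
      e.open_target.preimage continuous_fst
    have h2 : IsOpen {p : Coord n × Coord n | ∀ i ∈ I, p.1 i ≠ 0} := by
      simp only [Set.ofPred_forall]
      exact isOpen_biInter_finset fun i _ =>
        isOpen_ne.preimage ((continuous_apply i).comp continuous_fst)
    exact h1.inter h2
  have hs := ((h.smooth e I he).contDiffAt (x := (z, ξ)) (ho.mem_nhds ⟨hz, hI⟩)).of_le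
    (show (2 : WithTop ℕ∞) ≤ ∞ from WithTop.coe_le_coe.2 le_top)
  exact hs.log (normSq_logVector_pos h he hz hI hξ).ne'

/-! ### Holomorphic discs in log charts -/

/-- `log ‖f_*(∂/∂z)‖²`. -/
noncomputable def logNormSqPushDz (h : OpenMetric n D) (f : ℂ → X) (z : ℂ) : ℝ :=
  Real.log (h.normSq (f z) (pushDz n f z))

variable {f : ℂ → X} {Ω : Set ℂ}

/-- `f` read in a chart. -/
lemma analyticAt_chart_comp (he : IsLogChart D e I) (hΩ : IsOpen Ω)
    (hf : MDifferentiableOn 𝓘(ℂ, ℂ) 𝓘(ℂ, Coord n) f Ω) {z : ℂ} (hz : z ∈ Ω)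
    (hze : f z ∈ e.source) : AnalyticAt ℂ (fun t => e (f t)) z := by
  have hc : ContinuousOn f Ω := hf.continuousOn
  have ho : IsOpen (Ω ∩ f ⁻¹' e.source) := hc.isOpen_inter_preimage hΩ e.open_source
  have hd : DifferentiableOn ℂ (fun t => e (f t)) (Ω ∩ f ⁻¹' e.source) := by
    intro t ht
    have h1 : MDifferentiableAt 𝓘(ℂ, ℂ) 𝓘(ℂ, Coord n) f t :=
      (hf t ht.1).mdifferentiableAt (hΩ.mem_nhds ht.1)
    have h2 : MDifferentiableAt 𝓘(ℂ, Coord n) 𝓘(ℂ, Coord n) e (f t) :=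
      he.mdifferentiable.mdifferentiableAt ht.2
    exact (h2.comp t h1).differentiableAt.differentiableWithinAt
  exact hd.analyticAt (ho.mem_nhds ⟨hz, hze⟩)

lemma eventually_mem_source (hΩ : IsOpen Ω)
    (hf : MDifferentiableOn 𝓘(ℂ, ℂ) 𝓘(ℂ, Coord n) f Ω) {z : ℂ} (hz : z ∈ Ω)
    {s : Set X} (hs : IsOpen s) (hze : f z ∈ s) : ∀ᶠ t in 𝓝 z, t ∈ Ω ∧ f t ∈ s :=
  (hf.continuousOn.isOpen_inter_preimage hΩ hs).mem_nhds ⟨hz, hze⟩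

lemma pushDz_eq (he : IsLogChart D e I) (hΩ : IsOpen Ω)
    (hf : MDifferentiableOn 𝓘(ℂ, ℂ) 𝓘(ℂ, Coord n) f Ω) {z : ℂ} (hz : z ∈ Ω)
    (hze : f z ∈ e.source) : (pushDz n f z : Coord n)
      = (mfderiv 𝓘(ℂ, Coord n) 𝓘(ℂ, Coord n) e.symm (e (f z))
        (deriv (fun t => e (f t)) z) : Coord n) := by
  have hg : MDifferentiableAt 𝓘(ℂ, ℂ) 𝓘(ℂ, Coord n) (fun t => e (f t)) z :=
    (analyticAt_chart_comp he hΩ hf hz hze).differentiableAt.mdifferentiableAt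
  have hs : MDifferentiableAt 𝓘(ℂ, Coord n) 𝓘(ℂ, Coord n) e.symm (e (f z)) :=
    he.mdifferentiable.mdifferentiableAt_symm (e.map_source hze)
  have hev : f =ᶠ[𝓝 z] e.symm ∘ fun t => e (f t) := by
    filter_upwards [eventually_mem_source hΩ hf hz e.open_source hze] with t ht
    exact (e.left_inv ht.2).symm
  have h1 : (mfderiv 𝓘(ℂ, ℂ) 𝓘(ℂ, Coord n) f z : ℂ →L[ℂ] Coord n)
      = (mfderiv 𝓘(ℂ, Coord n) 𝓘(ℂ, Coord n) e.symm (e (f z))).comp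
        (mfderiv 𝓘(ℂ, ℂ) 𝓘(ℂ, Coord n) (fun t => e (f t)) z) :=
    (Filter.EventuallyEq.mfderiv_eq hev).trans (mfderiv_comp z hs hg)
  have h2 := congrArg (fun A : ℂ →L[ℂ] Coord n => A 1) h1
  refine h2.trans ?_
  change mfderiv 𝓘(ℂ, Coord n) 𝓘(ℂ, Coord n) e.symm (e (f z))
    (mfderiv 𝓘(ℂ, ℂ) 𝓘(ℂ, Coord n) (fun t => e (f t)) z (1 : ℂ)) = _
  rw [mfderiv_eq_fderiv]
  rfl

lemma pushDz_eq_zero_iff (he : IsLogChart D e I) (hΩ : IsOpen Ω)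
    (hf : MDifferentiableOn 𝓘(ℂ, ℂ) 𝓘(ℂ, Coord n) f Ω) {z : ℂ} (hz : z ∈ Ω)
    (hze : f z ∈ e.source) : pushDz n f z = 0 ↔ deriv (fun t => e (f t)) z = 0 := by
  have key := pushDz_eq he hΩ hf hz hze
  constructor
  · intro h0
    by_contra hne
    exact he.mfderiv_symm_ne_zero (e.map_source hze) hne (key.symm.trans h0)
  · intro h0
    refine key.trans ((congrArg (fun v : Coord n => (mfderiv 𝓘(ℂ, Coord n) 𝓘(ℂ, Coord n) e.symm
      (e (f z)) : Coord n →L[ℂ] Coord n) v) h0).trans ?_)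
    exact map_zero (mfderiv 𝓘(ℂ, Coord n) 𝓘(ℂ, Coord n) e.symm (e (f z)))

/-- The norm of `f_*(∂/∂z)` in terms of the components of `f_*(∂/∂z)` in the log frame. -/
lemma normSq_pushDz (h : OpenMetric n D) (he : IsLogChart D e I) (hΩ : IsOpen Ω)
    (hf : MDifferentiableOn 𝓘(ℂ, ℂ) 𝓘(ℂ, Coord n) f Ω) {z : ℂ} (hz : z ∈ Ω)
    (hze : f z ∈ e.source) {c : ℂ} {ξ : Coord n}
    (hξ : deriv (fun t => e (f t)) z = c • logFrame I (e (f z)) ξ) :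
    h.normSq (f z) (pushDz n f z)
      = ‖c‖ ^ 2 * h.normSq (e.symm (e (f z))) (logVector e I (e (f z)) ξ) := by
  have h1 : (pushDz n f z : Coord n) = (c • logVector e I (e (f z)) ξ : Coord n) := by
    refine (pushDz_eq he hΩ hf hz hze).trans ((congrArg (fun v : Coord n => (mfderiv
      𝓘(ℂ, Coord n) 𝓘(ℂ, Coord n) e.symm (e (f z)) : Coord n →L[ℂ] Coord n) v) hξ).trans ?_)
    exact map_smul (mfderiv 𝓘(ℂ, Coord n) 𝓘(ℂ, Coord n) e.symm (e (f z))) c _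
  rw [h.normSq_congr (e.left_inv hze).symm h1]
  exact h.normSq_smul _ c _

lemma logNormSqPushDz_eq (h : OpenMetric n D) (he : IsLogChart D e I) (hΩ : IsOpen Ω)
    (hf : MDifferentiableOn 𝓘(ℂ, ℂ) 𝓘(ℂ, Coord n) f Ω) {z : ℂ} (hz : z ∈ Ω)
    (hze : f z ∈ e.source) (hzD : f z ∉ D) {c : ℂ} (hc : c ≠ 0) {ξ : Coord n} (hξ0 : ξ ≠ 0)
    (hξ : deriv (fun t => e (f t)) z = c • logFrame I (e (f z)) ξ) :
    logNormSqPushDz h f z = tautPotential h e I (e (f z), ξ) + 2 * Real.log ‖c‖ := by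
  have hp := normSq_logVector_pos h he (e.map_source hze) ((he.notMem_iff hze).1 hzD) hξ0
  rw [logNormSqPushDz, normSq_pushDz h he hΩ hf hz hze hξ,
    Real.log_mul (pow_ne_zero _ (norm_ne_zero_iff.2 hc)) hp.ne', Real.log_pow, tautPotential]
  push_cast
  ring

/-- The Laplacian of `log ‖ξ‖²` along a lift of `f` is, up to a factor, the pullback of the Chern
form. -/
lemma laplacian_tautPotential_comp (h : OpenMetric n D) (he : IsLogChart D e I) (hΩ : IsOpen Ω)
    (hf : MDifferentiableOn 𝓘(ℂ, ℂ) 𝓘(ℂ, Coord n) f Ω) {z : ℂ} (hz : z ∈ Ω)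
    (hze : f z ∈ e.source) (hzD : f z ∉ D) {ξ : ℂ → Coord n} (hξ : AnalyticAt ℂ ξ z)
    (hξ0 : ξ z ≠ 0) :
    ContDiffAt ℝ 2 (fun t => tautPotential h e I (e (f t), ξ t)) z ∧
    Laplacian.laplacian (fun t => tautPotential h e I (e (f t), ξ t)) z
      = 4 * Real.pi * tautChernForm h e I (e (f z), ξ z)
        (deriv (fun t => e (f t)) z, deriv ξ z) := by
  have hg := analyticAt_chart_comp he hΩ hf hz hze
  have hγ : AnalyticAt ℂ (fun t => (e (f t), ξ t)) z := hg.prod hξ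
  have hd : deriv (fun t => (e (f t), ξ t)) z = (deriv (fun t => e (f t)) z, deriv ξ z) :=
    (hg.differentiableAt.hasDerivAt.prodMk hξ.differentiableAt.hasDerivAt).deriv
  obtain ⟨h1, h2⟩ := laplacian_comp_analyticAt (Φ := tautPotential h e I) hγ
    (contDiffAt_tautPotential h he (e.map_source hze) ((he.notMem_iff hze).1 hzD) hξ0)
  refine ⟨h1, h2.trans ?_⟩
  rw [hd, tautChernForm, leviForm]
  have := Real.pi_pos
  field_simp

end Geometry

/-! ### The Chern form and the norm of the derivative of a disc -/

section Discs

variable {n : ℕ} {X : Type*} [TopologicalSpace X] [ChartedSpace (Coord n) X] {D : Set X}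
  {e : OpenPartialHomeomorph X (Coord n)} {I : Finset (Fin n)} {f : ℂ → X} {Ω : Set ℂ}

lemma analyticAt_logFrame {g ξ : ℂ → Coord n} {z : ℂ} (hg : AnalyticAt ℂ g z)
    (hξ : AnalyticAt ℂ ξ z) : AnalyticAt ℂ (fun t => logFrame I (g t) (ξ t)) z := by
  rw [analyticAt_pi_iff]
  intro i
  by_cases hi : i ∈ I
  · simp only [logFrame, hi, if_true]
    exact (analyticAt_coord hg i).mul (analyticAt_coord hξ i)
  · simp only [logFrame, hi, if_false]
    exact analyticAt_coord hξ i

/-- Whichever lift of `f'` is used, the pullback of the Chern form is the Laplacian of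
`log ‖f_*(∂/∂z)‖²`, because the lift differs from `f_*(∂/∂z)` by a holomorphic factor `c`, and
`log |c|` is harmonic. -/
lemma IsDerivativeLift.laplacian_logNormSqPushDz {ξ : ℂ → Coord n} {z : ℂ}
    (hl : IsDerivativeLift D f z e I ξ) (h : OpenMetric n D) (hDo : IsOpen Dᶜ) (hΩ : IsOpen Ω)
    (hf : MDifferentiableOn 𝓘(ℂ, ℂ) 𝓘(ℂ, Coord n) f Ω) (hz : z ∈ Ω) (hzD : f z ∉ D)
    (hne : pushDz n f z ≠ 0) :
    ContDiffAt ℝ 2 (logNormSqPushDz h f) z ∧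
      Laplacian.laplacian (logNormSqPushDz h f) z = 4 * Real.pi *
        tautChernForm h e I (e (f z), ξ z) (deriv (fun t => e (f t)) z, deriv ξ z) := by
  obtain ⟨he, hze, hξ, hξ0, hl⟩ := hl
  have hg := analyticAt_chart_comp he hΩ hf hz hze
  have hw := analyticAt_logFrame (I := I) hg hξ
  have hg0 : deriv (fun t => e (f t)) z ≠ 0 := fun h0 =>
    hne ((pushDz_eq_zero_iff he hΩ hf hz hze).2 h0)
  have hw0 : logFrame I (e (f z)) (ξ z) ≠ 0 :=
    logFrame_ne_zero ((he.notMem_iff hze).1 hzD) hξ0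
  obtain ⟨j, hj⟩ := Function.ne_iff.1 hw0
  set c : ℂ → ℂ := fun t => deriv (fun t => e (f t)) t j / logFrame I (e (f t)) (ξ t) j with hc
  have hca : AnalyticAt ℂ c z :=
    (analyticAt_coord hg.deriv j).div (analyticAt_coord hw j) hj
  have hcl : ∀ᶠ t in 𝓝 z,
      deriv (fun t => e (f t)) t = c t • logFrame I (e (f t)) (ξ t) := by
    filter_upwards [hl, eventually_mem_source hΩ hf hz hDo hzD,
      (analyticAt_coord hw j).continuousAt.eventually_ne hj] with t h1 h2 h3
    obtain ⟨c', hc'⟩ := h1 h2.2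
    rw [hc', hc]
    simp only [hc', Pi.smul_apply, smul_eq_mul]
    rw [mul_div_cancel_right₀ _ h3]
  have hc0 : c z ≠ 0 := by
    intro h0
    apply hg0
    rw [hcl.self_of_nhds, h0, zero_smul]
  have hU : logNormSqPushDz h f =ᶠ[𝓝 z]
      (fun t => tautPotential h e I (e (f t), ξ t)) + (2 : ℝ) • fun t => Real.log ‖c t‖ := by
    filter_upwards [hcl, eventually_mem_source hΩ hf hz hDo hzD,
      eventually_mem_source hΩ hf hz e.open_source hze, hca.continuousAt.eventually_ne hc0,
      hξ.continuousAt.eventually_ne hξ0] with t h1 h2 h3 h4 h5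
    exact logNormSqPushDz_eq h he hΩ hf h2.1 h3.2 h2.2 h4 h5 h1
  have hharm : HarmonicAt ((2 : ℝ) • fun t => Real.log ‖c t‖) z :=
    (hca.harmonicAt_log_norm hc0).const_smul
  obtain ⟨h1, h2⟩ := laplacian_tautPotential_comp h he hΩ hf hz hze hzD hξ hξ0
  refine ⟨(h1.add hharm.1).congr_of_eventuallyEq hU, ?_⟩
  rw [laplacian_congr_at hU, h1.laplacian_add hharm.1, hharm.2.self_of_nhds, h2]
  simp

section IsManifold

variable [IsManifold 𝓘(ℂ, Coord n) ω X]

/-- Off the zeros of the derivative and off `f⁻¹(D)`, the derivative of `f` is itself a lift. -/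
lemma pullbackChern_eq (h : OpenMetric n D) (hDo : IsOpen Dᶜ) (hΩ : IsOpen Ω)
    (hf : MDifferentiableOn 𝓘(ℂ, ℂ) 𝓘(ℂ, Coord n) f Ω) {z : ℂ} (hz : z ∈ Ω) (hzD : f z ∉ D)
    (hne : pushDz n f z ≠ 0) :
    ContDiffAt ℝ 2 (logNormSqPushDz h f) z ∧ pullbackChern h f z
      = 1 / (4 * Real.pi) * Laplacian.laplacian (logNormSqPushDz h f) z := by
  have he : IsLogChart D ((chartAt (Coord n) (f z)).restr Dᶜ) ∅ :=
    isLogChart_restr_compl hDo (f z)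
  have hze : f z ∈ ((chartAt (Coord n) (f z)).restr Dᶜ).source := by
    rw [OpenPartialHomeomorph.restr_source, hDo.interior_eq]
    exact ⟨mem_chart_source _ _, hzD⟩
  have hg := analyticAt_chart_comp he hΩ hf hz hze
  have H : ∃ c : (OpenPartialHomeomorph X (Coord n) × Finset (Fin n)) × (ℂ → Coord n),
      IsDerivativeLift D f z c.1.1 c.1.2 c.2 := by
    refine ⟨(((chartAt (Coord n) (f z)).restr Dᶜ, ∅), deriv fun t => _), he, hze, hg.deriv,
      fun h0 => hne ((pushDz_eq_zero_iff he hΩ hf hz hze).2 h0), Eventually.of_forall fun t _ =>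
      ⟨1, ?_⟩⟩
    rw [one_smul]
    rfl
  obtain ⟨h1, h2⟩ := H.choose_spec.laplacian_logNormSqPushDz h hDo hΩ hf hz hzD hne
  refine ⟨h1, ?_⟩
  rw [pullbackChern, dif_pos H, h2]
  have := Real.pi_pos
  field_simp

/-! ### Orders of vanishing -/

/-- Statements about zeros of `f_*(∂/∂z)` do not involve `D`, and can be read in the preferred
charts, which are log charts for the empty divisor. -/
lemma isLogChart_empty (x : X) : IsLogChart ∅ (chartAt (Coord n) x) ∅ :=
  ⟨IsManifold.chart_mem_maximalAtlas x, fun y _ => by simp⟩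

lemma analyticAt_deriv_chartAt (hΩ : IsOpen Ω)
    (hf : MDifferentiableOn 𝓘(ℂ, ℂ) 𝓘(ℂ, Coord n) f Ω) {z : ℂ} (hz : z ∈ Ω) :
    AnalyticAt ℂ (deriv fun t => chartAt (Coord n) (f z) (f t)) z :=
  (analyticAt_chart_comp (isLogChart_empty (f z)) hΩ hf hz (mem_chart_source _ _)).deriv

lemma eventually_pushDz_eq_zero_iff (hΩ : IsOpen Ω)
    (hf : MDifferentiableOn 𝓘(ℂ, ℂ) 𝓘(ℂ, Coord n) f Ω) {z : ℂ} (hz : z ∈ Ω) :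
    ∀ᶠ y in 𝓝 z, pushDz n f y = 0 ↔ deriv (fun t => chartAt (Coord n) (f z) (f t)) y = 0 := by
  filter_upwards [eventually_mem_source hΩ hf hz (chartAt (Coord n) (f z)).open_source
    (mem_chart_source _ _)] with y hy
  exact pushDz_eq_zero_iff (isLogChart_empty (f z)) hΩ hf hy.1 hy.2

/-- The zeros of `f_*(∂/∂z)` are isolated, unless it vanishes identically nearby. -/
lemma pushDz_eq_zero_or (hΩ : IsOpen Ω)
    (hf : MDifferentiableOn 𝓘(ℂ, ℂ) 𝓘(ℂ, Coord n) f Ω) {z : ℂ} (hz : z ∈ Ω) :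
    (∀ᶠ y in 𝓝 z, pushDz n f y = 0) ∨ ∀ᶠ y in 𝓝[≠] z, ¬ pushDz n f y = 0 := by
  have hev := eventually_pushDz_eq_zero_iff hΩ hf hz
  rcases (analyticAt_deriv_chartAt hΩ hf hz).eventually_eq_zero_or_eventually_ne_zero with h | h
  · left
    filter_upwards [hev, h] with y h1 h2 using h1.2 h2
  · right
    filter_upwards [nhdsWithin_le_nhds hev, h] with y h1 h2 h3 using h2 (h1.1 h3)

lemma ramificationOrder_ne_top (hΩ : IsOpen Ω)
    (hf : MDifferentiableOn 𝓘(ℂ, ℂ) 𝓘(ℂ, Coord n) f Ω) {z : ℂ} (hz : z ∈ Ω)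
    (hne : ∀ᶠ y in 𝓝[≠] z, ¬ pushDz n f y = 0) : ramificationOrder n f z ≠ ⊤ := by
  rw [ramificationOrder, Ne, analyticOrderAt_eq_top]
  intro h0
  obtain ⟨y, h1, h2⟩ := (hne.and (nhdsWithin_le_nhds
    (h0.and (eventually_pushDz_eq_zero_iff hΩ hf hz)))).exists
  exact h1 (h2.2.2 h2.1)

lemma pushDz_eq_zero_of_ramificationOrder_ne_zero (hΩ : IsOpen Ω)
    (hf : MDifferentiableOn 𝓘(ℂ, ℂ) 𝓘(ℂ, Coord n) f Ω) {z : ℂ} (hz : z ∈ Ω)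
    (hne : ramificationOrder n f z ≠ 0) : pushDz n f z = 0 := by
  by_contra h0
  apply hne
  rw [ramificationOrder, analyticOrderAt_eq_zero]
  exact Or.inr fun h => h0 ((eventually_pushDz_eq_zero_iff hΩ hf hz).self_of_nhds.2 h)

end IsManifold

lemma analyticAt_prod_coord (he : IsLogChart D e I) (hΩ : IsOpen Ω)
    (hf : MDifferentiableOn 𝓘(ℂ, ℂ) 𝓘(ℂ, Coord n) f Ω) {z : ℂ} (hz : z ∈ Ω)
    (hze : f z ∈ e.source) : AnalyticAt ℂ (fun t => ∏ i ∈ I, e (f t) i) z :=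
  Finset.analyticAt_fun_prod _ fun i _ =>
    analyticAt_coord (analyticAt_chart_comp he hΩ hf hz hze) i

lemma IsLogChart.mem_iff_prod_eq_zero (he : IsLogChart D e I) {x : X} (hx : x ∈ e.source) :
    x ∈ D ↔ ∏ i ∈ I, e x i = 0 := by
  rw [he.2 x hx, Finset.prod_eq_zero_iff]

/-- The points of `f⁻¹(D)` are isolated, unless `f` maps a neighbourhood to `D`. -/
lemma mem_boundary_or (hD : IsLogSmooth n D) (hΩ : IsOpen Ω)
    (hf : MDifferentiableOn 𝓘(ℂ, ℂ) 𝓘(ℂ, Coord n) f Ω) {z : ℂ} (hz : z ∈ Ω) :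
    (∀ᶠ y in 𝓝 z, f y ∈ D) ∨ ∀ᶠ y in 𝓝[≠] z, ¬ f y ∈ D := by
  obtain ⟨e, I, he, hze⟩ := hD (f z)
  have hev := eventually_mem_source hΩ hf hz e.open_source hze
  rcases (analyticAt_prod_coord he hΩ hf hz hze).eventually_eq_zero_or_eventually_ne_zero
    with h | h
  · left
    filter_upwards [hev, h] with y h1 h2 using (he.mem_iff_prod_eq_zero h1.2).2 h2
  · right
    filter_upwards [nhdsWithin_le_nhds hev, h] with y h1 h2 h3
    exact h2 ((he.mem_iff_prod_eq_zero h1.2).1 h3)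

lemma boundaryOrder_eq_zero (hD : IsLogSmooth n D) {z : ℂ} (hzD : f z ∉ D) :
    boundaryOrder n D f z = 0 := by
  obtain ⟨e, I, he, hze⟩ := hD (f z)
  refine le_antisymm ((iInf₂_le e I).trans ((iInf₂_le he hze).trans ?_)) zero_le
  have h0 : ∏ i ∈ I, e (f z) i ≠ 0 := fun h => hzD ((he.mem_iff_prod_eq_zero hze).2 h)
  have h1 : analyticOrderAt (fun t => ∏ i ∈ I, e (f t) i) z = 0 :=
    analyticOrderAt_eq_zero.2 (Or.inr h0)
  exact h1.le

lemma boundaryOrder_ne_top (hD : IsLogSmooth n D) (hΩ : IsOpen Ω)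
    (hf : MDifferentiableOn 𝓘(ℂ, ℂ) 𝓘(ℂ, Coord n) f Ω) {z : ℂ} (hz : z ∈ Ω)
    (hne : ∀ᶠ y in 𝓝[≠] z, ¬ f y ∈ D) : boundaryOrder n D f z ≠ ⊤ := by
  obtain ⟨e, I, he, hze⟩ := hD (f z)
  refine ne_top_of_le_ne_top ?_ ((iInf₂_le e I).trans (iInf₂_le he hze))
  rw [Ne, analyticOrderAt_eq_top]
  intro h0
  obtain ⟨y, h1, h2⟩ := (hne.and (nhdsWithin_le_nhds
    (h0.and (eventually_mem_source hΩ hf hz e.open_source hze)))).exists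
  exact h1 ((he.mem_iff_prod_eq_zero h2.2.2).2 h2.1)

open Classical in
/-- Every local equation of `D` vanishes at the points of `f⁻¹(D)`, so the truncated order counts
them without multiplicity. -/
lemma toNat_min_one_boundaryOrder (hD : IsLogSmooth n D) (hΩ : IsOpen Ω)
    (hf : MDifferentiableOn 𝓘(ℂ, ℂ) 𝓘(ℂ, Coord n) f Ω) {z : ℂ} (hz : z ∈ Ω) :
    (min 1 (boundaryOrder n D f z)).toNat = if f z ∈ D then 1 else 0 := by
  split_ifs with hzD
  · rw [min_eq_left]
    · rfl
    · refine le_iInf₂ fun e I => le_iInf₂ fun he hze => ?_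
      rw [Order.one_le_iff_ne_zero, Ne, analyticOrderAt_eq_zero, not_or, not_not, not_not]
      exact ⟨analyticAt_prod_coord he hΩ hf hz hze, (he.mem_iff_prod_eq_zero hze).1 hzD⟩
  · rw [boundaryOrder_eq_zero hD hzD]
    simp

end Discs

/-! ### The norm of the derivative near the points where it degenerates -/

lemma isMildAt_of_contDiffAt {φ : ℂ → ℝ} {a : ℂ} (hφ : ContDiffAt ℝ 2 φ a) : IsMildAt φ a := by
  have h0 : IsMildAt (fun _ => 0) a := by
    refine ⟨⟨0, by simp⟩, fun _ => 0, ⟨univ, univ_mem, integrableOn_zero⟩, ?_⟩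
    simp [laplacian_eq_dirDeriv₂ (contDiffAt_const (c := (0 : ℝ)) (n := 2)), dirDeriv₂]
  exact (h0.sub_contDiffAt (Eventually.of_forall fun _ => contDiffAt_const) hφ.neg).congr
    (Eventually.of_forall fun z => by simp)

/-- If `x` is comparable to `y²` up to powers of `W ≤ C₁ s²`, then `log x` is bounded by a multiple
of `s`. Here `x` is a squared norm, `W` is the weight in the bounds on the metric, and `s` is the
growth that mild singularities allow. -/
lemma abs_log_le_of_bounds {x y C W C₁ s : ℝ} {N : ℕ} (hC : 0 < C) (hW : 1 ≤ W) (hx : 0 < x)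
    (hy : 0 < y) (h1 : y ^ 2 ≤ C * W ^ N * x) (h2 : x ≤ C * W ^ N * y ^ 2) (hC₁ : 0 < C₁)
    (hs : 1 ≤ s) (hWs : W ≤ C₁ * s ^ 2) {B : ℝ} (hB : |Real.log y| ≤ B) :
    |Real.log x| ≤ (|Real.log C| + N * (|Real.log C₁| + 2) + 2 * B) * s := by
  have hW0 : 0 < W := by linarith
  have hs0 : 0 < s := by linarith
  have hCW : 0 < C * W ^ N := by positivity
  have e1 := Real.log_le_log (by positivity) h1
  have e2 := Real.log_le_log hx h2
  have e3 := Real.log_le_log hW0 hWs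
  rw [Real.log_mul hCW.ne' hx.ne', Real.log_mul hC.ne' (by positivity), Real.log_pow,
    Real.log_pow] at e1
  rw [Real.log_mul hCW.ne' (by positivity), Real.log_mul hC.ne' (by positivity), Real.log_pow,
    Real.log_pow] at e2
  rw [Real.log_mul hC₁.ne' (by positivity), Real.log_pow] at e3
  push_cast at e1 e2 e3
  have e4 := Real.log_le_sub_one_of_pos hs0
  have e5 : Real.log W ≤ (|Real.log C₁| + 2) * s := by
    have := le_abs_self (Real.log C₁)
    have := mul_le_mul_of_nonneg_left hs (abs_nonneg (Real.log C₁))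
    linarith
  have e6 : N * Real.log W ≤ N * ((|Real.log C₁| + 2) * s) := by gcongr
  have e7 := mul_le_mul_of_nonneg_left hs (abs_nonneg (Real.log C))
  have e8 := mul_le_mul_of_nonneg_left hs ((abs_nonneg _).trans hB)
  have e9 := le_abs_self (Real.log C)
  have e10 := abs_le.1 hB
  rw [abs_le]
  constructor <;> linarith

section Discs

variable {n : ℕ} {X : Type*} [TopologicalSpace X] [ChartedSpace (Coord n) X] {D : Set X}
  {f : ℂ → X} {Ω : Set ℂ}

/-- At a point off `f⁻¹(D)`, the only singularity comes from the zero of the derivative. -/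
lemma exists_isMildAt_of_notMem [IsManifold 𝓘(ℂ, Coord n) ω X] (h : OpenMetric n D)
    (hDo : IsOpen Dᶜ) (hΩ : IsOpen Ω)
    (hf : MDifferentiableOn 𝓘(ℂ, ℂ) 𝓘(ℂ, Coord n) f Ω) {a : ℂ} (ha : a ∈ Ω) (haD : f a ∉ D)
    (hne : ramificationOrder n f a ≠ ⊤) :
    ∃ φ, IsMildAt φ a ∧ ∀ᶠ z in 𝓝[≠] a, logNormSqPushDz h f z
      = φ z + 2 * ((ramificationOrder n f a).toNat : ℝ) * Real.log ‖z - a‖ := by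
  have he : IsLogChart D ((chartAt (Coord n) (f a)).restr Dᶜ) ∅ :=
    isLogChart_restr_compl hDo (f a)
  have hae : f a ∈ ((chartAt (Coord n) (f a)).restr Dᶜ).source := by
    rw [OpenPartialHomeomorph.restr_source, hDo.interior_eq]
    exact ⟨mem_chart_source _ _, haD⟩
  obtain ⟨ξ, hξ, hξ0, hgξ⟩ := (analyticAt_deriv_chartAt hΩ hf ha).analyticOrderAt_ne_top.1 hne
  refine ⟨_, isMildAt_of_contDiffAt
    (laplacian_tautPotential_comp h he hΩ hf ha hae haD hξ hξ0).1, ?_⟩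
  filter_upwards [nhdsWithin_le_nhds hgξ, self_mem_nhdsWithin,
    nhdsWithin_le_nhds (eventually_mem_source hΩ hf ha hDo haD),
    nhdsWithin_le_nhds (eventually_mem_source hΩ hf ha
      ((chartAt (Coord n) (f a)).restr Dᶜ).open_source hae),
    nhdsWithin_le_nhds (hξ.continuousAt.eventually_ne hξ0)] with z h1 h2 h3 h4 h5
  have hza : z - a ≠ 0 := sub_ne_zero.2 h2
  rw [logNormSqPushDz_eq h he hΩ hf h3.1 h4.2 h3.2 (pow_ne_zero _ hza) h5
    (c := (z - a) ^ (ramificationOrder n f a).toNat) (h1.trans (congrArg _ ?_)), norm_pow,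
    Real.log_pow]
  · ring
  · ext i
    simp [logFrame]

/-- At a point of `f⁻¹(D)` the vector `(z - a) f_*(∂/∂z)` is a non-vanishing section of the pullback
of `T_X(-log D)`. The bounds on the metric control its norm, and the lower bound of the Chern form
by the form of Poincaré growth controls the Laplacian. -/
lemma exists_isMildAt_of_mem {h : OpenMetric n D} (hlog : IsLogMetric h) (hΩ : IsOpen Ω)
    (hf : MDifferentiableOn 𝓘(ℂ, ℂ) 𝓘(ℂ, Coord n) f Ω) {a : ℂ} (ha : a ∈ Ω) (haD : f a ∈ D)
    (hne : ∀ᶠ z in 𝓝[≠] a, ¬ f z ∈ D) :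
    ∃ φ, IsMildAt φ a ∧ ∀ᶠ z in 𝓝[≠] a,
      logNormSqPushDz h f z = φ z + (-2) * Real.log ‖z - a‖ := by
  obtain ⟨e, I, he, hae, C, N, hC, hbd⟩ := hlog (f a) haD
  have hg := analyticAt_chart_comp he hΩ hf ha hae
  have hsrc := eventually_mem_source hΩ hf ha e.open_source hae
  have hneI : ∀ i ∈ I, ¬ ∀ᶠ z in 𝓝 a, e (f z) i = 0 := by
    intro i hi h0
    obtain ⟨z, h1, h2⟩ := (hne.and (nhdsWithin_le_nhds (h0.and hsrc))).exists
    exact h1 ((he.2 _ h2.2.2).2 ⟨i, hi, h2.1⟩)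
  obtain ⟨ξ, hξ, hξ0, hgξ⟩ := exists_lift_of_zero hg hneI ((he.2 _ hae).1 haD)
  obtain ⟨C₁, hC₁⟩ := logWeight_le hg hneI
  obtain ⟨C₂, hC₂⟩ := poincareForm_le hg hneI
  have hξlog : ContinuousAt (fun z => |Real.log ‖ξ z‖|) a :=
    (hξ.continuousAt.norm.log (norm_ne_zero_iff.2 hξ0)).abs
  have hξne := hξ.continuousAt.eventually_ne hξ0
  have hbd' := hg.continuousAt.eventually hbd
  refine ⟨fun z => tautPotential h e I (e (f z), ξ z), ⟨⟨|Real.log C|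
    + N * (|Real.log (max C₁ 1)| + 2) + 2 * (|Real.log ‖ξ a‖| + 1), ?_⟩,
    fun z => 4 * Real.pi * (C * C₂) * singularWeight a z, ?_, ?_⟩, ?_⟩
  · filter_upwards [hC₁, hne, nhdsWithin_le_nhds hsrc, nhdsWithin_le_nhds hbd',
      nhdsWithin_le_nhds hξne,
      nhdsWithin_le_nhds (hξlog.eventually (gt_mem_nhds (lt_add_one _)))] with z h1 h2 h3 h4 h5 h6
    have hI := (he.notMem_iff h3.2).1 h2
    obtain ⟨h7, h8⟩ := (h4 hI).1 (ξ z)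
    refine abs_log_le_of_bounds hC ?_ (normSq_logVector_pos h he (e.map_source h3.2) hI h5)
      (norm_pos_iff.2 h5) h7 h8 (by positivity) (one_le_logGrowth a z) (h1.trans ?_) h6.le
    · exact le_add_of_nonneg_right (Finset.sum_nonneg fun _ _ => abs_nonneg _)
    · gcongr
      exact le_max_left _ _
  · exact ⟨ball a 1, ball_mem_nhds a one_pos, (integrableOn_singularWeight a).const_mul _⟩
  · filter_upwards [hC₂, hne, nhdsWithin_le_nhds hsrc, nhdsWithin_le_nhds hbd',
      nhdsWithin_le_nhds hξne, nhdsWithin_le_nhds hξ.eventually_analyticAt] with z h1 h2 h3 h4 h5 h6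
    have hI := (he.notMem_iff h3.2).1 h2
    have h7 := (h4 hI).2 (ξ z) h5 (deriv (fun t => e (f t)) z) (deriv ξ z)
    rw [(laplacian_tautPotential_comp h he hΩ hf h3.1 h3.2 h2 h6 h5).2]
    have h8 := mul_le_mul_of_nonneg_left h1 hC.le
    have h9 := mul_le_mul_of_nonneg_left (h7.trans' (neg_le_neg h8))
      (by positivity : 0 ≤ 4 * Real.pi)
    linarith
  · filter_upwards [nhdsWithin_le_nhds hgξ, self_mem_nhdsWithin, hne, nhdsWithin_le_nhds hsrc,
      nhdsWithin_le_nhds hξne] with z h1 h2 h3 h4 h5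
    have hza : z - a ≠ 0 := sub_ne_zero.2 h2
    rw [logNormSqPushDz_eq h he hΩ hf h4.1 h4.2 h3 (inv_ne_zero hza) h5 (c := (z - a)⁻¹),
      norm_inv, Real.log_inv]
    · ring
    · rw [← h1, inv_smul_smul₀ hza]

lemma log_norm_pushDz (h : OpenMetric n D) {z : ℂ} (hzD : f z ∉ D) :
    Real.log (h.norm (f z) (pushDz n f z)) = 1 / 2 * logNormSqPushDz h f z := by
  have h0 : 0 ≤ h.normSq (f z) (pushDz n f z) := by
    by_cases hv : pushDz n f z = 0
    · rw [hv, OpenMetric.normSq, map_zero]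
      rfl
    · exact (h.normSq_pos hzD hv).le
  rw [OpenMetric.norm, Real.log_sqrt h0, logNormSqPushDz]
  ring

end Discs

/-! ### The tautological formula -/

/-- A finite set with a point-free annulus just outside a given circle. -/
lemma exists_radius_of_finite {s : Set ℂ} (hs : s.Finite) {r R₁ : ℝ} (h : r < R₁) :
    ∃ R, r < R ∧ R < R₁ ∧ ∀ a ∈ s, ‖a‖ < R → ‖a‖ ≤ r := by
  have h1 : ∀ᶠ R in 𝓝[>] r, ∀ a ∈ s, ‖a‖ < R → ‖a‖ ≤ r := by
    rw [eventually_all_finite hs]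
    intro a _
    by_cases ha : ‖a‖ ≤ r
    · exact Eventually.of_forall fun _ _ => ha
    · filter_upwards [nhdsWithin_le_nhds (gt_mem_nhds (not_le.1 ha))] with R hR hR'
      exact absurd hR' hR.le.not_gt
  have h2 : ∀ᶠ R in 𝓝[>] r, R < R₁ := nhdsWithin_le_nhds (gt_mem_nhds h)
  obtain ⟨R, h2, h3, h4⟩ := (h1.and (h2.and self_mem_nhdsWithin)).exists
  exact ⟨R, h4, h3, h2⟩

/-- A sum over the closed disc weighted by `log (r / |a|)` only sees the open disc. -/
lemma finsum_mem_log_div_eq {A : Finset ℂ} {r : ℝ} (hr : 0 < r) (hA0 : (0 : ℂ) ∉ A)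
    (hAr : ∀ a ∈ A, ‖a‖ ≤ r) {p : ℂ → Prop} [DecidablePred p] {b : ℂ → ℝ}
    (hb : ∀ z, ‖z‖ < r → p z → b z ≠ 0 → z ∈ A) :
    ∑ᶠ z ∈ {z : ℂ | 0 < ‖z‖ ∧ ‖z‖ < r ∧ p z}, b z * Real.log (r / ‖z‖)
      = ∑ a ∈ A.filter p, b a * Real.log (r / ‖a‖) := by
  apply finsum_mem_eq_sum_of_inter_support_eq
  ext z
  simp only [mem_inter_iff, Function.mem_support, Finset.coe_filter, mem_ofPred_eq,
    and_congr_left_iff]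
  intro hz
  obtain ⟨hz1, hz2⟩ := mul_ne_zero_iff.1 hz
  constructor
  · rintro ⟨-, h1, h2⟩
    exact ⟨hb z h1 h2 hz1, h2⟩
  · rintro ⟨h1, h2⟩
    refine ⟨norm_pos_iff.2 fun h => hA0 (h ▸ h1), lt_of_le_of_ne (hAr z h1) fun h => hz2 ?_, h2⟩
    rw [h, div_self hr.ne', Real.log_one]

end LogDisc

theorem mainTheorem2 {n : ℕ} {X : Type*} [TopologicalSpace X]
    [ChartedSpace (LogDisc.Coord n) X] [IsManifold 𝓘(ℂ, LogDisc.Coord n) ω X]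
    (D : Set X) (hD : LogDisc.IsLogSmooth n D)
    (h : LogDisc.OpenMetric n D) (hlog : LogDisc.IsLogMetric h)
    (f : ℂ → X)
    (hf : MDifferentiableOn 𝓘(ℂ, ℂ) 𝓘(ℂ, LogDisc.Coord n) f (Metric.ball (0 : ℂ) 1))
    (hf0 : f 0 ∉ D) (hram : LogDisc.pushDz n f 0 ≠ 0)
    (r : ℝ) (hr0 : 0 < r) (hr1 : r < 1) :
    -- every term of the formula is meaningful
    MeasureTheory.IntegrableOn (LogDisc.pullbackChern h f) (Metric.ball (0 : ℂ) r) ∧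
    IntervalIntegrable
      (fun t : ℝ => (1 / t) * ∫ z in Metric.ball (0 : ℂ) t, LogDisc.pullbackChern h f z)
      MeasureTheory.volume 0 r ∧
    CircleIntegrable (fun z => Real.log (h.norm (f z) (LogDisc.pushDz n f z))) 0 r ∧
    {z : ℂ | ‖z‖ < r ∧ LogDisc.boundaryOrder n D f z ≠ 0}.Finite ∧
    {z : ℂ | ‖z‖ < r ∧ LogDisc.ramificationOrder n f z ≠ 0}.Finite ∧
    (∀ z : ℂ, ‖z‖ < r →
      LogDisc.boundaryOrder n D f z ≠ ⊤ ∧ LogDisc.ramificationOrder n f z ≠ ⊤) ∧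
    -- the formula
    LogDisc.doubleIntegral (LogDisc.pullbackChern h f) r =
      -Real.log (h.norm (f 0) (LogDisc.pushDz n f 0))
      + Real.circleAverage (fun z => Real.log (h.norm (f z) (LogDisc.pushDz n f z))) 0 r
      + (∑ᶠ z ∈ {z : ℂ | 0 < ‖z‖ ∧ ‖z‖ < r},
          ((min 1 (LogDisc.boundaryOrder n D f z)).toNat : ℝ) * Real.log (r / ‖z‖))
      - (∑ᶠ z ∈ {z : ℂ | 0 < ‖z‖ ∧ ‖z‖ < r ∧ f z ∉ D},
          ((LogDisc.ramificationOrder n f z).toNat : ℝ) * Real.log (r / ‖z‖)) := by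
  classical
  have hDo : IsOpen Dᶜ := LogDisc.isOpen_compl_of_isLogSmooth hD
  have hΩ : IsOpen (ball (0 : ℂ) 1) := isOpen_ball
  have hconn : IsPreconnected (ball (0 : ℂ) 1) := (convex_ball 0 1).isPreconnected
  have h0Ω : (0 : ℂ) ∈ ball (0 : ℂ) 1 := mem_ball_self one_pos
  have hmem : ∀ {z : ℂ}, ‖z‖ < 1 → z ∈ ball (0 : ℂ) 1 := fun hz => by simpa using hz
  have hQD : ∀ z ∈ ball (0 : ℂ) 1, ∀ᶠ y in 𝓝[≠] z, ¬ f y ∈ D := fun z hz =>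
    LogDisc.eventually_not_of_isPreconnected hconn
      (fun w hw => LogDisc.mem_boundary_or hD hΩ hf hw) h0Ω hf0 hz
  have hQP : ∀ z ∈ ball (0 : ℂ) 1, ∀ᶠ y in 𝓝[≠] z, ¬ LogDisc.pushDz n f y = 0 := fun z hz =>
    LogDisc.eventually_not_of_isPreconnected hconn
      (fun w hw => LogDisc.pushDz_eq_zero_or hΩ hf hw) h0Ω hram hz
  have hord : ∀ z : ℂ, ‖z‖ < 1 →
      LogDisc.boundaryOrder n D f z ≠ ⊤ ∧ LogDisc.ramificationOrder n f z ≠ ⊤ := fun z hz =>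
    ⟨LogDisc.boundaryOrder_ne_top hD hΩ hf (hmem hz) (hQD z (hmem hz)),
      LogDisc.ramificationOrder_ne_top hΩ hf (hmem hz) (hQP z (hmem hz))⟩
  -- the exceptional points, in a disc slightly larger than the given one
  obtain ⟨R₁, hrR₁, hR₁⟩ := exists_between hr1
  have hS : {z | z ∈ closedBall (0 : ℂ) R₁ ∧ (f z ∈ D ∨ LogDisc.pushDz n f z = 0)}.Finite := by
    refine LogDisc.finite_inter_of_eventually_not (isCompact_closedBall 0 R₁) fun z hz => ?_
    have hz1 := closedBall_subset_ball hR₁ hz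
    filter_upwards [hQD z hz1, hQP z hz1] with y h1 h2 h3 using h3.elim h1 h2
  obtain ⟨R, hrR, hRR₁, hR⟩ := LogDisc.exists_radius_of_finite hS hrR₁
  obtain ⟨A, hmemA⟩ : ∃ A : Finset ℂ,
      ∀ a, a ∈ A ↔ ‖a‖ ≤ r ∧ (f a ∈ D ∨ LogDisc.pushDz n f a = 0) := by
    refine ⟨hS.toFinset.filter fun a => ‖a‖ ≤ r, fun a => ?_⟩
    simp only [Finset.mem_filter, Finite.mem_toFinset, mem_ofPred_eq, mem_closedBall,
      dist_zero_right]
    exact ⟨fun h => ⟨h.2, h.1.2⟩, fun h => ⟨⟨h.1.trans hrR₁.le, h.2⟩, h.1⟩⟩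
  have hA0 : (0 : ℂ) ∉ A := fun h => ((hmemA _).1 h).2.elim hf0 hram
  have hAr : ∀ a ∈ A, ‖a‖ ≤ r := fun a ha => ((hmemA _).1 ha).1
  have hregR : ∀ z ∈ ball (0 : ℂ) R \ A, z ∈ ball (0 : ℂ) 1 ∧ f z ∉ D ∧
      LogDisc.pushDz n f z ≠ 0 := by
    rintro z ⟨hz, hzA⟩
    rw [mem_ball_zero_iff] at hz
    have h2 : ¬ (f z ∈ D ∨ LogDisc.pushDz n f z = 0) := fun h2 => hzA <| (hmemA _).2
      ⟨hR z ⟨by simpa using (hz.trans hRR₁).le, h2⟩ hz, h2⟩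
    exact ⟨hmem (hz.trans (hRR₁.trans hR₁)), not_or.1 h2⟩
  have hbA : ∀ z : ℂ, ‖z‖ < r → f z ∈ D → z ∈ A := fun z hz h1 => (hmemA _).2 ⟨hz.le, Or.inl h1⟩
  have hrA : ∀ z : ℂ, ‖z‖ < r → LogDisc.ramificationOrder n f z ≠ 0 → z ∈ A := fun z hz h1 =>
    (hmemA _).2 ⟨hz.le, Or.inr (LogDisc.pushDz_eq_zero_of_ramificationOrder_ne_zero hΩ hf
      (hmem (hz.trans hr1)) h1)⟩
  -- the coefficients of `log |z - a|` in `log ‖f_*(∂/∂z)‖²`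
  set m : ℂ → ℝ := fun a => if f a ∈ D then -2 else
    2 * ((LogDisc.ramificationOrder n f a).toNat : ℝ) with hm
  obtain ⟨hI1, hI2, hI3, hJ⟩ := LogDisc.jensen_of_isMildAt hr0 hrR
    (U := LogDisc.logNormSqPushDz h f) (u := LogDisc.pullbackChern h f) m hA0 hAr
    (fun z hz => by
      obtain ⟨h1, h2, h3⟩ := hregR z hz
      exact (LogDisc.pullbackChern_eq h hDo hΩ hf h1 h2 h3).1.contDiffWithinAt)
    (fun a ha => by
      have ha1 := hmem ((hAr a ha).trans_lt hr1)
      by_cases haD : f a ∈ D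
      · simpa only [hm, if_pos haD] using
          LogDisc.exists_isMildAt_of_mem hlog hΩ hf ha1 haD (hQD a ha1)
      · simpa only [hm, if_neg haD] using LogDisc.exists_isMildAt_of_notMem h hDo hΩ hf ha1 haD
          (hord a ((hAr a ha).trans_lt hr1)).2)
    (fun z hz => by
      obtain ⟨h1, h2, h3⟩ := hregR z ⟨ball_subset_ball hrR.le hz.1, hz.2⟩
      exact (LogDisc.pullbackChern_eq h hDo hΩ hf h1 h2 h3).2)
  -- On the circle, the logarithm of the norm is half of the logarithm of its square, except
  -- possibly at the points that `f` maps to `D`, where the metric has arbitrary values.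
  have hcirc : ∀ᵐ θ : ℝ, 1 / 2 * LogDisc.logNormSqPushDz h f (circleMap 0 r θ)
      = Real.log (h.norm (f (circleMap 0 r θ)) (LogDisc.pushDz n f (circleMap 0 r θ))) := by
    filter_upwards [LogDisc.ae_circleMap_notMem hr0 A] with θ hθ
    refine (LogDisc.log_norm_pushDz h fun hD' => hθ ((hmemA _).2 ⟨?_, Or.inl hD'⟩)).symm
    simp [abs_of_pos hr0]
  have havg : Real.circleAverage
      (fun z => Real.log (h.norm (f z) (LogDisc.pushDz n f z))) 0 r
      = 1 / 2 * Real.circleAverage (LogDisc.logNormSqPushDz h f) 0 r := by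
    rw [Real.circleAverage_def, Real.circleAverage_def, smul_eq_mul, smul_eq_mul, mul_left_comm,
      ← intervalIntegral.integral_const_mul (1 / 2)]
    congr 1
    exact intervalIntegral.integral_congr_ae (hcirc.mono fun θ hθ _ => hθ.symm)
  refine ⟨hI1, hI2, ?_, A.finite_toSet.subset ?_, A.finite_toSet.subset ?_,
    fun z hz => hord z (hz.trans hr1), ?_⟩
  · exact IntervalIntegrable.congr_ae (hI3.const_mul (1 / 2)) (ae_restrict_of_ae hcirc)
  · rintro z ⟨hz, h1⟩
    exact hbA z hz (by_contra fun h2 => h1 (LogDisc.boundaryOrder_eq_zero hD h2))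
  · rintro z ⟨hz, h1⟩
    exact hrA z hz h1
  have hsum1 := LogDisc.finsum_mem_log_div_eq hr0 hA0 hAr (p := fun _ => True)
    (b := fun z => ((min 1 (LogDisc.boundaryOrder n D f z)).toNat : ℝ)) (fun z hz _ h1 =>
      hbA z hz (by_contra fun h2 => h1 (by simp [LogDisc.boundaryOrder_eq_zero hD h2])))
  have hsum2 := LogDisc.finsum_mem_log_div_eq hr0 hA0 hAr (p := fun z => f z ∉ D)
    (b := fun z => ((LogDisc.ramificationOrder n f z).toNat : ℝ)) (fun z hz _ h1 =>
      hrA z hz fun h2 => h1 (by simp [h2]))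
  simp only [and_true, Finset.filter_true] at hsum1
  rw [hJ, havg, LogDisc.log_norm_pushDz h hf0, hsum1, hsum2]
  have hmA : ∑ a ∈ A, m a * Real.log (r / ‖a‖)
      = 2 * ∑ a ∈ A.filter fun z => f z ∉ D,
          ((LogDisc.ramificationOrder n f a).toNat : ℝ) * Real.log (r / ‖a‖)
        - 2 * ∑ a ∈ A,
          ((min 1 (LogDisc.boundaryOrder n D f a)).toNat : ℝ) * Real.log (r / ‖a‖) := by
    rw [Finset.sum_filter, Finset.mul_sum, Finset.mul_sum, ← Finset.sum_sub_distrib]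
    refine Finset.sum_congr rfl fun a ha => ?_
    rw [LogDisc.toNat_min_one_boundaryOrder hD hΩ hf (hmem ((hAr a ha).trans_lt hr1)), hm]
    by_cases haD : f a ∈ D
    · simp [haD]
    · simp [haD, mul_assoc]
  rw [hmA]
  ring
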